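/- Let $\mathbb{F}_q$ be a finite field with $q$ elements, of odd characteristic, let $K=\mathbb{F}_q(t)$, let $\gamma\in\mathbb{F}_q^\times$ and let $a\ge 1$ be an integer. Let $E_{\gamma,a}$ be the elliptic curve over $K$ with Weierstrass equation $$y^2=x^3+(t^{q^a}-t)\,x^2+\gamma x .$$ For a place $v$ of $K$ let $\mathbb{F}_v$ be the residue field and $\deg v=[\mathbb{F}_v:\mathbb{F}_q]$. Let $\widetilde E_v$ be the plane cubic over $\mathbb{F}_v$ obtained by reducing a minimal Weierstrass equation of $E=E_{\gamma,a}$ at $v$, and put $a_v=|\mathbb{F}_v|+1-|\widetilde E_v(\mathbb{F}_v)|$. The $L$-function of $E$ is the formal power series $L(E,T)=\prod_v L_v(E,T)^{-1}$, the product being over all places $v$ of $K$ (including $\infty$), where $L_v(E,T)=1-a_vT^{\deg v}+q^{\deg v}T^{2\deg v}$ if $E$ has good reduction at $v$, and $L_v(E,T)=1-a_vT^{\deg v}$ otherwise. Let $P_q(a)$ be the (finite) set of places $v\ne 0,\infty$ of $K$ with $\deg v\mid a$. Fix a nontrivial additive character $\psi_q:\mathbb{F}_q\to\overline{\mathbb{Q}}^\times$.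 For $v\in P_q(a)$ let $\beta_v\in\mathbb{F}_v^\times$ be the residue class of $t$ at $v$, and let $\psi_v(x)=\psi_q(\mathrm{Tr}_{\mathbb{F}_v/\mathbb{F}_q}(\beta_v x))$ for $x\in\mathbb{F}_v$. Put $$\mathsf g(v)=-\sum_{x\in\mathbb{F}_v}\lambda_v(x)\psi_v(x),\qquad \mathsf{Kl}_\gamma(v)=-\sum_{x\in\mathbb{F}_v^\times}\psi_v\!\left(x+\frac{\gamma}{x}\right),$$ where $\lambda_v$ is the quadratic character of $\mathbb{F}_v^\times$, extended by $\lambda_v(0)=0$. There is a unique unordered pair $\{\mathsf{kl}_\gamma(v),\mathsf{kl}'_\gamma(v)\}$ of algebraic integers whose product is $|\mathbb{F}_v|$ and such that, for every finite extension $\mathbb{F}'/\mathbb{F}_v$, $$-\sum_{x\in\mathbb{F}'^\times}\psi_v\!\left(\mathrm{Tr}_{\mathbb{F}'/\mathbb{F}_v}\!\left(x+\frac{\gamma}{x}\right)\right)=\mathsf{kl}_\gamma(v)^{[\mathbb{F}':\mathbb{F}_v]}+\mathsf{kl}'_\gamma(v)^{[\mathbb{F}':\mathbb{F}_v]}.$$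 Then $L(E_{\gamma,a},T)$ is a polynomial with integral coefficients, and $$L(E_{\gamma,a},T)=\prod_{v\in P_q(a)}\bigl(1-\mathsf g(v)\,\mathsf{kl}_\gamma(v)\,T^{\deg v}\bigr)\bigl(1-\mathsf g(v)\,\mathsf{kl}'_\gamma(v)\,T^{\deg v}\bigr).$$ Equivalently, $$L(E_{\gamma,a},T)=\prod_{v\in P_q(a)}\bigl(1-\mathsf g(v)\,\mathsf{Kl}_\gamma(v)\,T^{\deg v}+\mathsf g(v)^2q^{\deg v}\,T^{2\deg v}\bigr).$$ -/

import Mathlib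

universe u

open Polynomial
open scoped PowerSeries PowerSeries.WithPiTopology

noncomputable section

namespace EllipticL

/-! ### Places of a function field -/

/-- A place of a function field `K` with constant field `F`: a discrete valuation ring with
fraction field `K` which contains the constants. -/
@[ext]
structure Place (F K : Type u) [Field F] [Field K] [Algebra F K] where
  /-- The valuation ring of the place. -/
  ring : ValuationSubring K
  algebraMap_mem : ∀ c : F, algebraMap F K c ∈ ring
  isDVR : IsDiscreteValuationRing ring

namespace Place

variable {F K : Type u} [Field F] [Field K] [Algebra F K]

instance (v : Place F K) : IsDiscreteValuationRing v.ring := v.isDVR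

/-- The inclusion of the constant field in the valuation ring of a place. -/
instance (v : Place F K) : Algebra F v.ring :=
  ((algebraMap F K).codRestrict v.ring.toSubring v.algebraMap_mem).toAlgebra

/-- The residue field of a place. -/
abbrev residueField (v : Place F K) : Type u := IsLocalRing.ResidueField v.ring

/-- The degree of a place: the degree of its residue field over the constant field. -/
def degree (v : Place F K) : ℕ := Module.finrank F v.residueField

lemma coe_algebraMap (v : Place F K) (c : F) :
    ((algebraMap F v.ring c : v.ring) : K) = algebraMap F K c := rfl

lemma coe_aeval (v : Place F K) (y : v.ring) (f : F[X]) :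
    ((aeval y f : v.ring) : K) = aeval (y : K) f := by
  have h : v.ring.subtype.comp (aeval y : F[X] →ₐ[F] v.ring).toRingHom
      = (aeval (y : K) : F[X] →ₐ[F] K).toRingHom := by
    apply Polynomial.ringHom_ext
    · intro c
      simp [coe_algebraMap]
    · simp
  exact congrArg (fun φ : F[X] →+* K => φ f) h

lemma exists_coprime_factors (f g : F[X]) :
    ∃ d f' g' : F[X], IsCoprime f' g' ∧ f = d * f' ∧ g = d * g' := by
  classical
  by_cases hg : g = 0
  · exact ⟨f, 1, 0, isCoprime_one_left, by simp, by simp [hg]⟩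
  · let _ := EuclideanDomain.gcdMonoid F[X]
    have hd : GCDMonoid.gcd f g ≠ 0 := fun h => hg ((gcd_eq_zero_iff f g).mp h).2
    exact ⟨GCDMonoid.gcd f g, f / GCDMonoid.gcd f g, g / GCDMonoid.gcd f g,
      isCoprime_div_gcd_div_gcd hg,
      (EuclideanDomain.mul_div_cancel' hd (GCDMonoid.gcd_dvd_left f g)).symm,
      (EuclideanDomain.mul_div_cancel' hd (GCDMonoid.gcd_dvd_right f g)).symm⟩

/-- If `K` consists of the fractions `f(y) / g(y)` for some `y` in the valuation ring, then the
residue field is generated by the residue class of `y`; it is finite when `F` is. -/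
lemma finite_residueField_of_generator [Finite F] (v : Place F K) (y : v.ring)
    (hy : ∀ z : K, ∃ f g : F[X], aeval (y : K) g ≠ 0 ∧ z * aeval (y : K) g = aeval (y : K) f) :
    Finite v.residueField := by
  let φ : F[X] →+* v.residueField :=
    (IsLocalRing.residue v.ring).comp (aeval y : F[X] →ₐ[F] v.ring).toRingHom
  have hφ (f : F[X]) : φ f = IsLocalRing.residue v.ring (aeval y f) := rfl
  have hker : ∃ p : F[X], p ≠ 0 ∧ φ p = 0 := by
    by_contra! hcon
    apply IsDiscreteValuationRing.not_isField v.ring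
    refine ⟨⟨0, 1, zero_ne_one⟩, mul_comm, fun {a} ha => ?_⟩
    have ha' : (a : K) ≠ 0 := by simpa using ha
    obtain ⟨f, g, hg, hfg⟩ := hy ((a : K)⁻¹)
    have hg0 : g ≠ 0 := by rintro rfl; simp at hg
    have hu : IsUnit (aeval y g) := by
      by_contra hnu
      exact hcon g hg0 (by
        rw [hφ, IsLocalRing.residue_eq_zero_iff]; exact hnu)
    obtain ⟨w, hw⟩ := hu.exists_right_inv
    refine ⟨aeval y f * w, ?_⟩
    apply Subtype.ext
    have hw' : aeval (y : K) g * (w : K) = 1 := by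
      rw [← coe_aeval, ← MulMemClass.coe_mul, hw]; rfl
    rw [MulMemClass.coe_mul, MulMemClass.coe_mul, coe_aeval, ← hfg]
    rw [mul_assoc, hw', mul_one, mul_inv_cancel₀ ha']; rfl
  obtain ⟨p, hp0, hp⟩ := hker
  let b₀ : v.residueField := IsLocalRing.residue v.ring y
  have hφ' (f : F[X]) : φ f = aeval b₀ f := by
    rw [hφ]
    exact (aeval_algebraMap_apply v.residueField y f).symm
  have hint : IsIntegral F b₀ :=
    (isAlgebraic_iff_isIntegral).mp ⟨p, hp0, by rw [← hφ', hp]⟩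
  let S : IntermediateField F v.residueField := IntermediateField.adjoin F {b₀}
  have hfd : FiniteDimensional F S := IntermediateField.adjoin.finiteDimensional hint
  have hmem (f : F[X]) : φ f ∈ S := by
    rw [hφ']
    exact IntermediateField.algebra_adjoin_le_adjoin F _ (aeval_mem_adjoin_singleton F b₀)
  have hall (b : v.residueField) : b ∈ S := by
    obtain ⟨a, rfl⟩ := IsLocalRing.residue_surjective b
    obtain ⟨f, g, hg, hfg⟩ := hy (a : K)
    have hg0 : g ≠ 0 := by rintro rfl; simp at hg
    obtain ⟨d, f', g', hd, hcop, rfl, rfl⟩ : ∃ d f' g' : F[X], d ≠ 0 ∧ IsCoprime f' g' ∧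
        f = d * f' ∧ g = d * g' := by
      obtain ⟨d, f', g', hcop, hf, hg'⟩ := exists_coprime_factors f g
      refine ⟨d, f', g', ?_, hcop, hf, hg'⟩
      rintro rfl
      simp [hg'] at hg0
    have hdy : aeval (y : K) d ≠ 0 := by
      intro h; simp [h] at hg
    have hK : (a : K) * aeval (y : K) g' = aeval (y : K) f' := by
      apply mul_left_cancel₀ hdy
      rw [map_mul, map_mul] at hfg
      rw [← hfg]; ring
    have hA : a * aeval y g' = aeval y f' := by
      apply Subtype.ext
      rw [MulMemClass.coe_mul, coe_aeval, coe_aeval, hK]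
    have hb : IsLocalRing.residue v.ring a * φ g' = φ f' := by
      rw [hφ, hφ, ← map_mul, hA]
    have hg' : φ g' ≠ 0 := by
      intro h0
      obtain ⟨r, s, hrs⟩ := hcop
      have := congrArg φ hrs
      rw [map_add, map_mul, map_mul, ← hb, h0] at this
      simp at this
    rw [eq_div_of_mul_eq hg' hb]
    exact S.div_mem (hmem _) (hmem _)
  have hS : Finite S := Module.finite_of_finite F
  exact Finite.of_injective (fun b : v.residueField => (⟨b, hall b⟩ : S))
    (fun x z h => congrArg Subtype.val h)

/-- The residue fields of a rational function field over a finite field are finite. -/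
instance [Finite F] (v : Place F (RatFunc F)) : Finite v.residueField := by
  have hfrac (z : RatFunc F) : ∃ f g : F[X], aeval (RatFunc.X : RatFunc F) g ≠ 0 ∧
      z * aeval (RatFunc.X : RatFunc F) g = aeval (RatFunc.X : RatFunc F) f := by
    have haev (f : F[X]) : aeval (RatFunc.X : RatFunc F) f = algebraMap F[X] (RatFunc F) f := by
      rw [← RatFunc.algebraMap_X, aeval_algebraMap_apply, aeval_X_left_apply]
    refine ⟨z.num, z.denom, ?_, ?_⟩
    · rw [haev]
      exact RatFunc.algebraMap_ne_zero z.denom_ne_zero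
    · rw [haev, haev]
      nth_rewrite 1 [← RatFunc.num_div_denom z]
      exact div_mul_cancel₀ _ (RatFunc.algebraMap_ne_zero z.denom_ne_zero)
  rcases v.ring.mem_or_inv_mem RatFunc.X with h | h
  · exact v.finite_residueField_of_generator ⟨RatFunc.X, h⟩ hfrac
  · refine v.finite_residueField_of_generator ⟨_, h⟩ fun z => ?_
    obtain ⟨f, g, hg, hfg⟩ := hfrac z
    let N := max f.natDegree g.natDegree
    have hX : (RatFunc.X : RatFunc F) ≠ 0 := RatFunc.X_ne_zero
    let _ : Invertible (RatFunc.X : RatFunc F) := invertibleOfNonzero hX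
    have key (f : F[X]) (hf : f.natDegree ≤ N) :
        aeval (RatFunc.X⁻¹ : RatFunc F) (reflect N f) * RatFunc.X ^ N
          = aeval (RatFunc.X : RatFunc F) f := by
      have := eval₂_reflect_mul_pow (algebraMap F (RatFunc F)) RatFunc.X N f hf
      rwa [invOf_eq_inv] at this
    have hf := key f (le_max_left _ _)
    have hg1 := key g (le_max_right _ _)
    refine ⟨reflect N f, reflect N g, ?_, ?_⟩
    · intro h0
      exact hg (by rw [← hg1]; simp [h0])
    · apply mul_right_cancel₀ (pow_ne_zero N hX)
      rw [mul_assoc]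
      exact (by rw [hf]; rw [← hfg, ← hg1])

end Place

/-! ### The `L`-function of an elliptic curve over a function field -/

section LFunction

variable {F K : Type u} [Field F] [Field K] [Algebra F K]

/-- The number of rational points of the projective plane cubic defined by a Weierstrass equation,
smooth or not: the solutions of the affine equation and the point at infinity. -/
def numPoints {k : Type u} [Field k] (W : WeierstrassCurve k) : ℕ :=
  Nat.card {P : k × k // W.toAffine.Equation P.1 P.2} + 1

/-- The reduction of `E` at a place: the reduction of a minimal Weierstrass equation of `E`. -/
def reductionAt (E : WeierstrassCurve K) (v : Place F K) : WeierstrassCurve v.residueField :=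
  (E.minimal v.ring).reduction v.ring

/-- `a_v(E) = |F_v| + 1 - |Ẽ_v(F_v)|`. -/
def traceAt (E : WeierstrassCurve K) (v : Place F K) : ℤ :=
  (Nat.card v.residueField : ℤ) + 1 - numPoints (reductionAt E v)

open Classical in
/-- The local factor of the `L`-function at a place, as a polynomial in `T`. -/
def localFactor (E : WeierstrassCurve K) (v : Place F K) : ℤ[X] :=
  if (E.minimal v.ring).HasGoodReduction v.ring then
    1 - C (traceAt E v) * X ^ v.degree + C ((Nat.card F : ℤ) ^ v.degree) * X ^ (2 * v.degree)
  else
    1 - C (traceAt E v) * X ^ v.degree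

/-- The inverse of the local factor at a place, as a formal power series. -/
def eulerFactor (E : WeierstrassCurve K) (v : Place F K) : ℤ⟦X⟧ :=
  PowerSeries.invOfUnit (localFactor E v : ℤ⟦X⟧) 1

/-- The `L`-function of `E`, as a formal power series: the inverse product of the local factors at
all places. The product is the unconditional one for coefficientwise convergence. -/
def lFunction (F : Type u) {K : Type u} [Field F] [Field K] [Algebra F K]
    (E : WeierstrassCurve K) : ℤ⟦X⟧ :=
  ∏' v : Place F K, eulerFactor E v

end LFunction

/-! ### The Artin--Schreier family -/

section Family

variable {F : Type u} [Field F]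

/-- The rational function `t ^ (q ^ a) - t`, where `q = |F|`. -/
def artinSchreier (F : Type u) [Field F] (a : ℕ) : RatFunc F :=
  RatFunc.X ^ (Nat.card F ^ a) - RatFunc.X

/-- The curve `y² = x³ + (t ^ (q ^ a) - t) x² + γ x` over `F(t)`. -/
def curveE (γ : F) (a : ℕ) : WeierstrassCurve (RatFunc F) where
  a₁ := 0
  a₂ := artinSchreier F a
  a₃ := 0
  a₄ := RatFunc.C γ
  a₆ := 0

/-- The places of `F(t)` other than `0` and `∞` (that is, at which `t` is a unit) whose degree
divides `a`. -/
def placesDividing (F : Type u) [Field F] (a : ℕ) : Set (Place F (RatFunc F)) :=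
  {v | (RatFunc.X : RatFunc F) ∈ v.ring ∧ (RatFunc.X : RatFunc F)⁻¹ ∈ v.ring ∧ v.degree ∣ a}

open Classical in
/-- The coordinate in `F_v` of a place `v ≠ ∞`: the residue class of `t` (and `0` at `∞`). For `v`
viewed as a Galois orbit of geometric points of the affine line, it is an element of that orbit. -/
def Place.coord (v : Place F (RatFunc F)) : v.residueField :=
  if h : (RatFunc.X : RatFunc F) ∈ v.ring then IsLocalRing.residue v.ring ⟨RatFunc.X, h⟩ else 0

end Family

/-! ### Character sums -/

section Sums

/-- An algebraic closure of the field of rational numbers. -/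
abbrev QBar : Type := AlgebraicClosure ℚ

variable {k : Type u} [Field k] [Finite k]

open Classical in
/-- The quadratic Gauss sum, normalised as `-∑ x, λ(x) ψ(x)`. -/
def quadGauss (ψ : AddChar k QBar) : QBar :=
  -(letI := Fintype.ofFinite k; ∑ x : k, (quadraticChar k x : QBar) * ψ x)

open Classical in
/-- The Kloosterman sum, normalised as `-∑ x ≠ 0, ψ(x + α / x)`. -/
def kloosterman (ψ : AddChar k QBar) (α : k) : QBar :=
  -(letI := Fintype.ofFinite k; ∑ x : kˣ, ψ ((x : k) + α / (x : k)))

/-- The additive character `x ↦ ψ(Tr(β x))` of an extension `k'` of `k`, for `β ∈ k'`. -/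
def liftChar {k : Type u} [Field k] (ψ : AddChar k QBar)
    {k' : Type u} [Field k'] [Algebra k k'] (β : k') : AddChar k' QBar :=
  (ψ.compAddMonoidHom (Algebra.trace k k').toAddMonoidHom).mulShift β

/-- `{κ, κ'}` is the pair of algebraic integers attached to the Kloosterman sum with character `ψ`
and parameter `α`: their product is `|k|`, and the sums of their powers are the Kloosterman sums
over all the finite extensions of `k`. -/
structure IsKloostermanPair (ψ : AddChar k QBar) (α : k) (κ κ' : QBar) : Prop where
  isIntegral_left : IsIntegral ℤ κ
  isIntegral_right : IsIntegral ℤ κ'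
  mul_eq : κ * κ' = (Nat.card k : QBar)
  pow_add_pow_eq : ∀ (k' : Type u) [Field k'] [Finite k'] [Algebra k k'],
    kloosterman (liftChar ψ (1 : k')) (algebraMap k k' α) =
      κ ^ Module.finrank k k' + κ' ^ Module.finrank k k'

variable {F : Type u} [Field F]

/-- The additive character `x ↦ ψ(Tr(β_v x))` of `F_v`. -/
def placeChar (ψ : AddChar F QBar) (v : Place F (RatFunc F)) : AddChar v.residueField QBar :=
  liftChar ψ v.coord

variable [Finite F]

/-- The quadratic Gauss sum `g(v)`. -/
def gaussAt (ψ : AddChar F QBar) (v : Place F (RatFunc F)) : QBar :=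
  quadGauss (placeChar ψ v)

/-- The Kloosterman sum `Kl_γ(v)`. -/
def kloostermanAt (ψ : AddChar F QBar) (γ : F) (v : Place F (RatFunc F)) : QBar :=
  kloosterman (placeChar ψ v) (algebraMap F v.residueField γ)

/-- `{κ, κ'}` is the pair `{kl_γ(v), kl'_γ(v)}` attached to the Kloosterman sum `Kl_γ(v)`. -/
def IsKloostermanPairAt (ψ : AddChar F QBar) (γ : F) (v : Place F (RatFunc F))
    (κ κ' : QBar) : Prop :=
  IsKloostermanPair (placeChar ψ v) (algebraMap F v.residueField γ) κ κ'

end Sums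

end EllipticL

open EllipticL

set_option linter.unusedSectionVars false

/-! Both sides are power series with constant term 1, so over a domain of characteristic zero it
suffices to compare their logarithmic derivatives `T·L'/L`, one coefficient at a time. Fix n, let L
be the extension of degree n of F = F_q, and put Q = q^a. Let λ be the quadratic character of L and
Ψ = ψ ∘ Tr.

Geometric side. At a place of the affine line either c₄ or Δ of the given equation is a unit, so the
equation is minimal; at infinity a rescaling gives a minimal equation with cuspidal reduction y² =
x³, and the local factor is 1. Elements of L are the geometric points above affine places of degree
dividing n. Since point counts of y² = x³ + Ax² + γx over all extensions are governed by a
polynomial of degree at most 2, the n-th coefficient is -∑_β ∑_x λ(x³ + (β^Q - β)x² + γx)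
(`exists_hasProd_eulerFactor`).

Fourier side. For x ≠ 0 the summand is λ(x + γ/x + β^Q - β). Expand λ in additive characters by
means of the Gauss sum. The sum over β of Ψ(c(β^Q - β)) is |L| if c^Q = c and 0 otherwise, because
the Q-th power map preserves Ψ (`sum_addChar_pow_sub`). What remains is a sum over nonzero c with
c^Q = c of a Gauss sum times a Kloosterman sum (`sum_quadraticChar_cubic_family`). Such c are
exactly the geometric points above the places of P_q(a) of degree dividing n. By Hasse-Davenport and
its Kloosterman analogue the two sums are g(v)^m and kl(v)^m + kl'(v)^m with m = n / deg v; each v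
has deg v geometric points, and this is the coefficient for the product of the theorem.

The three facts over finite fields (Hasse-Davenport, Kloosterman, point counts) share one mechanism.
A function χ on monic polynomials, multiplicative and depending on few coefficients, has a series ∑
χ(f) T^deg f which is a polynomial, because the sum over monic f of large degree vanishes. Its
logarithmic derivative (`X_mul_derivative_monicSum`) has as n-th coefficient the sum of χ over
characteristic polynomials of elements of L.

Integrality costs nothing: the Euler product lives in ℤ⟦T⟧, and its image over the algebraic closure
of ℚ is a polynomial. -/

namespace EllipticL

/-! ### Monic polynomials over a finite field and their Euler products. -/

section MonicPolynomials

open Finset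

variable (k : Type*) [Field k] [Fintype k]

open Classical in
/-- The monic polynomials of degree `n` over a finite field. -/
def monicFinset : ℕ → Finset k[X]
  | 0 => {1}
  | n + 1 => (monicFinset n ×ˢ univ).image fun p : k[X] × k => X * p.1 + C p.2

variable {k}

lemma monic_X_mul_add_C {g : k[X]} (hg : g.Monic) (b : k) : (X * g + C b).Monic := by
  refine (monic_X.mul hg).add_of_left ?_
  refine lt_of_le_of_lt degree_C_le ?_
  rw [degree_mul, degree_X, degree_eq_natDegree hg.ne_zero]
  norm_cast
  omega

lemma natDegree_X_mul_add_C {g : k[X]} (hg : g.Monic) (b : k) :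
    (X * g + C b).natDegree = g.natDegree + 1 := by
  rw [natDegree_add_C, natDegree_X_mul hg.ne_zero]

lemma mem_monicFinset {n : ℕ} {f : k[X]} :
    f ∈ monicFinset k n ↔ f.Monic ∧ f.natDegree = n := by
  induction n generalizing f with
  | zero =>
    rw [monicFinset, mem_singleton]
    exact ⟨by rintro rfl; simp, fun ⟨h, h'⟩ => eq_one_of_monic_natDegree_zero h h'⟩
  | succ n ih =>
    simp only [monicFinset, mem_image, mem_product, mem_univ, and_true, Prod.exists]
    constructor
    · rintro ⟨g, b, hg, rfl⟩
      obtain ⟨hm, rfl⟩ := ih.mp hg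
      exact ⟨monic_X_mul_add_C hm b, natDegree_X_mul_add_C hm b⟩
    · rintro ⟨hm, hd⟩
      refine ⟨f.divX, f.coeff 0, ih.mpr ⟨?_, ?_⟩, X_mul_divX_add f⟩
      · rw [Monic, leadingCoeff, natDegree_divX_eq_natDegree_tsub_one, coeff_divX, hd,
          Nat.add_sub_cancel, ← hd]
        exact hm
      · rw [natDegree_divX_eq_natDegree_tsub_one, hd, Nat.add_sub_cancel]

lemma sum_monicFinset_zero {R : Type*} [AddCommMonoid R] (F : k[X] → R) :
    ∑ f ∈ monicFinset k 0, F f = F 1 := by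
  simp [monicFinset]

/-- Peels off the constant coefficient; iterated, it makes the sums in degrees 1 and 2 explicit. -/
lemma sum_monicFinset_succ {R : Type*} [AddCommMonoid R] (n : ℕ) (F : k[X] → R) :
    ∑ f ∈ monicFinset k (n + 1), F f = ∑ g ∈ monicFinset k n, ∑ b : k, F (X * g + C b) := by
  classical
  rw [monicFinset, sum_image, sum_product]
  rintro ⟨g, b⟩ - ⟨g', b'⟩ - h
  have h2 : b = b' := by simpa using congrArg (coeff · 0) h
  subst h2
  have h1 : g = g' := mul_left_cancel₀ X_ne_zero (add_right_cancel h)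
  rw [h1]

lemma sum_monicFinset_one {R : Type*} [AddCommMonoid R] (F : k[X] → R) :
    ∑ f ∈ monicFinset k 1, F f = ∑ b : k, F (X + C b) := by
  rw [sum_monicFinset_succ, sum_monicFinset_zero]; simp

lemma sum_monicFinset_two {R : Type*} [AddCommMonoid R] (F : k[X] → R) :
    ∑ f ∈ monicFinset k 2, F f = ∑ c : k, ∑ b : k, F (X ^ 2 + C c * X + C b) := by
  rw [sum_monicFinset_succ, sum_monicFinset_one]
  refine sum_congr rfl fun c _ => sum_congr rfl fun b _ => ?_
  congr 1; ring

/-- A sum over the monic polynomials of degree `n` is invariant under translation by a polynomial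
of smaller degree. -/
lemma sum_monicFinset_add {R : Type*} [AddCommMonoid R] {n : ℕ} {g : k[X]} (hg : g.degree < n)
    (F : k[X] → R) :
    ∑ f ∈ monicFinset k n, F (f + g) = ∑ f ∈ monicFinset k n, F f := by
  have key {g : k[X]} (hg : g.degree < n) {f : k[X]} (hf : f ∈ monicFinset k n) :
      f + g ∈ monicFinset k n := by
    obtain ⟨hm, rfl⟩ := mem_monicFinset.mp hf
    have : g.degree < f.degree := by rwa [degree_eq_natDegree hm.ne_zero]
    exact mem_monicFinset.mpr ⟨hm.add_of_left this, natDegree_add_eq_left_of_degree_lt this⟩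
  refine sum_bij' (fun f _ => f + g) (fun f _ => f - g) (fun f hf => key hg hf) (fun f hf => ?_)
    (by simp) (by simp) (by simp)
  rw [sub_eq_add_neg]
  exact key (by rwa [degree_neg]) hf

/-- The sum of a function over the monic polynomials of degree `n` vanishes if its sums over
the translates by a line do. -/
lemma sum_monicFinset_eq_zero {R : Type*} [CommRing R] [IsDomain R] [CharZero R] {n : ℕ} {g : k[X]}
    (hg : g.degree < n) (F : k[X] → R)
    (h : ∀ f ∈ monicFinset k n, ∑ c : k, F (f + C c * g) = 0) :
    ∑ f ∈ monicFinset k n, F f = 0 := by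
  -- Each translation by c·g permutes the monic polynomials, so this double sum is |k| times the sum
  -- in question, and |k| is nonzero in R.
  have h1 : ∑ c : k, ∑ f ∈ monicFinset k n, F (f + C c * g) = 0 := by
    rw [sum_comm]; exact sum_eq_zero h
  have h2 (c : k) : ∑ f ∈ monicFinset k n, F (f + C c * g) = ∑ f ∈ monicFinset k n, F f :=
    sum_monicFinset_add (lt_of_le_of_lt (by
      rw [degree_mul]
      calc (C c).degree + g.degree ≤ 0 + g.degree := by gcongr; exact degree_C_le
        _ = g.degree := zero_add _) hg) F
  simp_rw [h2, sum_const, card_univ, nsmul_eq_mul] at h1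
  exact (mul_eq_zero.mp h1).resolve_left (by exact_mod_cast Fintype.card_ne_zero)

open Classical in
variable (k) in
/-- The monic irreducible polynomials of degree at most `n` over a finite field. -/
def irredFinset (n : ℕ) : Finset k[X] :=
  ((range (n + 1)).biUnion (monicFinset k)).filter Irreducible

lemma mem_irredFinset {n : ℕ} {P : k[X]} :
    P ∈ irredFinset k n ↔ P.Monic ∧ Irreducible P ∧ P.natDegree ≤ n := by
  simp only [irredFinset, mem_filter, mem_biUnion, mem_range, mem_monicFinset]
  constructor
  · rintro ⟨⟨a, ha, hm, rfl⟩, hi⟩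
    exact ⟨hm, hi, by omega⟩
  · rintro ⟨hm, hi, hd⟩
    exact ⟨⟨_, by omega, hm, rfl⟩, hi⟩

open Classical in
/-- The degree of a monic polynomial is the sum of the degrees of the irreducible polynomials of
which some power divides it, one for each power. -/
lemma sum_natDegree_of_pow_dvd {n : ℕ} {f : k[X]} (hf : f ∈ monicFinset k n) :
    ∑ P ∈ irredFinset k n, ∑ j ∈ Icc 1 n, (if P ^ j ∣ f then P.natDegree else 0) = n := by
  obtain ⟨hm, hd⟩ := mem_monicFinset.mp hf
  let s := UniqueFactorizationMonoid.normalizedFactors f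
  have hs {P : k[X]} (hP : P ∈ s) : P ∈ irredFinset k n := by
    have h0 := UniqueFactorizationMonoid.irreducible_of_normalized_factor P hP
    have h1 := UniqueFactorizationMonoid.normalize_normalized_factor P hP
    exact mem_irredFinset.mpr ⟨(normalize_eq_self_iff_monic h0.ne_zero).mp h1, h0,
      hd ▸ natDegree_le_of_dvd (UniqueFactorizationMonoid.dvd_of_mem_normalizedFactors hP)
        hm.ne_zero⟩
  have hcount {P : k[X]} (hP : P ∈ irredFinset k n) :
      ∑ j ∈ Icc 1 n, (if P ^ j ∣ f then P.natDegree else 0) = s.count P * P.natDegree := by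
    obtain ⟨hPm, hPi, hPd⟩ := mem_irredFinset.mp hP
    rw [← sum_filter, sum_const, smul_eq_mul]
    congr 1
    -- The admissible exponents are those from 1 up to the multiplicity of P, which is at most n;
    -- hence the cutoff n loses nothing.
    have hiff (j : ℕ) : P ^ j ∣ f ↔ j ≤ s.count P := by
      rw [pow_dvd_iff_le_emultiplicity,
        UniqueFactorizationMonoid.emultiplicity_eq_count_normalizedFactors hPi hm.ne_zero,
        hPm.normalize_eq_self, Nat.cast_le]
    have hle : s.count P ≤ n := by
      have h1 : P ^ s.count P ∣ f := (hiff _).mpr le_rfl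
      have h2 := natDegree_le_of_dvd h1 hm.ne_zero
      rw [hPm.natDegree_pow, hd] at h2
      exact le_trans (Nat.le_mul_of_pos_right _ hPi.natDegree_pos) h2
    have : (Icc 1 n).filter (fun j => P ^ j ∣ f) = Icc 1 (s.count P) := by
      ext j; simp only [mem_filter, mem_Icc, hiff]; omega
    rw [this, Nat.card_Icc, Nat.add_sub_cancel]
  rw [sum_congr rfl fun P hP => hcount hP]
  have h1 : s.prod = f := by
    have := UniqueFactorizationMonoid.prod_normalizedFactors_eq hm.ne_zero
    rwa [hm.normalize_eq_self] at this
  have h2 : (s.map natDegree).sum = n := by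
    rw [← natDegree_multiset_prod_of_monic s fun P hP => (mem_irredFinset.mp (hs hP)).1, h1, hd]
  refine Eq.trans ?_ h2
  rw [sum_multiset_map_count]
  simp_rw [smul_eq_mul]
  symm
  refine sum_subset (fun P hP => hs (Multiset.mem_toFinset.mp hP)) fun P _ hP => ?_
  rw [Multiset.count_eq_zero_of_notMem (by simpa using hP), zero_mul]

variable {R : Type*} [CommRing R]

/-- The coefficients of the `L`-function attached to a function on monic polynomials. -/
def monicSum (χ : k[X] → R) (n : ℕ) : R := ∑ f ∈ monicFinset k n, χ f

lemma map_pow_of_monic {χ : k[X] → R} (h1 : χ 1 = 1)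
    (hmul : ∀ f g : k[X], f.Monic → g.Monic → χ (f * g) = χ f * χ g) {P : k[X]} (hP : P.Monic)
    (j : ℕ) : χ (P ^ j) = χ P ^ j := by
  induction j with
  | zero => simpa
  | succ j ih => rw [pow_succ, hmul _ _ (hP.pow j) hP, ih, pow_succ]

-- The multiples of Q are the products Q·g with g monic of the complementary degree, and χ(Q)
-- factors out.
open Classical in
lemma sum_monicFinset_filter_dvd {χ : k[X] → R}
    (hmul : ∀ f g : k[X], f.Monic → g.Monic → χ (f * g) = χ f * χ g) {Q : k[X]} (hQ : Q.Monic)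
    (n : ℕ) : ∑ f ∈ monicFinset k n with Q ∣ f, χ f
      = if Q.natDegree ≤ n then χ Q * monicSum χ (n - Q.natDegree) else 0 := by
  split_ifs with h
  · rw [monicSum, mul_sum]
    symm
    refine sum_bij (fun g _ => Q * g) (fun g hg => ?_) (fun g _ g' _ h => ?_) (fun f hf => ?_)
      (fun g hg => ?_)
    · obtain ⟨hm, hd⟩ := mem_monicFinset.mp hg
      refine mem_filter.mpr ⟨mem_monicFinset.mpr ⟨hQ.mul hm, ?_⟩, dvd_mul_right _ _⟩
      rw [hQ.natDegree_mul hm, hd]; omega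
    · exact mul_left_cancel₀ hQ.ne_zero h
    · obtain ⟨hf, g, rfl⟩ := mem_filter.mp hf
      obtain ⟨hm, hd⟩ := mem_monicFinset.mp hf
      have hg : g.Monic := hQ.of_mul_monic_left hm
      refine ⟨g, mem_monicFinset.mpr ⟨hg, ?_⟩, rfl⟩
      rw [← hd, hQ.natDegree_mul hg]; omega
    · rw [hmul _ _ hQ (mem_monicFinset.mp hg).1]
  · refine sum_eq_zero fun f hf => absurd ?_ h
    obtain ⟨hf, hdvd⟩ := mem_filter.mp hf
    obtain ⟨hm, hd⟩ := mem_monicFinset.mp hf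
    exact hd ▸ natDegree_le_of_dvd hdvd hm.ne_zero

open Classical in
/-- The logarithmic derivative of an Euler product over the monic irreducible polynomials. -/
lemma natCast_mul_monicSum {χ : k[X] → R} (h1 : χ 1 = 1)
    (hmul : ∀ f g : k[X], f.Monic → g.Monic → χ (f * g) = χ f * χ g) (n : ℕ) :
    (n : R) * monicSum χ n = ∑ m ∈ Icc 1 n, (∑ P ∈ irredFinset k n, ∑ j ∈ Icc 1 n,
      if j * P.natDegree = m then (P.natDegree : R) * χ P ^ j else 0) * monicSum χ (n - m) := by
  -- The analogue of log = Λ * 1: the degree n of each f is distributed over the prime powers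
  -- dividing f.
  have hl : (n : R) * monicSum χ n = ∑ P ∈ irredFinset k n, ∑ j ∈ Icc 1 n,
      (P.natDegree : R) * ∑ f ∈ monicFinset k n with P ^ j ∣ f, χ f := by
    rw [monicSum, mul_sum]
    have : ∀ f ∈ monicFinset k n, (n : R) * χ f = ∑ P ∈ irredFinset k n, ∑ j ∈ Icc 1 n,
        (P.natDegree : R) * (if P ^ j ∣ f then χ f else 0) := by
      intro f hf
      conv_lhs => rw [← sum_natDegree_of_pow_dvd hf]
      push_cast
      simp_rw [sum_mul]
      refine sum_congr rfl fun P _ => sum_congr rfl fun j _ => ?_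
      split_ifs <;> simp
    rw [sum_congr rfl this, sum_comm (s := monicFinset k n)]
    refine sum_congr rfl fun P _ => ?_
    rw [sum_comm]
    refine sum_congr rfl fun j _ => ?_
    rw [← mul_sum, sum_filter]
  rw [hl]
  simp_rw [sum_mul]
  rw [sum_comm (s := Icc 1 n) (t := irredFinset k n)]
  refine sum_congr rfl fun P hP => ?_
  rw [sum_comm (s := Icc 1 n) (t := Icc 1 n)]
  refine sum_congr rfl fun j hj => ?_
  obtain ⟨hPm, hPi, hPd⟩ := mem_irredFinset.mp hP
  rw [sum_monicFinset_filter_dvd hmul (hPm.pow j), hPm.natDegree_pow, map_pow_of_monic h1 hmul hPm]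
  simp_rw [ite_mul, zero_mul]
  rw [sum_ite_eq]
  have : 1 ≤ j * P.natDegree := Nat.mul_pos (by simp at hj; omega) hPi.natDegree_pos
  simp only [mem_Icc, this, true_and]
  split_ifs <;> ring

end MonicPolynomials

/-! ### Logarithmic derivatives as sums over finite extensions; characteristic polynomials. -/

section Extension

open Finset

variable {k : Type*} [Field k] [Fintype k] {L : Type*} [Field L] [Fintype L] [Algebra k L]

open Classical in
/-- A monic irreducible polynomial has as many roots in a finite extension as its degree if that
divides the degree of the extension, and none otherwise. -/
lemma card_filter_minpoly_eq {P : k[X]} (hPm : P.Monic) (hPi : Irreducible P) :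
    #{θ : L | minpoly k θ = P} = if P.natDegree ∣ Module.finrank k L then P.natDegree else 0 := by
  have hint (θ : L) : IsIntegral k θ := Algebra.IsIntegral.isIntegral θ
  split_ifs with h
  -- As a divisor of X^|L| - X, the polynomial P splits over L; it is separable because k is
  -- perfect.
  · have hdvd : P ∣ X ^ Nat.card k ^ Module.finrank k L - X :=
      hPi.natDegree_dvd_iff_dvd_X_pow_card_pow_sub_X.mp h
    have hsplit : (P.map (algebraMap k L)).Splits := by
      refine Splits.of_dvd ?_ ?_ (map_dvd (algebraMap k L) hdvd)
      · rw [← Module.natCard_eq_pow_finrank, Nat.card_eq_fintype_card]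
        exact (FiniteField.isSplittingField_sub L k).splits
      · exact map_ne_zero
          (FiniteField.X_pow_card_pow_sub_X_ne_zero _ Module.finrank_pos.ne' Finite.one_lt_card)
    have hsep : P.Separable := PerfectField.separable_of_irreducible hPi
    rw [← card_rootSet_eq_natDegree hsep hsplit, ← Set.toFinset_card]
    congr 1
    ext θ
    rw [mem_filter, Set.mem_toFinset, mem_rootSet]
    refine ⟨?_, fun h => ⟨mem_univ _, ?_⟩⟩
    · rintro ⟨-, rfl⟩
      exact ⟨hPm.ne_zero, minpoly.aeval k θ⟩
    · exact (minpoly.eq_of_irreducible_of_monic hPi h.2 hPm).symm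
  · rw [card_eq_zero, filter_eq_empty_iff]
    rintro θ - rfl
    exact h (minpoly.degree_dvd (hint θ))

variable {R : Type*} [CommRing R]

/-- The sum over the elements of an extension which appears in the logarithmic derivative. -/
def extensionSum (χ : k[X] → R) (L : Type*) [Field L] [Fintype L] [Algebra k L] : R :=
  ∑ θ : L, χ (minpoly k θ) ^ (Module.finrank k L / (minpoly k θ).natDegree)

-- Group the elements by minimal polynomial: an irreducible P occurs for deg P of them when deg P
-- divides the degree of L, and for none otherwise. The cutoff n may exceed the degree of L, since
-- the additional terms vanish.
open Classical in
lemma extensionSum_eq (χ : k[X] → R) {n : ℕ} (hn : Module.finrank k L ≤ n) :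
    extensionSum χ L = ∑ P ∈ irredFinset k n, ∑ j ∈ Icc 1 n,
      if j * P.natDegree = Module.finrank k L then (P.natDegree : R) * χ P ^ j else 0 := by
  have hint (θ : L) : IsIntegral k θ := Algebra.IsIntegral.isIntegral θ
  have hmaps : ∀ θ ∈ (univ : Finset L), minpoly k θ ∈ irredFinset k n := fun θ _ =>
    mem_irredFinset.mpr ⟨minpoly.monic (hint θ), minpoly.irreducible (hint θ),
      (minpoly.natDegree_le θ).trans hn⟩
  rw [extensionSum, ← sum_fiberwise_of_maps_to hmaps]
  refine sum_congr rfl fun P hP => ?_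
  obtain ⟨hPm, hPi, hPd⟩ := mem_irredFinset.mp hP
  have hpos := hPi.natDegree_pos
  have hm : 0 < Module.finrank k L := Module.finrank_pos
  rw [sum_congr rfl (g := fun _ => χ P ^ (Module.finrank k L / P.natDegree))
    (fun θ hθ => by rw [(mem_filter.mp hθ).2]), sum_const, card_filter_minpoly_eq hPm hPi]
  split_ifs with h
  · obtain ⟨j, hj⟩ := h
    rw [hj, Nat.mul_div_cancel_left _ hpos, nsmul_eq_mul]
    have : ∀ i, i * P.natDegree = P.natDegree * j ↔ j = i := fun i => by
      rw [mul_comm, Nat.mul_right_inj hpos.ne']; exact eq_comm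
    simp_rw [this]
    rw [sum_ite_eq, if_pos]
    rw [mem_Icc]
    have hj0 : j ≠ 0 := by rintro rfl; omega
    have : j ≤ P.natDegree * j := Nat.le_mul_of_pos_left _ hpos
    omega
  · rw [zero_smul, sum_eq_zero]
    intro j _
    rw [if_neg]
    rintro h'
    exact h ⟨j, by rw [← h', mul_comm]⟩

-- Every positive index is the degree of an extension, so power series can be compared
-- coefficientwise through sums over extensions. The extension lives in `Type`, which is why later
-- statements quantify over `L : Type`.
variable (k) in
lemma exists_extension_of_finrank (n : ℕ) (hn : n ≠ 0) :
    ∃ (L : Type) (_ : Field L) (_ : Fintype L) (_ : Algebra k L), Module.finrank k L = n := by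
  obtain ⟨p, hp⟩ := CharP.exists k
  have : Fact p.Prime := ⟨CharP.char_is_prime k p⟩
  have : NeZero n := ⟨hn⟩
  exact ⟨FiniteField.Extension k p n, inferInstance, Fintype.ofFinite _, inferInstance,
    FiniteField.finrank_extension k p n⟩

open Classical in
/-- The coefficients of the logarithmic derivative of the `L`-function attached to a function on
monic polynomials. -/
def primeSum (χ : k[X] → R) (m : ℕ) : R :=
  ∑ P ∈ irredFinset k m, ∑ j ∈ Icc 1 m,
    if j * P.natDegree = m then (P.natDegree : R) * χ P ^ j else 0

variable (L) in
lemma extensionSum_eq_primeSum (χ : k[X] → R) :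
    extensionSum χ L = primeSum χ (Module.finrank k L) :=
  extensionSum_eq χ le_rfl

/-- The logarithmic derivative of the `L`-function attached to a multiplicative function on monic
polynomials. -/
theorem X_mul_derivative_monicSum {χ : k[X] → R} (h1 : χ 1 = 1)
    (hmul : ∀ f g : k[X], f.Monic → g.Monic → χ (f * g) = χ f * χ g) :
    PowerSeries.X * PowerSeries.derivative (R := R) (PowerSeries.mk (monicSum χ)) =
      PowerSeries.mk (primeSum χ) * PowerSeries.mk (monicSum χ) := by
  ext n
  have hl : PowerSeries.coeff n
      (PowerSeries.X * PowerSeries.derivative (R := R) (PowerSeries.mk (monicSum χ))) =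
      (n : R) * monicSum χ n := by
    cases n with
    | zero => simp
    | succ n =>
      rw [PowerSeries.coeff_succ_X_mul, PowerSeries.coeff_derivative, PowerSeries.coeff_mk]
      push_cast; ring
  rw [hl, natCast_mul_monicSum h1 hmul, PowerSeries.coeff_mul,
    Nat.sum_antidiagonal_eq_sum_range_succ_mk]
  have : range n.succ = insert 0 (Icc 1 n) := by ext; simp; omega
  rw [this, sum_insert (by simp)]
  simp only [PowerSeries.coeff_mk, tsub_zero]
  have h0 : primeSum χ 0 = 0 := by simp [primeSum]
  rw [h0, zero_mul, zero_add]
  refine sum_congr rfl fun m hm => ?_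
  obtain ⟨hm1, hm2⟩ := mem_Icc.mp hm
  -- The extension of degree m serves to identify the prime sum with cutoff n and the one with
  -- cutoff m: both compute the same sum over its elements.
  obtain ⟨L, _, _, _, rfl⟩ := exists_extension_of_finrank k m (by omega)
  rw [← extensionSum_eq_primeSum L, ← extensionSum_eq χ hm2]

open Classical in
/-- The conjugates of an element of a finite extension, with multiplicities. -/
lemma prod_X_sub_C_algEquiv (θ : L) :
    ∏ σ : L ≃ₐ[k] L, (X - C (σ θ)) = ((minpoly k θ) ^
      (Module.finrank k L / (minpoly k θ).natDegree)).map (algebraMap k L) := by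
  have hint : IsIntegral k θ := Algebra.IsIntegral.isIntegral θ
  have hpos := (minpoly.irreducible hint).natDegree_pos
  let S : Finset L := {ρ : L | minpoly k ρ = minpoly k θ}
  have hS : #S = (minpoly k θ).natDegree := by
    rw [card_filter_minpoly_eq (minpoly.monic hint) (minpoly.irreducible hint),
      if_pos (minpoly.degree_dvd hint)]
  have hmaps : ∀ σ ∈ (univ : Finset (L ≃ₐ[k] L)), σ θ ∈ S := fun σ _ => by
    simp [S]
  -- The Galois group is transitive on the conjugates, so every fibre of σ ↦ σ θ is a coset of the
  -- stabiliser of θ.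
  have hfib : ∀ ρ ∈ S, #{σ : L ≃ₐ[k] L | σ θ = ρ} = #{σ : L ≃ₐ[k] L | σ θ = θ} := by
    intro ρ hρ
    obtain ⟨τ, hτ⟩ := (Normal.minpoly_eq_iff_mem_orbit L).mp (mem_filter.mp hρ).2
    have hτ : τ θ = ρ := hτ
    refine card_bij' (fun σ _ => τ⁻¹ * σ) (fun σ _ => τ * σ) ?_ ?_ ?_ ?_
    · intro σ hσ
      have hσ := (mem_filter.mp hσ).2
      refine mem_filter.mpr ⟨mem_univ _, ?_⟩
      rw [AlgEquiv.mul_apply, hσ, ← hτ, ← AlgEquiv.mul_apply, inv_mul_cancel, AlgEquiv.one_apply]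
    · intro σ hσ
      have hσ := (mem_filter.mp hσ).2
      exact mem_filter.mpr ⟨mem_univ _, by rw [AlgEquiv.mul_apply, hσ, hτ]⟩
    · intros; simp
    · intros; simp
  set e := #{σ : L ≃ₐ[k] L | σ θ = θ} with he
  have hcard : Module.finrank k L = (minpoly k θ).natDegree * e := by
    rw [← IsGalois.card_aut_eq_finrank, Nat.card_eq_fintype_card, ← card_univ,
      card_eq_sum_card_fiberwise hmaps, sum_congr rfl hfib, sum_const, hS, smul_eq_mul]
  rw [hcard, Nat.mul_div_cancel_left _ hpos, ← prod_fiberwise_of_maps_to hmaps,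
    Polynomial.map_pow]
  have h1 : ∀ ρ ∈ S, ∏ σ : L ≃ₐ[k] L with σ θ = ρ, (X - C (σ θ)) = (X - C ρ) ^ e := by
    intro ρ hρ
    rw [prod_congr rfl (g := fun _ => X - C ρ) (fun σ hσ => by rw [(mem_filter.mp hσ).2]),
      prod_const, hfib ρ hρ]
  rw [prod_congr rfl h1, prod_pow]
  congr 1
  refine (eq_of_monic_of_dvd_of_natDegree_le
    (monic_prod_of_monic S (fun ρ => X - C ρ) fun ρ _ => monic_X_sub_C ρ)
    ((minpoly.monic hint).map _) ?_ ?_).symm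
  · refine prod_dvd_of_coprime (fun ρ _ ρ' _ h => ?_) fun ρ hρ => ?_
    · exact isCoprime_X_sub_C_of_isUnit_sub (sub_ne_zero.mpr h).isUnit
    · rw [dvd_iff_isRoot, IsRoot, eval_map_algebraMap, ← (mem_filter.mp hρ).2, minpoly.aeval]
  · rw [natDegree_prod_of_monic _ _ fun ρ _ => monic_X_sub_C ρ, natDegree_map]
    simp [hS]

/-- The characteristic polynomial of an element of a finite extension. -/
def charPoly (k : Type*) [Field k] {L : Type*} [Field L] [Algebra k L] (θ : L) : k[X] :=
  (minpoly k θ) ^ (Module.finrank k L / (minpoly k θ).natDegree)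

lemma natDegree_charPoly (θ : L) : (charPoly k θ).natDegree = Module.finrank k L := by
  have hint : IsIntegral k θ := Algebra.IsIntegral.isIntegral θ
  rw [charPoly, (minpoly.monic hint).natDegree_pow, Nat.div_mul_cancel (minpoly.degree_dvd hint)]

lemma map_charPoly (θ : L) :
    (charPoly k θ).map (algebraMap k L) = ∏ σ : L ≃ₐ[k] L, (X - C (σ θ)) :=
  (prod_X_sub_C_algEquiv θ).symm

/-- When χ is defined through coefficients, this form turns it into a function of the trace, the
norm and the trace of the inverse of θ. -/
lemma extensionSum_eq_sum_charPoly {χ : k[X] → R} (h1 : χ 1 = 1)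
    (hmul : ∀ f g : k[X], f.Monic → g.Monic → χ (f * g) = χ f * χ g) :
    extensionSum χ L = ∑ θ : L, χ (charPoly k θ) :=
  sum_congr rfl fun θ _ =>
    (map_pow_of_monic h1 hmul (minpoly.monic (Algebra.IsIntegral.isIntegral θ)) _).symm

lemma neg_nextCoeff_charPoly (θ : L) : -(charPoly k θ).nextCoeff = Algebra.trace k L θ := by
  apply FaithfulSMul.algebraMap_injective k L
  rw [map_neg, ← nextCoeff_map (FaithfulSMul.algebraMap_injective k L), map_charPoly,
    prod_X_sub_C_nextCoeff, neg_neg, trace_eq_sum_automorphisms]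

lemma coeff_zero_charPoly (θ : L) :
    (-1) ^ Module.finrank k L * (charPoly k θ).coeff 0 = Algebra.norm k θ := by
  apply FaithfulSMul.algebraMap_injective k L
  rw [map_mul, ← coeff_map, map_charPoly, coeff_zero_eq_eval_zero, eval_prod,
    Algebra.norm_eq_prod_automorphisms, ← IsGalois.card_aut_eq_finrank, Nat.card_eq_fintype_card,
    ← card_univ, map_pow, ← prod_const, ← prod_mul_distrib]
  simp

lemma coeff_zero_charPoly_ne_zero {θ : L} (hθ : θ ≠ 0) : (charPoly k θ).coeff 0 ≠ 0 := by
  intro h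
  have := coeff_zero_charPoly (k := k) θ
  rw [h, mul_zero] at this
  exact hθ (Algebra.norm_eq_zero_iff.mp this.symm)

/-- The quotient is the logarithmic derivative at 0, hence additive over the factors; X - z
contributes -1/z. -/
lemma coeff_one_div_coeff_zero_prod {K ι : Type*} [Field K] (s : Finset ι) (z : ι → K)
    (hz : ∀ i ∈ s, z i ≠ 0) :
    (∏ i ∈ s, (X - C (z i))).coeff 1 / (∏ i ∈ s, (X - C (z i))).coeff 0 = -∑ i ∈ s, (z i)⁻¹ := by
  classical
  induction s using Finset.induction_on with
  | empty => simp [coeff_one]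
  | insert i s hi ih =>
    have hzi := hz i (mem_insert_self i s)
    have ih := ih fun j hj => hz j (mem_insert_of_mem hj)
    have h0 : (∏ i ∈ s, (X - C (z i))).coeff 0 ≠ 0 := by
      rw [coeff_zero_eq_eval_zero, eval_prod]
      exact prod_ne_zero_iff.mpr fun j hj => by simpa using hz j (mem_insert_of_mem hj)
    rw [prod_insert hi, sum_insert hi, mul_coeff_zero, mul_coeff_one, neg_add, ← ih]
    simp only [coeff_sub, coeff_X_zero, coeff_C_zero, coeff_X_one, coeff_C_succ]
    field_simp
    ring

lemma coeff_one_div_coeff_zero_charPoly {θ : L} (hθ : θ ≠ 0) :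
    (charPoly k θ).coeff 1 / (charPoly k θ).coeff 0 = -Algebra.trace k L θ⁻¹ := by
  apply FaithfulSMul.algebraMap_injective k L
  rw [map_div₀, ← coeff_map, ← coeff_map, map_charPoly, coeff_one_div_coeff_zero_prod, map_neg,
    trace_eq_sum_automorphisms]
  · simp
  · intro σ _; simpa

end Extension

end EllipticL

namespace EllipticL

/-! ### Sums of the quadratic character and its behaviour under norms. -/

section QuadraticCharacter

open Finset

variable {k : Type*} [Field k] [Fintype k] [DecidableEq k]

/-- A sum over squares, in terms of the quadratic character. -/
lemma sum_sq_eq_sum_quadraticChar {R : Type*} [CommRing R] (hk : ringChar k ≠ 2) (g : k → R) :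
    ∑ y : k, g (y ^ 2) = ∑ u : k, (1 + (quadraticChar k u : R)) * g u := by
  rw [← sum_fiberwise (s := univ) (g := fun y : k => y ^ 2)]
  refine sum_congr rfl fun u _ => ?_
  rw [sum_congr rfl (g := fun _ => g u) (fun y hy => by rw [(mem_filter.mp hy).2]), sum_const,
    nsmul_eq_mul]
  congr 1
  have := congrArg (Int.cast : ℤ → R) (quadraticChar_card_sqrts hk u)
  push_cast at this
  rw [add_comm, ← this]
  congr 2
  ext y; simp

lemma quadraticChar_mul_self {a : k} (ha : a ≠ 0) : quadraticChar k a * quadraticChar k a = 1 := by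
  rw [← sq]; exact quadraticChar_sq_one ha

/-- For d ≠ 0, counting square roots reduces the sum to that of λ(u)λ(u - d), which is λ(1 - d/u)
for u ≠ 0; as u varies, 1 - d/u takes every value except 1 once. -/
lemma sum_quadraticChar_sq_sub (hk : ringChar k ≠ 2) (d : k) :
    ∑ y : k, quadraticChar k (y ^ 2 - d) = if d = 0 then (Fintype.card k : ℤ) - 1 else -1 := by
  split_ifs with hd
  · subst hd
    have : ∀ y : k, quadraticChar k (y ^ 2 - 0) = 1 - if y = 0 then 1 else 0 := by
      intro y
      split_ifs with h
      · simp [h]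
      · rw [sub_zero, quadraticChar_sq_one' h, sub_zero]
    simp_rw [this, sum_sub_distrib]
    simp
  · have h1 := sum_sq_eq_sum_quadraticChar (R := ℤ) hk fun u => quadraticChar k (u - d)
    rw [h1]
    simp_rw [add_mul, one_mul, sum_add_distrib]
    have h2 : ∑ u : k, quadraticChar k (u - d) = 0 := by
      rw [← quadraticChar_sum_zero hk]
      exact Fintype.sum_equiv (Equiv.subRight d) _ _ fun u => rfl
    rw [h2, zero_add]
    simp_rw [Int.cast_id]
    -- Since `0⁻¹ = 0`, the term u = 0 on the right would be λ(1) = 1; the subtracted indicator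
    -- removes it.
    have h3 : ∀ u : k, quadraticChar k u * quadraticChar k (u - d)
        = quadraticChar k (1 - d * u⁻¹) - if u = 0 then 1 else 0 := by
      intro u
      split_ifs with h
      · simp [h]
      · have : u - d = u * (1 - d * u⁻¹) := by field_simp
        rw [this, map_mul, ← mul_assoc, quadraticChar_mul_self h, one_mul, sub_zero]
    simp_rw [h3, sum_sub_distrib]
    have h4 : ∑ u : k, quadraticChar k (1 - d * u⁻¹) = 0 := by
      rw [← quadraticChar_sum_zero hk]
      refine Fintype.sum_bijective (fun u : k => 1 - d * u⁻¹)
        (Finite.injective_iff_bijective.mp fun u w h => ?_) _ _ fun u => rfl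
      have : d * u⁻¹ = d * w⁻¹ := by simpa using h
      exact inv_injective (mul_left_cancel₀ hd this)
    rw [h4]
    simp

/-- The sum of the quadratic character over the values of a quadratic polynomial. -/
lemma sum_quadraticChar_quadratic (hk : ringChar k ≠ 2) {a : k} (ha : a ≠ 0) (b c : k) :
    ∑ x : k, quadraticChar k (a * x ^ 2 + b * x + c) =
      quadraticChar k a * if b ^ 2 = 4 * a * c then (Fintype.card k : ℤ) - 1 else -1 := by
  have h2 : (2 : k) ≠ 0 := Ring.two_ne_zero hk
  have h4 : (4 : k) ≠ 0 := by
    have : (4 : k) = 2 * 2 := by norm_num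
    rw [this]; exact mul_ne_zero h2 h2
  have hq4 : quadraticChar k 4 = 1 := by
    have : (4 : k) = 2 ^ 2 := by norm_num
    rw [this, quadraticChar_sq_one' h2]
  -- Completing the square after multiplication by 4a, where 4 is a square.
  have h1 : ∀ x : k, quadraticChar k (a * x ^ 2 + b * x + c)
      = quadraticChar k a * quadraticChar k ((2 * a * x + b) ^ 2 - (b ^ 2 - 4 * a * c)) := by
    intro x
    have : (2 * a * x + b) ^ 2 - (b ^ 2 - 4 * a * c) = 4 * (a * (a * x ^ 2 + b * x + c)) := by ring
    rw [this, map_mul, map_mul, hq4, one_mul, ← mul_assoc, quadraticChar_mul_self ha, one_mul]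
  simp_rw [h1, ← mul_sum]
  congr 1
  have h3 : ∑ x : k, quadraticChar k ((2 * a * x + b) ^ 2 - (b ^ 2 - 4 * a * c))
      = ∑ y : k, quadraticChar k (y ^ 2 - (b ^ 2 - 4 * a * c)) := by
    refine Fintype.sum_bijective (fun x : k => 2 * a * x + b)
      (Finite.injective_iff_bijective.mp fun u w h => ?_) _ _ fun u => rfl
    have : 2 * a * u = 2 * a * w := by simpa using h
    exact mul_left_cancel₀ (mul_ne_zero h2 ha) this
  rw [h3, sum_quadraticChar_sq_sub hk]
  simp_rw [sub_eq_zero]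

variable {L : Type*} [Field L] [Fintype L] [DecidableEq L] [Algebra k L]

omit [Fintype k] [DecidableEq k] [Fintype L] [DecidableEq L] in
lemma ringChar_ne_two_of_algebra (hk : ringChar k ≠ 2) : ringChar L ≠ 2 := by
  rwa [← Algebra.ringChar_eq k L]

/-- Euler's criterion on both sides: the norm is θ^(1 + q + ... + q^(n-1)), and that exponent times
(q - 1)/2 is (q^n - 1)/2. -/
lemma quadraticChar_norm (hk : ringChar k ≠ 2) (θ : L) :
    quadraticChar k (Algebra.norm k θ) = quadraticChar L θ := by
  have hL := ringChar_ne_two_of_algebra (L := L) hk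
  by_cases hθ : θ = 0
  · subst hθ; simp
  · have hn : Algebra.norm k θ ≠ 0 := fun h => hθ (Algebra.norm_eq_zero_iff.mp h)
    rw [quadraticChar_eq_pow_of_char_ne_two hk hn, quadraticChar_eq_pow_of_char_ne_two hL hθ]
    congr 1
    rw [← (FaithfulSMul.algebraMap_injective k L).eq_iff, map_pow, map_one,
      FiniteField.algebraMap_norm_eq_pow_sum, ← pow_mul]
    have hodd := FiniteField.odd_card_of_char_ne_two hk
    have hoddL := FiniteField.odd_card_of_char_ne_two hL
    have hcard : Fintype.card L = Fintype.card k ^ Module.finrank k L :=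
      Module.card_eq_pow_finrank
    have : (∑ i ∈ range (Module.finrank k L), Nat.card k ^ i) * (Fintype.card k / 2)
        = Fintype.card L / 2 := by
      rw [Nat.card_eq_fintype_card]
      obtain ⟨a, ha⟩ : ∃ a, Fintype.card k = 2 * a + 1 :=
        ⟨Fintype.card k / 2, by omega⟩
      have h2 : Fintype.card k / 2 = a := by omega
      have h3 := geom_sum_mul_add (2 * a) (Module.finrank k L)
      rw [← ha, ← hcard] at h3
      rw [h2]
      have h4 : ∀ s : ℕ, s * (2 * a) + 1 = Fintype.card L → s * a = Fintype.card L / 2 := by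
        intro s hs
        have : s * (2 * a) = 2 * (s * a) := by ring
        omega
      exact h4 _ h3
    rw [this]

end QuadraticCharacter

/-! ### Quadratic Gauss sums and the Hasse-Davenport relation. -/

section GaussSums

open Finset

variable {k : Type*} [Field k] [Fintype k] [DecidableEq k]
variable {R : Type*} [CommRing R] [IsDomain R] [CharZero R]

/-- The multiplicative function on monic polynomials attached to a quadratic Gauss sum. -/
def gaussFun (ψ : AddChar k R) (f : k[X]) : R :=
  (quadraticChar k ((-1) ^ f.natDegree * f.coeff 0) : R) * ψ (-f.nextCoeff)

omit [IsDomain R] [CharZero R] in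
lemma gaussFun_one (ψ : AddChar k R) : gaussFun ψ 1 = 1 := by
  simp [gaussFun, nextCoeff]

omit [IsDomain R] [CharZero R] in
lemma gaussFun_mul (ψ : AddChar k R) (f g : k[X]) (hf : f.Monic) (hg : g.Monic) :
    gaussFun ψ (f * g) = gaussFun ψ f * gaussFun ψ g := by
  rw [gaussFun, hf.nextCoeff_mul hg, hf.natDegree_mul hg, mul_coeff_zero, neg_add,
    AddChar.map_add_eq_mul, pow_add, mul_mul_mul_comm, map_mul, Int.cast_mul, gaussFun, gaussFun]
  ring

omit [DecidableEq k] in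
lemma nextCoeff_add_C_mul_X_pow {n : ℕ} (hn : n ≠ 0) {f : k[X]} (hf : f ∈ monicFinset k n)
    (c : k) : (f + C c * X ^ (n - 1)).nextCoeff = f.nextCoeff + c ∧
      (f + C c * X ^ (n - 1)).natDegree = n := by
  obtain ⟨hm, hd⟩ := mem_monicFinset.mp hf
  have hdeg : (C c * X ^ (n - 1)).degree < f.degree := by
    refine lt_of_le_of_lt (degree_C_mul_X_pow_le _ _) ?_
    rw [degree_eq_natDegree hm.ne_zero, hd]
    norm_cast; omega
  have hd' : (f + C c * X ^ (n - 1)).natDegree = n := by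
    rw [natDegree_add_eq_left_of_degree_lt hdeg, hd]
  refine ⟨?_, hd'⟩
  rw [nextCoeff_of_natDegree_pos (by omega), nextCoeff_of_natDegree_pos (by omega), hd, hd']
  simp

lemma sum_addChar_sub {ψ : AddChar k R} (hψ : ψ ≠ 1) (z : k) : ∑ c : k, ψ (z - c) = 0 := by
  rw [← AddChar.sum_eq_zero_of_ne_one hψ]
  exact Fintype.sum_equiv (Equiv.subLeft z) _ _ fun c => rfl

lemma monicSum_gaussFun_zero (ψ : AddChar k R) : monicSum (gaussFun ψ) 0 = 1 := by
  rw [monicSum, sum_monicFinset_zero, gaussFun_one]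

lemma monicSum_gaussFun_one (ψ : AddChar k R) :
    monicSum (gaussFun ψ) 1 = ∑ x : k, (quadraticChar k x : R) * ψ x := by
  rw [monicSum, sum_monicFinset_one]
  refine Fintype.sum_equiv (Equiv.neg k) _ _ fun b => ?_
  simp [gaussFun]

/-- From degree 2 on, the second highest coefficient can be moved without touching the constant one,
so a full sum of ψ splits off. -/
lemma monicSum_gaussFun_of_two_le {ψ : AddChar k R} (hψ : ψ ≠ 1) {n : ℕ} (hn : 2 ≤ n) :
    monicSum (gaussFun ψ) n = 0 := by
  refine sum_monicFinset_eq_zero (g := X ^ (n - 1)) ?_ _ fun f hf => ?_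
  · rw [degree_X_pow]; norm_cast; omega
  · have h (c : k) : gaussFun ψ (f + C c * X ^ (n - 1)) =
        (quadraticChar k ((-1) ^ n * f.coeff 0) : R) * ψ (-f.nextCoeff - c) := by
      obtain ⟨h1, h2⟩ := nextCoeff_add_C_mul_X_pow (by omega) hf c
      rw [gaussFun, h1, h2, coeff_add, coeff_C_mul, coeff_X_pow, if_neg (by omega), mul_zero,
        add_zero, neg_add, sub_eq_add_neg]
    simp_rw [h, ← mul_sum, sum_addChar_sub hψ, mul_zero]

variable {L : Type*} [Field L] [Fintype L] [DecidableEq L] [Algebra k L]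

omit [IsDomain R] [CharZero R] in
lemma extensionSum_gaussFun (hk : ringChar k ≠ 2) (ψ : AddChar k R) :
    extensionSum (gaussFun ψ) L =
      ∑ θ : L, (quadraticChar L θ : R) * ψ (Algebra.trace k L θ) := by
  rw [extensionSum_eq_sum_charPoly (gaussFun_one ψ) (gaussFun_mul ψ)]
  refine sum_congr rfl fun θ _ => ?_
  rw [gaussFun, neg_nextCoeff_charPoly, natDegree_charPoly, coeff_zero_charPoly,
    quadraticChar_norm hk]

/-- The logarithmic derivative of 1 - gT with its denominator cleared; it converts a factorisation
of a series into power sums of its reciprocal roots. -/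
lemma X_mul_derivative_one_sub_C_mul_X (g : R) :
    PowerSeries.X * PowerSeries.derivative (R := R) (1 - PowerSeries.C g * PowerSeries.X) =
      PowerSeries.mk (fun m => if m = 0 then 0 else -g ^ m) *
        (1 - PowerSeries.C g * PowerSeries.X) := by
  ext n
  cases n with
  | zero => simp
  | succ n =>
    rw [mul_sub, mul_one, map_sub (PowerSeries.coeff (n + 1)), mul_left_comm,
      PowerSeries.coeff_C_mul, PowerSeries.coeff_succ_mul_X, PowerSeries.coeff_succ_X_mul,
      PowerSeries.coeff_mk, PowerSeries.coeff_mk]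
    simp only [map_sub, Derivation.map_one_eq_zero, Derivation.leibniz, PowerSeries.derivative_C,
      PowerSeries.derivative_X]
    cases n with
    | zero => simp
    | succ n => simp [pow_succ]; ring

/-- The Hasse-Davenport relation for quadratic Gauss sums. -/
theorem neg_sum_quadraticChar_trace (hk : ringChar k ≠ 2) {ψ : AddChar k R} (hψ : ψ ≠ 1) :
    -∑ θ : L, (quadraticChar L θ : R) * ψ (Algebra.trace k L θ) =
      (-∑ x : k, (quadraticChar k x : R) * ψ x) ^ Module.finrank k L := by
  set g := -∑ x : k, (quadraticChar k x : R) * ψ x with hg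
  -- The L-function is linear with the Gauss sum as its only reciprocal root, whence the pure power.
  have hser : PowerSeries.mk (monicSum (gaussFun ψ)) = 1 - PowerSeries.C g * PowerSeries.X := by
    ext n
    rw [PowerSeries.coeff_mk]
    match n with
    | 0 => simp [monicSum_gaussFun_zero]
    | 1 => simp [monicSum_gaussFun_one, hg, PowerSeries.coeff_one]
    | n + 2 =>
      rw [monicSum_gaussFun_of_two_le hψ (by omega), map_sub, PowerSeries.coeff_C_mul,
        PowerSeries.coeff_X, PowerSeries.coeff_one]
      simp
  have h1 := X_mul_derivative_monicSum (gaussFun_one ψ) (gaussFun_mul ψ)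
  rw [hser, X_mul_derivative_one_sub_C_mul_X] at h1
  have hne : (1 - PowerSeries.C g * PowerSeries.X : R⟦X⟧) ≠ 0 := by
    intro h
    simpa using congrArg PowerSeries.constantCoeff h
  have h2 := congrArg (PowerSeries.coeff (Module.finrank k L)) (mul_right_cancel₀ hne h1)
  rw [PowerSeries.coeff_mk, PowerSeries.coeff_mk, if_neg Module.finrank_pos.ne',
    ← extensionSum_eq_primeSum L, extensionSum_gaussFun hk] at h2
  rw [← h2, neg_neg]

end GaussSums

/-! ### Kloosterman sums over extensions. -/

section KloostermanSums

open Finset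

variable {k : Type*} [Field k] [Fintype k] [DecidableEq k]
variable {R : Type*} [CommRing R] [IsDomain R] [CharZero R]

/-- The multiplicative function on monic polynomials attached to a Kloosterman sum. -/
def kloostermanFun (ψ : AddChar k R) (γ : k) (f : k[X]) : R :=
  if f.coeff 0 = 0 then 0 else ψ (-f.nextCoeff - γ * (f.coeff 1 / f.coeff 0))

omit [IsDomain R] [CharZero R] in
lemma kloostermanFun_one (ψ : AddChar k R) (γ : k) : kloostermanFun ψ γ 1 = 1 := by
  simp [kloostermanFun, nextCoeff, coeff_one]

-- Both arguments of ψ are additive over products: the next coefficient is minus the sum of the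
-- roots, and the quotient f₁/f₀ is the logarithmic derivative at 0.
omit [IsDomain R] [CharZero R] in
lemma kloostermanFun_mul (ψ : AddChar k R) (γ : k) (f g : k[X]) (hf : f.Monic) (hg : g.Monic) :
    kloostermanFun ψ γ (f * g) = kloostermanFun ψ γ f * kloostermanFun ψ γ g := by
  rw [kloostermanFun, kloostermanFun, kloostermanFun, hf.nextCoeff_mul hg, mul_coeff_zero,
    mul_coeff_one]
  by_cases h1 : f.coeff 0 = 0
  · simp [h1]
  by_cases h2 : g.coeff 0 = 0
  · simp [h2]
  rw [if_neg (mul_ne_zero h1 h2), if_neg h1, if_neg h2, ← AddChar.map_add_eq_mul]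
  congr 1
  field_simp
  ring

lemma monicSum_kloostermanFun_zero (ψ : AddChar k R) (γ : k) :
    monicSum (kloostermanFun ψ γ) 0 = 1 := by
  rw [monicSum, sum_monicFinset_zero, kloostermanFun_one]

lemma sum_units_eq (F : k → R) : ∑ x : kˣ, F x = ∑ x : k, if x = 0 then 0 else F x := by
  classical
  have h0 : ∑ x : k with x = 0, (if x = 0 then 0 else F x) = 0 :=
    sum_eq_zero fun x hx => if_pos (mem_filter.mp hx).2
  rw [← sum_filter_add_sum_filter_not univ (fun x : k => x = 0), h0, zero_add]
  · rw [sum_congr rfl fun x hx => if_neg (mem_filter.mp hx).2]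
    symm
    refine sum_bij (fun x hx => Units.mk0 x (mem_filter.mp hx).2) (fun _ _ => mem_univ _)
      (fun x hx y hy h => by simpa using congrArg Units.val h)
      (fun x _ => ⟨x, by simp, by simp⟩) (fun x hx => by simp)
lemma monicSum_kloostermanFun_one (ψ : AddChar k R) (γ : k) :
    monicSum (kloostermanFun ψ γ) 1 = ∑ x : kˣ, ψ (x + γ / x) := by
  rw [monicSum, sum_monicFinset_one, sum_units_eq fun x : k => ψ (x + γ / x)]
  refine Fintype.sum_equiv (Equiv.neg k) _ _ fun b => ?_
  simp only [kloostermanFun, coeff_add, coeff_X_zero, coeff_C_zero, zero_add, coeff_X_one,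
    coeff_C_succ, add_zero, nextCoeff_X_add_C, Equiv.neg_apply, neg_eq_zero]
  congr 2
  rw [div_neg, one_div, div_eq_mul_inv, sub_eq_add_neg]

/-- For X² + cX + b the argument of ψ is linear in c with slope -(1 + γ/b). The sum over c vanishes
unless b = -γ, where it equals |k|. -/
lemma monicSum_kloostermanFun_two {ψ : AddChar k R} (hψ : ψ ≠ 1) {γ : k} (hγ : γ ≠ 0) :
    monicSum (kloostermanFun ψ γ) 2 = Fintype.card k := by
  rw [monicSum, sum_monicFinset_two, sum_comm]
  have h (b c : k) : kloostermanFun ψ γ (X ^ 2 + C c * X + C b) =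
      if b = 0 then 0 else ψ (c * (-(1 + γ / b))) := by
    have hd : (X ^ 2 + C c * X + C b : k[X]).natDegree = 2 := by
      have := natDegree_quadratic (R := k) (a := 1) (b := c) (c := b) one_ne_zero
      simpa using this
    rw [kloostermanFun, nextCoeff_of_natDegree_pos (by omega), hd]
    simp only [coeff_add, coeff_X_pow, coeff_C_mul, coeff_X, coeff_C]
    norm_num
    congr 2
    ring
  simp_rw [h]
  rw [sum_eq_single (-γ)]
  · simp_rw [if_neg (neg_ne_zero.mpr hγ), div_neg, div_self hγ]
    simp
  · intro b _ hb
    split_ifs with h0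
    · simp
    · have hne : -(1 + γ / b) ≠ 0 := by
        intro h
        apply hb
        field_simp at h
        linear_combination -h
      have := AddChar.sum_mulShift (R' := R) (-(1 + γ / b)) (AddChar.IsPrimitive.of_ne_one hψ)
      rwa [if_neg hne, Nat.cast_zero] at this
  · simp

/-- From degree 3 on, the second highest coefficient is distinct from both coefficients 0 and 1, and
summing over it gives zero. -/
lemma monicSum_kloostermanFun_of_three_le {ψ : AddChar k R} (hψ : ψ ≠ 1) (γ : k) {n : ℕ}
    (hn : 3 ≤ n) : monicSum (kloostermanFun ψ γ) n = 0 := by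
  refine sum_monicFinset_eq_zero (g := X ^ (n - 1)) ?_ _ fun f hf => ?_
  · rw [degree_X_pow]; norm_cast; omega
  · have h (c : k) : kloostermanFun ψ γ (f + C c * X ^ (n - 1)) = if f.coeff 0 = 0 then 0 else
        ψ (-f.nextCoeff - γ * (f.coeff 1 / f.coeff 0) - c) := by
      obtain ⟨h1, h2⟩ := nextCoeff_add_C_mul_X_pow (by omega) hf c
      have h3 : (f + C c * X ^ (n - 1)).coeff 0 = f.coeff 0 := by
        rw [coeff_add, coeff_C_mul_X_pow, if_neg (by omega), add_zero]
      have h4 : (f + C c * X ^ (n - 1)).coeff 1 = f.coeff 1 := by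
        rw [coeff_add, coeff_C_mul_X_pow, if_neg (by omega), add_zero]
      rw [kloostermanFun, h1, h3, h4]
      congr 2
      ring
    simp_rw [h]
    split_ifs
    · simp
    · exact sum_addChar_sub hψ _

variable {L : Type*} [Field L] [Fintype L] [DecidableEq L] [Algebra k L]

lemma extensionSum_kloostermanFun (ψ : AddChar k R) (γ : k) :
    extensionSum (kloostermanFun ψ γ) L =
      ∑ x : Lˣ, ψ (Algebra.trace k L (x + algebraMap k L γ / x)) := by
  rw [extensionSum_eq_sum_charPoly (kloostermanFun_one ψ γ) (kloostermanFun_mul ψ γ),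
    sum_units_eq fun x : L => ψ (Algebra.trace k L (x + algebraMap k L γ / x))]
  refine sum_congr rfl fun θ _ => ?_
  by_cases h : θ = 0
  · rw [if_pos h, kloostermanFun, if_pos]
    have := coeff_zero_charPoly (k := k) θ
    rw [h, Algebra.norm_zero, mul_eq_zero] at this
    rw [h]
    exact this.resolve_left (pow_ne_zero _ (neg_ne_zero.mpr one_ne_zero))
  · rw [if_neg h, kloostermanFun, if_neg (coeff_zero_charPoly_ne_zero h),
      neg_nextCoeff_charPoly, coeff_one_div_coeff_zero_charPoly h, map_add, div_eq_mul_inv,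
      ← Algebra.smul_def, map_smul, smul_eq_mul]
    congr 1
    ring

/-- The rationality of the `L`-function of Kloosterman sums. -/
theorem sum_kloosterman_trace {ψ : AddChar k R} (hψ : ψ ≠ 1) {γ : k} (hγ : γ ≠ 0) {κ κ' : R}
    (hadd : κ + κ' = -∑ x : kˣ, ψ (x + γ / x)) (hmul : κ * κ' = Fintype.card k) :
    -∑ x : Lˣ, ψ (Algebra.trace k L (x + algebraMap k L γ / x)) =
      κ ^ Module.finrank k L + κ' ^ Module.finrank k L := by
  have hser : PowerSeries.mk (monicSum (kloostermanFun ψ γ)) =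
      (1 - PowerSeries.C κ * PowerSeries.X) * (1 - PowerSeries.C κ' * PowerSeries.X) := by
    have : (1 - PowerSeries.C κ * PowerSeries.X) * (1 - PowerSeries.C κ' * PowerSeries.X) =
        1 - PowerSeries.C (κ + κ') * PowerSeries.X
          + PowerSeries.C (κ * κ') * PowerSeries.X ^ 2 := by
      rw [map_add, map_mul]; ring
    rw [this, hadd, hmul]
    ext n
    rw [PowerSeries.coeff_mk, map_add, map_sub, PowerSeries.coeff_C_mul, PowerSeries.coeff_C_mul,
      PowerSeries.coeff_X, PowerSeries.coeff_one, PowerSeries.coeff_X_pow]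
    match n with
    | 0 => simp [monicSum_kloostermanFun_zero]
    | 1 => simp [monicSum_kloostermanFun_one]
    | 2 => simp [monicSum_kloostermanFun_two hψ hγ]
    | n + 3 => simp [monicSum_kloostermanFun_of_three_le hψ γ (show 3 ≤ n + 3 by omega)]
  have h1 := X_mul_derivative_monicSum (kloostermanFun_one ψ γ) (kloostermanFun_mul ψ γ)
  have h3 := X_mul_derivative_one_sub_C_mul_X κ
  have h3' := X_mul_derivative_one_sub_C_mul_X κ'
  rw [hser, Derivation.leibniz, smul_eq_mul, smul_eq_mul] at h1
  have hne (g : R) : (1 - PowerSeries.C g * PowerSeries.X : R⟦X⟧) ≠ 0 := by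
    intro h
    simpa using congrArg PowerSeries.constantCoeff h
  -- Cancelling the quadratic L-function leaves the power sums of its reciprocal roots κ and κ'.
  have h4 : PowerSeries.mk (primeSum (kloostermanFun ψ γ)) =
      PowerSeries.mk (fun m => if m = 0 then 0 else -κ ^ m) +
        PowerSeries.mk (fun m => if m = 0 then 0 else -κ' ^ m) := by
    apply mul_right_cancel₀ (mul_ne_zero (hne κ) (hne κ'))
    rw [← h1]
    linear_combination (1 - PowerSeries.C κ' * PowerSeries.X) * h3
      + (1 - PowerSeries.C κ * PowerSeries.X) * h3'
  have h2 := congrArg (PowerSeries.coeff (Module.finrank k L)) h4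
  rw [map_add, PowerSeries.coeff_mk, PowerSeries.coeff_mk, PowerSeries.coeff_mk,
    if_neg Module.finrank_pos.ne', if_neg Module.finrank_pos.ne',
    ← extensionSum_eq_primeSum L, extensionSum_kloostermanFun] at h2
  rw [h2]; ring

end KloostermanSums

end EllipticL

namespace EllipticL

/-! ### Point counts on y² = x³ + Ax² + γx over extensions. -/

section CubicSums

open Finset

variable {k : Type*} [Field k] [Fintype k] [DecidableEq k]

/-- The quadratic polynomial `x² + A x + γ`. -/
def quadPoly (A γ : k) : k[X] := X ^ 2 + C A * X + C γ

/-- The resultant of a polynomial with the quadratic polynomial `x² + A x + γ`. -/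
def quadRes (A γ : k) (f : k[X]) : k :=
  (f %ₘ quadPoly A γ).coeff 0 ^ 2 -
    A * (f %ₘ quadPoly A γ).coeff 0 * (f %ₘ quadPoly A γ).coeff 1 +
    γ * (f %ₘ quadPoly A γ).coeff 1 ^ 2

lemma quadPoly_monic (A γ : k) : (quadPoly A γ).Monic := by
  have : (quadPoly A γ) = X ^ 2 + (C A * X + C γ) := by rw [quadPoly, add_assoc]
  rw [this]
  exact monic_X_pow_add (lt_of_le_of_lt degree_linear_le (by norm_num))

lemma degree_quadPoly (A γ : k) : (quadPoly A γ).degree = 2 := by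
  have := degree_quadratic (R := k) (a := 1) (b := A) (c := γ) one_ne_zero
  simpa [quadPoly] using this

lemma quadRes_eq (A γ : k) {f g : k[X]} {u v : k} (h : f = g * quadPoly A γ + (C v * X + C u)) :
    quadRes A γ f = u ^ 2 - A * u * v + γ * v ^ 2 := by
  have h1 : f %ₘ quadPoly A γ = C v * X + C u := by
    refine (div_modByMonic_unique g _ (quadPoly_monic A γ) ⟨?_, ?_⟩).2
    · rw [h]; ring
    · rw [degree_quadPoly]
      exact lt_of_le_of_lt degree_linear_le (by norm_num)
  rw [quadRes, h1]
  simp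

/-- Only the remainder u + vX matters, and (u + v r₁)(u + v r₂) = u² - Auv + γv². This form makes
multiplicativity and the link with norms evident. -/
lemma map_quadRes (A γ : k) (f : k[X]) {Ω : Type*} [Field Ω] [Algebra k Ω] {r₁ r₂ : Ω}
    (hadd : r₁ + r₂ = -algebraMap k Ω A) (hmul : r₁ * r₂ = algebraMap k Ω γ) :
    algebraMap k Ω (quadRes A γ f) = aeval r₁ f * aeval r₂ f := by
  have h1 : r₁ ^ 2 + algebraMap k Ω A * r₁ + algebraMap k Ω γ = 0 := by
    linear_combination -r₁ * hadd.symm - hmul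
  have h2 : r₂ ^ 2 + algebraMap k Ω A * r₂ + algebraMap k Ω γ = 0 := by
    linear_combination -r₂ * hadd.symm - hmul
  have hdeg : (f %ₘ quadPoly A γ).degree ≤ 1 := by
    have := degree_modByMonic_lt f (quadPoly_monic A γ)
    rw [degree_quadPoly] at this
    exact Order.le_of_lt_succ this
  have hf := eq_X_add_C_of_degree_le_one hdeg
  set u := (f %ₘ quadPoly A γ).coeff 0
  set v := (f %ₘ quadPoly A γ).coeff 1
  have hf' : f = (f /ₘ quadPoly A γ) * quadPoly A γ + (C v * X + C u) := by
    rw [← hf, add_comm, mul_comm]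
    exact (modByMonic_add_div f (quadPoly A γ)).symm
  rw [quadRes_eq A γ hf']
  have key (r : Ω) (hr : r ^ 2 + algebraMap k Ω A * r + algebraMap k Ω γ = 0) :
      aeval r f = algebraMap k Ω v * r + algebraMap k Ω u := by
    rw [hf']
    simp [quadPoly, hr]
  rw [key r₁ h1, key r₂ h2]
  simp only [map_sub, map_add, map_mul, map_pow]
  linear_combination (-algebraMap k Ω u * algebraMap k Ω v) * hadd - algebraMap k Ω v ^ 2 * hmul

lemma exists_roots_quadPoly (A γ : k) (Ω : Type*) [Field Ω] [Algebra k Ω] [IsAlgClosed Ω] :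
    ∃ r₁ r₂ : Ω, r₁ + r₂ = -algebraMap k Ω A ∧ r₁ * r₂ = algebraMap k Ω γ := by
  obtain ⟨r, hr⟩ := IsAlgClosed.exists_aeval_eq_zero Ω (quadPoly A γ)
    (by rw [degree_quadPoly]; norm_num)
  simp only [quadPoly, map_add, map_mul, map_pow, aeval_X, aeval_C] at hr
  exact ⟨r, -algebraMap k Ω A - r, by ring, by linear_combination -hr⟩

lemma quadRes_mul (A γ : k) (f g : k[X]) :
    quadRes A γ (f * g) = quadRes A γ f * quadRes A γ g := by
  obtain ⟨r₁, r₂, h1, h2⟩ := exists_roots_quadPoly A γ (AlgebraicClosure k)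
  apply FaithfulSMul.algebraMap_injective k (AlgebraicClosure k)
  rw [map_mul, map_quadRes A γ _ h1 h2, map_quadRes A γ _ h1 h2, map_quadRes A γ _ h1 h2,
    map_mul, map_mul]
  ring

/-- Evaluating ∏(X - σθ) at the two roots and pairing the factors gives the product of the
conjugates of θ² + Aθ + γ. -/
lemma quadRes_charPoly (A γ : k) {L : Type*} [Field L] [Fintype L] [Algebra k L] (θ : L) :
    quadRes A γ (charPoly k θ) =
      Algebra.norm k (θ ^ 2 + algebraMap k L A * θ + algebraMap k L γ) := by
  obtain ⟨r₁, r₂, h1, h2⟩ := exists_roots_quadPoly A γ (AlgebraicClosure L)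
  apply FaithfulSMul.algebraMap_injective k (AlgebraicClosure L)
  have key (r : AlgebraicClosure L) : aeval r (charPoly k θ) =
      ∏ σ : L ≃ₐ[k] L, (r - algebraMap L (AlgebraicClosure L) (σ θ)) := by
    rw [← aeval_map_algebraMap L, map_charPoly, map_prod]
    simp
  rw [map_quadRes A γ _ h1 h2, key, key, ← prod_mul_distrib,
    IsScalarTower.algebraMap_apply k L (AlgebraicClosure L), Algebra.norm_eq_prod_automorphisms,
    map_prod]
  refine prod_congr rfl fun σ _ => ?_
  rw [IsScalarTower.algebraMap_apply k L (AlgebraicClosure L)] at h1 h2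
  simp only [map_add, map_mul, map_pow, AlgEquiv.commutes]
  linear_combination h2 - algebraMap L (AlgebraicClosure L) (σ θ) * h1

/-- The multiplicative function on monic polynomials attached to the cubic
`x (x² + A x + γ)`. -/
def cubicFun (A γ : k) (f : k[X]) : ℤ :=
  quadraticChar k ((-1) ^ f.natDegree * f.coeff 0 * quadRes A γ f)

lemma cubicFun_one (A γ : k) : cubicFun A γ 1 = 1 := by
  rw [cubicFun, quadRes_eq A γ (g := 0) (u := 1) (v := 0) (by simp)]
  simp

lemma cubicFun_mul (A γ : k) (f g : k[X]) (hf : f.Monic) (hg : g.Monic) :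
    cubicFun A γ (f * g) = cubicFun A γ f * cubicFun A γ g := by
  rw [cubicFun, cubicFun, cubicFun, ← map_mul, hf.natDegree_mul hg, mul_coeff_zero, quadRes_mul]
  congr 1
  ring

lemma monicSum_cubicFun_zero (A γ : k) : monicSum (cubicFun A γ) 0 = 1 := by
  rw [monicSum, sum_monicFinset_zero, cubicFun_one]

lemma monicSum_cubicFun_one (A γ : k) : monicSum (cubicFun A γ) 1 =
    ∑ x : k, quadraticChar k (x ^ 3 + A * x ^ 2 + γ * x) := by
  rw [monicSum, sum_monicFinset_one]
  refine Fintype.sum_equiv (Equiv.neg k) _ _ fun b => ?_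
  rw [cubicFun, quadRes_eq A γ (g := 0) (u := b) (v := 1) (by simp)]
  simp only [natDegree_X_add_C, coeff_add, coeff_X_zero, coeff_C_zero, Equiv.neg_apply]
  congr 1
  ring

/-- The remainder of X² + cX + b is (c - A)X + (b - γ), so the sum over c is that of λ over a
quadratic of discriminant (A² - 4γ)(b - γ)². If A² = 4γ it does not depend on b and the factor λ(b)
sums to zero; otherwise only b = γ deviates, and contributes |k|. -/
lemma monicSum_cubicFun_two (hk : ringChar k ≠ 2) (A : k) {γ : k} (hγ : γ ≠ 0) :
    monicSum (cubicFun A γ) 2 = if A ^ 2 = 4 * γ then 0 else (Fintype.card k : ℤ) := by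
  have h (b c : k) : cubicFun A γ (X ^ 2 + C c * X + C b) = quadraticChar k b *
      quadraticChar k (γ * (c - A) ^ 2 + -(A * (b - γ)) * (c - A) + (b - γ) ^ 2) := by
    have hd : (X ^ 2 + C c * X + C b : k[X]).natDegree = 2 := by
      have := natDegree_quadratic (R := k) (a := 1) (b := c) (c := b) one_ne_zero
      simpa using this
    rw [cubicFun, quadRes_eq A γ (g := 1) (u := b - γ) (v := c - A), hd, ← map_mul]
    · congr 1
      have hc : (X ^ 2 + C c * X + C b : k[X]).coeff 0 = b := by simp
      rw [hc]
      ring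
    · simp only [quadPoly, map_sub]; ring
  rw [monicSum, sum_monicFinset_two, sum_comm]
  simp_rw [h, ← mul_sum]
  have h2 (b : k) : ∑ c : k, quadraticChar k
      (γ * (c - A) ^ 2 + -(A * (b - γ)) * (c - A) + (b - γ) ^ 2) =
      quadraticChar k γ * if A ^ 2 = 4 * γ ∨ b = γ then (Fintype.card k : ℤ) - 1 else -1 := by
    have h3 := sum_quadraticChar_quadratic hk hγ (-(A * (b - γ))) ((b - γ) ^ 2)
    have h4 : (-(A * (b - γ))) ^ 2 = 4 * γ * (b - γ) ^ 2 ↔ A ^ 2 = 4 * γ ∨ b = γ := by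
      rw [neg_sq, mul_pow, mul_eq_mul_right_iff, pow_eq_zero_iff two_ne_zero, sub_eq_zero]
    simp_rw [h4] at h3
    rw [← h3]
    exact Fintype.sum_equiv (Equiv.subRight A) _ _ fun c => rfl
  simp_rw [h2]
  split_ifs with hA
  · simp only [hA, true_or, if_true]
    rw [← sum_mul, quadraticChar_sum_zero hk, zero_mul]
  · simp only [hA, false_or]
    have h5 (b : k) : quadraticChar k b * (quadraticChar k γ *
        if b = γ then (Fintype.card k : ℤ) - 1 else -1) =
        -quadraticChar k γ * quadraticChar k b +
          if b = γ then (Fintype.card k : ℤ) else 0 := by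
      split_ifs with hb
      · subst hb
        linear_combination (Fintype.card k : ℤ) * quadraticChar_mul_self hγ
      · ring
    simp_rw [h5, sum_add_distrib, ← mul_sum, quadraticChar_sum_zero hk]
    simp

/-- Adding c(x² + Ax + γ) preserves the resultant and shifts the constant coefficient by cγ, which
runs over the whole field. -/
lemma monicSum_cubicFun_of_three_le (hk : ringChar k ≠ 2) (A : k) {γ : k} (hγ : γ ≠ 0) {n : ℕ}
    (hn : 3 ≤ n) : monicSum (cubicFun A γ) n = 0 := by
  have hdeg : (quadPoly A γ).degree < n := by rw [degree_quadPoly]; norm_cast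
  refine sum_monicFinset_eq_zero hdeg _ fun f hf => ?_
  obtain ⟨hm, hd⟩ := mem_monicFinset.mp hf
  have h (c : k) : cubicFun A γ (f + C c * quadPoly A γ) =
      quadraticChar k ((-1) ^ n * quadRes A γ f) * quadraticChar k (f.coeff 0 + c * γ) := by
    have h1 : (C c * quadPoly A γ).degree < f.degree := by
      rw [degree_eq_natDegree hm.ne_zero, hd, degree_mul]
      refine lt_of_le_of_lt ?_ hdeg
      calc (C c).degree + (quadPoly A γ).degree ≤ 0 + (quadPoly A γ).degree := by
            gcongr; exact degree_C_le
        _ = (quadPoly A γ).degree := zero_add _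
    have h2 : (f + C c * quadPoly A γ).coeff 0 = f.coeff 0 + c * γ := by simp [quadPoly]
    have h3 : quadRes A γ (f + C c * quadPoly A γ) = quadRes A γ f := by
      rw [quadRes, quadRes, add_modByMonic,
        (modByMonic_eq_zero_iff_dvd (quadPoly_monic A γ)).mpr (dvd_mul_left _ _), add_zero]
    rw [cubicFun, natDegree_add_eq_left_of_degree_lt h1, hd, h2, h3, ← map_mul]
    congr 1
    ring
  simp_rw [h, ← mul_sum]
  have h6 : ∑ c : k, quadraticChar k (f.coeff 0 + c * γ) = 0 := by
    rw [← quadraticChar_sum_zero hk]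
    exact Fintype.sum_bijective (fun c : k => f.coeff 0 + c * γ)
      (Finite.injective_iff_bijective.mp fun u w h =>
        mul_right_cancel₀ hγ (add_left_cancel h)) _ _ fun u => rfl
  rw [h6, mul_zero]

lemma extensionSum_cubicFun (hk : ringChar k ≠ 2) (A γ : k)
    {L : Type*} [Field L] [Fintype L] [DecidableEq L] [Algebra k L] :
    extensionSum (cubicFun A γ) L =
      ∑ x : L, quadraticChar L (x ^ 3 + algebraMap k L A * x ^ 2 + algebraMap k L γ * x) := by
  rw [extensionSum_eq_sum_charPoly (cubicFun_one A γ) (cubicFun_mul A γ)]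
  refine sum_congr rfl fun θ _ => ?_
  rw [cubicFun, natDegree_charPoly, coeff_zero_charPoly, quadRes_charPoly, ← map_mul,
    quadraticChar_norm hk]
  congr 1
  ring

/-- The rationality of the zeta function of the curve `y² = x³ + A x² + γ x` over a finite field:
the point counts over extensions are determined by the number of rational points. -/
theorem X_mul_derivative_cubic (hk : ringChar k ≠ 2) (A : k) {γ : k} (hγ : γ ≠ 0) :
    ∃ s : ℤ⟦X⟧, PowerSeries.coeff 0 s = 0 ∧
      (∀ (L : Type*) [Field L] [Fintype L] [DecidableEq L] [Algebra k L],
        PowerSeries.coeff (Module.finrank k L) s =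
          ∑ x : L, quadraticChar L (x ^ 3 + algebraMap k L A * x ^ 2 + algebraMap k L γ * x)) ∧
      ∀ l : ℤ⟦X⟧, l = 1 + PowerSeries.C (∑ x : k, quadraticChar k (x ^ 3 + A * x ^ 2 + γ * x)) *
          PowerSeries.X + PowerSeries.C (if A ^ 2 = 4 * γ then 0 else (Fintype.card k : ℤ)) *
          PowerSeries.X ^ 2 → PowerSeries.X * PowerSeries.derivative (R := ℤ) l = s * l := by
  refine ⟨PowerSeries.mk (primeSum (cubicFun A γ)), by simp [primeSum], ?_, ?_⟩
  · intro L _ _ _ _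
    rw [PowerSeries.coeff_mk, ← extensionSum_eq_primeSum L, extensionSum_cubicFun hk]
  · rintro l rfl
    have h1 := X_mul_derivative_monicSum (cubicFun_one A γ) (cubicFun_mul A γ)
    convert h1 using 2 <;> try congr 1
    all_goals
    · ext n
      rw [PowerSeries.coeff_mk, map_add, map_add, PowerSeries.coeff_C_mul, PowerSeries.coeff_C_mul,
        PowerSeries.coeff_X, PowerSeries.coeff_one, PowerSeries.coeff_X_pow]
      match n with
      | 0 => simp [monicSum_cubicFun_zero]
      | 1 => simp [monicSum_cubicFun_one]
      | 2 => simp [monicSum_cubicFun_two hk A hγ]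
      | n + 3 => simp [monicSum_cubicFun_of_three_le hk A hγ (show 3 ≤ n + 3 by omega)]

end CubicSums

end EllipticL

namespace EllipticL

/-! ### Affine places of F(t) and their geometric points. -/

section Places

open Finset

variable {F : Type u} [Field F]

lemma aeval_ratFunc_X (f : F[X]) :
    aeval (RatFunc.X : RatFunc F) f = algebraMap F[X] (RatFunc F) f := by
  rw [← RatFunc.algebraMap_X, aeval_algebraMap_apply, aeval_X_left_apply]

namespace Place

variable {v : Place F (RatFunc F)}

lemma coord_eq (h : (RatFunc.X : RatFunc F) ∈ v.ring) :
    v.coord = IsLocalRing.residue v.ring ⟨RatFunc.X, h⟩ := dif_pos h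

lemma algebraMap_polynomial_mem (h : (RatFunc.X : RatFunc F) ∈ v.ring) (f : F[X]) :
    algebraMap F[X] (RatFunc F) f ∈ v.ring := by
  rw [← aeval_ratFunc_X, ← v.coe_aeval ⟨RatFunc.X, h⟩ f]
  exact Subtype.property _

lemma residue_polynomial (h : (RatFunc.X : RatFunc F) ∈ v.ring) (f : F[X]) :
    IsLocalRing.residue v.ring ⟨algebraMap F[X] (RatFunc F) f, algebraMap_polynomial_mem h f⟩ =
      aeval v.coord f := by
  have h1 : (⟨algebraMap F[X] (RatFunc F) f, algebraMap_polynomial_mem h f⟩ : v.ring) =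
      aeval ⟨RatFunc.X, h⟩ f :=
    Subtype.ext (by rw [v.coe_aeval, aeval_ratFunc_X])
  rw [h1, coord_eq h]
  exact (aeval_algebraMap_apply v.residueField (⟨RatFunc.X, h⟩ : v.ring) f).symm

lemma isUnit_iff_inv_mem {x : RatFunc F} (hx : x ∈ v.ring) (hx0 : x ≠ 0) :
    IsUnit (⟨x, hx⟩ : v.ring) ↔ x⁻¹ ∈ v.ring := by
  constructor
  · intro h
    obtain ⟨w, hw⟩ := h.exists_right_inv
    have : x * (w : RatFunc F) = 1 := congrArg Subtype.val hw
    rw [← eq_inv_of_mul_eq_one_right this]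
    exact w.2
  · intro h
    exact IsUnit.of_mul_eq_one ⟨x⁻¹, h⟩ (Subtype.ext (mul_inv_cancel₀ hx0))

/-- The valuation ring is F[t] localised at the polynomials vanishing at the coordinate. A reduced
fraction in the ring cannot have its denominator vanish there, since its numerator would vanish too.
-/
lemma mem_ring_iff (h : (RatFunc.X : RatFunc F) ∈ v.ring) {z : RatFunc F} :
    z ∈ v.ring ↔ ∃ f g : F[X], aeval v.coord g ≠ 0 ∧
      z * algebraMap F[X] (RatFunc F) g = algebraMap F[X] (RatFunc F) f := by
  constructor
  · intro hz
    refine ⟨z.num, z.denom, fun hg => ?_, ?_⟩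
    · have h1 : (⟨z, hz⟩ : v.ring) * ⟨_, algebraMap_polynomial_mem h z.denom⟩ =
          ⟨_, algebraMap_polynomial_mem h z.num⟩ := by
        apply Subtype.ext
        change z * algebraMap F[X] (RatFunc F) z.denom = algebraMap F[X] (RatFunc F) z.num
        nth_rewrite 1 [← RatFunc.num_div_denom z]
        exact div_mul_cancel₀ _ (RatFunc.algebraMap_ne_zero z.denom_ne_zero)
      have h2 := congrArg (IsLocalRing.residue v.ring) h1
      rw [map_mul, residue_polynomial h, residue_polynomial h, hg, mul_zero] at h2
      obtain ⟨r, s, hrs⟩ := z.isCoprime_num_denom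
      have := congrArg (aeval v.coord) hrs
      simp [hg, ← h2] at this
    · nth_rewrite 1 [← RatFunc.num_div_denom z]
      exact div_mul_cancel₀ _ (RatFunc.algebraMap_ne_zero z.denom_ne_zero)
  · rintro ⟨f, g, hg, hz⟩
    have hg0 : algebraMap F[X] (RatFunc F) g ≠ 0 := by
      apply RatFunc.algebraMap_ne_zero
      rintro rfl
      simp at hg
    have hu : IsUnit (⟨_, algebraMap_polynomial_mem h g⟩ : v.ring) := by
      by_contra hnu
      apply hg
      rw [← residue_polynomial h, IsLocalRing.residue_eq_zero_iff]
      exact hnu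
    rw [eq_div_of_mul_eq hg0 hz, div_eq_mul_inv]
    exact v.ring.mul_mem _ _ (algebraMap_polynomial_mem h f) ((isUnit_iff_inv_mem _ hg0).mp hu)

variable [Finite F]

instance : Module.Finite F v.residueField := Module.Finite.of_finite

lemma isIntegral_coord : IsIntegral F v.coord := Algebra.IsIntegral.isIntegral _

lemma adjoin_coord (h : (RatFunc.X : RatFunc F) ∈ v.ring) :
    IntermediateField.adjoin F {v.coord} = ⊤ := by
  rw [eq_top_iff]
  rintro b -
  obtain ⟨⟨z, hz⟩, rfl⟩ := IsLocalRing.residue_surjective b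
  obtain ⟨f, g, hg, hfg⟩ := (mem_ring_iff h).mp hz
  have h1 : (⟨z, hz⟩ : v.ring) * ⟨_, algebraMap_polynomial_mem h g⟩ =
      ⟨_, algebraMap_polynomial_mem h f⟩ := Subtype.ext hfg
  have h2 := congrArg (IsLocalRing.residue v.ring) h1
  rw [map_mul, residue_polynomial h, residue_polynomial h] at h2
  have hmem (p : F[X]) : aeval v.coord p ∈ IntermediateField.adjoin F {v.coord} :=
    IntermediateField.algebra_adjoin_le_adjoin F _ (aeval_mem_adjoin_singleton F _)
  rw [eq_div_of_mul_eq hg h2]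
  exact div_mem (hmem _) (hmem _)

lemma degree_eq_natDegree (h : (RatFunc.X : RatFunc F) ∈ v.ring) :
    v.degree = (minpoly F v.coord).natDegree := by
  rw [← IntermediateField.adjoin.finrank isIntegral_coord, adjoin_coord h,
    IntermediateField.finrank_top', degree]

lemma degree_pos (v : Place F (RatFunc F)) : 0 < v.degree := Module.finrank_pos

lemma eq_of_minpoly_eq {w : Place F (RatFunc F)} (hv : (RatFunc.X : RatFunc F) ∈ v.ring)
    (hw : (RatFunc.X : RatFunc F) ∈ w.ring) (h : minpoly F v.coord = minpoly F w.coord) :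
    v = w := by
  apply Place.ext
  ext z
  rw [mem_ring_iff hv, mem_ring_iff hw]
  simp_rw [ne_eq, ← minpoly.dvd_iff, h]

omit [Finite F] in
lemma exists_mem_of_heightOneSpectrum (P : IsDedekindDomain.HeightOneSpectrum F[X]) :
    ∃ v : Place F (RatFunc F), (RatFunc.X : RatFunc F) ∈ v.ring ∧
      ∀ p ∈ P.asIdeal, aeval v.coord p = 0 := by
  have hmem (f : F[X]) : algebraMap F[X] (RatFunc F) f ∈ P.valuationSubringAtPrime (RatFunc F) :=
    (algebraMap F[X] (P.valuationSubringAtPrime (RatFunc F)) f).2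
  have hdvr : IsDiscreteValuationRing (P.valuationSubringAtPrime (RatFunc F)) :=
    IsLocalization.AtPrime.isDiscreteValuationRing_of_dedekind_domain F[X] P.ne_bot _
  let v : Place F (RatFunc F) := ⟨P.valuationSubringAtPrime (RatFunc F), fun c => by
    have := hmem (C c)
    rwa [← algebraMap_eq, ← IsScalarTower.algebraMap_apply] at this, hdvr⟩
  have hX : (RatFunc.X : RatFunc F) ∈ v.ring := by
    rw [← RatFunc.algebraMap_X]; exact hmem X
  refine ⟨v, hX, fun p hp => ?_⟩
  rw [← residue_polynomial hX, IsLocalRing.residue_eq_zero_iff]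
  exact (IsLocalization.AtPrime.to_map_mem_maximal_iff
    (P.valuationSubringAtPrime (RatFunc F)) P.asIdeal p).mpr hp

omit [Finite F] in
lemma exists_mem_of_irreducible {p : F[X]} (hp : Irreducible p) :
    ∃ v : Place F (RatFunc F), (RatFunc.X : RatFunc F) ∈ v.ring ∧ aeval v.coord p = 0 := by
  obtain ⟨v, hv, h⟩ := exists_mem_of_heightOneSpectrum ⟨Ideal.span {p},
    (Ideal.span_singleton_prime hp.ne_zero).mpr hp.prime, by simpa using hp.ne_zero⟩
  exact ⟨v, hv, h p (Ideal.mem_span_singleton_self p)⟩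

end Place

variable [Finite F]

variable (F) in
lemma finite_affinePlaces {n : ℕ} (hn : n ≠ 0) :
    {v : Place F (RatFunc F) | (RatFunc.X : RatFunc F) ∈ v.ring ∧ v.degree ∣ n}.Finite := by
  have := Fintype.ofFinite F
  refine Set.Finite.of_injOn (f := fun v => minpoly F v.coord) (t := irredFinset F n)
    (fun v hv => ?_) (fun v hv w hw h => Place.eq_of_minpoly_eq hv.1 hw.1 h)
    (Finset.finite_toSet _)
  rw [mem_coe, mem_irredFinset]
  refine ⟨minpoly.monic Place.isIntegral_coord, minpoly.irreducible Place.isIntegral_coord, ?_⟩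
  rw [← Place.degree_eq_natDegree hv.1]
  exact Nat.le_of_dvd (Nat.pos_of_ne_zero hn) hv.2

open Classical in
variable (F) in
/-- The places of `F(t)` at which `t` is integral and whose degree divides `n`. -/
def affinePlaces (n : ℕ) : Finset (Place F (RatFunc F)) :=
  if h : n ≠ 0 then (finite_affinePlaces F h).toFinset else ∅

lemma mem_affinePlaces {n : ℕ} (hn : n ≠ 0) {v : Place F (RatFunc F)} :
    v ∈ affinePlaces F n ↔ (RatFunc.X : RatFunc F) ∈ v.ring ∧ v.degree ∣ n := by
  rw [affinePlaces, dif_pos hn, Set.Finite.mem_toFinset, Set.mem_ofPred_eq]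

variable {L : Type*} [Field L] [Fintype L] [Algebra F L]

/-- The elements of a finite extension of `F` are the geometric points above the places of the
affine line. -/
lemma sum_eq_sum_affinePlaces {M : Type*} [AddCommMonoid M] (f : L → M) :
    ∑ β : L, f β = ∑ v ∈ affinePlaces F (Module.finrank F L),
      ∑ σ : v.residueField →ₐ[F] L, f (σ v.coord) := by
  have hn : Module.finrank F L ≠ 0 := Module.finrank_pos.ne'
  rw [sum_sigma']
  symm
  refine sum_bij (fun x _ => x.2 x.1.coord) (fun _ _ => mem_univ _) ?_ ?_ (fun _ _ => rfl)
  · rintro ⟨v, σ⟩ hv ⟨w, τ⟩ hw h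
    have hv := ((mem_affinePlaces hn).mp (mem_sigma.mp hv).1).1
    have hw := ((mem_affinePlaces hn).mp (mem_sigma.mp hw).1).1
    have h : σ v.coord = τ w.coord := h
    obtain rfl : v = w := by
      refine Place.eq_of_minpoly_eq hv hw ?_
      rw [← minpoly.algHom_eq σ σ.injective, h, minpoly.algHom_eq τ τ.injective]
    -- An embedding of the residue field is determined by the image of the coordinate, which
    -- generates it.
    have : σ = τ := by
      have h1 : (⊤ : IntermediateField F v.residueField) ≤
          IntermediateField.adjoin F {v.coord} := (Place.adjoin_coord hv).ge
      ext b
      have hb := h1 (IntermediateField.mem_top (x := b))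
      induction hb using IntermediateField.adjoin_induction with
      | mem x hx => rw [Set.mem_singleton_iff.mp hx, h]
      | algebraMap x => simp
      | add x y _ _ hx hy => rw [map_add, map_add, hx, hy]
      | inv x _ hx => rw [map_inv₀, map_inv₀, hx]
      | mul x y _ _ hx hy => rw [map_mul, map_mul, hx, hy]
    rw [this]
  · intro β _
    have hint : IsIntegral F β := Algebra.IsIntegral.isIntegral β
    obtain ⟨v, hv, h0⟩ := Place.exists_mem_of_irreducible (minpoly.irreducible hint)
    have hmin : minpoly F β = minpoly F v.coord :=
      minpoly.eq_of_irreducible_of_monic (minpoly.irreducible hint) h0 (minpoly.monic hint)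
    have hdvd : v.degree ∣ Module.finrank F L := by
      rw [Place.degree_eq_natDegree hv, ← hmin]
      exact minpoly.degree_dvd hint
    -- Any embedding sends the coordinate to a conjugate of β; a Galois automorphism of L then
    -- corrects it.
    obtain ⟨σ⟩ := FiniteField.nonempty_algHom_of_finrank_dvd hdvd
    have h1 : minpoly F β = minpoly F (σ v.coord) := by
      rw [minpoly.algHom_eq σ σ.injective, hmin]
    obtain ⟨τ, hτ⟩ := (Normal.minpoly_eq_iff_mem_orbit L).mp h1
    exact ⟨⟨v, (τ : L →ₐ[F] L).comp σ⟩,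
      mem_sigma.mpr ⟨(mem_affinePlaces hn).mpr ⟨hv, hdvd⟩, mem_univ _⟩, hτ⟩

lemma card_algHom_affinePlace {v : Place F (RatFunc F)}
    (hv : v ∈ affinePlaces F (Module.finrank F L)) :
    Fintype.card (v.residueField →ₐ[F] L) = v.degree := by
  rw [← Nat.card_eq_fintype_card]
  exact FiniteField.natCard_algHom_of_finrank_dvd
    ((mem_affinePlaces Module.finrank_pos.ne').mp hv).2

lemma coord_ne_zero_iff {v : Place F (RatFunc F)} (h : (RatFunc.X : RatFunc F) ∈ v.ring) :
    v.coord ≠ 0 ↔ (RatFunc.X : RatFunc F)⁻¹ ∈ v.ring := by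
  rw [Place.coord_eq h, ← Place.isUnit_iff_inv_mem h RatFunc.X_ne_zero, ne_eq,
    IsLocalRing.residue_eq_zero_iff, IsLocalRing.mem_maximalIdeal, mem_nonunits_iff, not_not]

lemma coord_pow_eq_iff {v : Place F (RatFunc F)} (h : (RatFunc.X : RatFunc F) ∈ v.ring) (a : ℕ) :
    v.coord ^ Nat.card F ^ a = v.coord ↔ v.degree ∣ a := by
  rw [Place.degree_eq_natDegree h,
    (minpoly.irreducible Place.isIntegral_coord).natDegree_dvd_iff_dvd_X_pow_card_pow_sub_X,
    minpoly.dvd_iff]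
  simp [sub_eq_zero]

/-- The description in terms of the coordinate is the condition on c that survives the summation
over β. -/
lemma mem_placesDividing_iff {v : Place F (RatFunc F)} (h : (RatFunc.X : RatFunc F) ∈ v.ring)
    (a : ℕ) : v ∈ placesDividing F a ↔ v.coord ≠ 0 ∧ v.coord ^ Nat.card F ^ a = v.coord := by
  rw [coord_ne_zero_iff h, coord_pow_eq_iff h]
  exact ⟨fun h' => h'.2, fun h' => ⟨h, h'⟩⟩

variable (F) in
lemma finite_placesDividing {a : ℕ} (ha : a ≠ 0) : (placesDividing F a).Finite :=
  (finite_affinePlaces F ha).subset fun _ hv => ⟨hv.1, hv.2.2⟩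

end Places

end EllipticL

namespace EllipticL

/-! ### Minimal Weierstrass equations away from residue characteristic two. -/

section MinimalModels

open WeierstrassCurve

/-- The Weierstrass curve `y² = x³ + A x² + γ x`. -/
def cubicCurve {R : Type*} [CommRing R] (A γ : R) : WeierstrassCurve R where
  a₁ := 0
  a₂ := A
  a₃ := 0
  a₄ := γ
  a₆ := 0

lemma map_cubicCurve {R S : Type*} [CommRing R] [CommRing S] (f : R →+* S) (A γ : R) :
    (cubicCurve A γ).map f = cubicCurve (f A) (f γ) := by
  ext <;> simp [cubicCurve]

lemma cubicCurve_Δ {R : Type*} [CommRing R] (A γ : R) :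
    (cubicCurve A γ).Δ = 16 * γ ^ 2 * (A ^ 2 - 4 * γ) := by
  simp only [WeierstrassCurve.Δ, b₂, b₄, b₆, b₈, cubicCurve]
  ring

lemma cubicCurve_c₄ {R : Type*} [CommRing R] (A γ : R) :
    (cubicCurve A γ).c₄ = 16 * (A ^ 2 - 3 * γ) := by
  simp only [c₄, b₂, b₄, cubicCurve]
  ring

variable {R : Type*} [CommRing R] [IsDomain R] [IsDiscreteValuationRing R]
variable {K : Type*} [Field K] [Algebra R K] [IsFractionRing R K]

/-- A criterion for minimality of a Weierstrass equation over a discrete valuation ring with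
residue characteristic different from two, and the uniqueness of minimal equations. -/
theorem exists_integralModel_minimal_eq_smul (h2 : IsUnit (2 : R)) (E : WeierstrassCurve K)
    (W : WeierstrassCurve R) (C₀ : VariableChange K) (hE : C₀ • E = W.map (algebraMap R K))
    (hΔ : W.Δ ≠ 0)
    (hmin : ∀ u : K, (∃ c, algebraMap R K c = u ^ 4 * algebraMap R K W.c₄) →
      (∃ d, algebraMap R K d = u ^ 12 * algebraMap R K W.Δ) → ∃ w, algebraMap R K w = u) :
    ∃ D : VariableChange R, integralModel R (E.minimal R) = D • W := by
  have hinj : Function.Injective (algebraMap R K) := IsFractionRing.injective R K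
  obtain ⟨D, hD⟩ : ∃ D : VariableChange K, E.minimal R = D • W.map (algebraMap R K) := by
    refine ⟨(E.exists_isMinimal R).choose * C₀⁻¹, ?_⟩
    rw [← hE, ← mul_smul, inv_mul_cancel_right]
    rfl
  set W' := E.minimal R with hW'
  set I := integralModel R W' with hI
  have hc₄ : algebraMap R K I.c₄ = (↑D.u⁻¹ : K) ^ 4 * algebraMap R K W.c₄ := by
    rw [hI, integralModel_c₄_eq, hD, variableChange_c₄, map_c₄]
  have hIΔ : W'.Δ = (↑D.u⁻¹ : K) ^ 12 * algebraMap R K W.Δ := by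
    rw [hD, variableChange_Δ, map_Δ]
  obtain ⟨w, hw⟩ := hmin _ ⟨_, hc₄⟩ ⟨I.Δ, by rw [hI, integralModel_Δ_eq, hIΔ]⟩
  -- Otherwise the discriminant of the minimal equation would have strictly smaller multiplicative
  -- valuation than that of W, against maximality.
  have hwu : IsUnit w := by
    by_contra hnu
    have hmax := (inferInstance : IsMinimal R W').val_Δ_maximal.2
    have hint : IsIntegral R (D⁻¹ • W') := by
      rw [hD, inv_smul_smul]
      exact ⟨⟨W, rfl⟩⟩
    have hint1 : IsIntegral R ((1 : VariableChange K) • W') := by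
      rw [one_smul]; infer_instance
    let val := IsDedekindDomain.HeightOneSpectrum.valuation K
      (IsDiscreteValuationRing.maximalIdeal R)
    have hval : val (algebraMap R K w) < 1 :=
      (IsDedekindDomain.HeightOneSpectrum.valuation_lt_one_iff_mem _ _).mpr hnu
    have hv1 : (valuation_Δ_aux R ((1 : VariableChange K) • W') : WithZero (Multiplicative ℤ)) =
        val (algebraMap R K w) ^ 12 * val (algebraMap R K W.Δ) := by
      rw [valuation_Δ_aux_eq_of_isIntegral, one_smul, hIΔ, ← hw, map_mul, map_pow]
    have hvD : (valuation_Δ_aux R (D⁻¹ • W') : WithZero (Multiplicative ℤ)) =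
        val (algebraMap R K W.Δ) := by
      rw [valuation_Δ_aux_eq_of_isIntegral, hD, inv_smul_smul, map_Δ]
    have hpos : 0 < val (algebraMap R K W.Δ) := by
      rw [zero_lt_iff, Valuation.ne_zero_iff]
      exact fun h => hΔ (hinj (by rw [h, map_zero]))
    have hlt : val (algebraMap R K w) ^ 12 * val (algebraMap R K W.Δ) <
        val (algebraMap R K W.Δ) :=
      mul_lt_of_lt_one_left hpos (pow_lt_one₀ zero_le hval (by norm_num))
    have h3 := hmax hint (by
      rw [← Subtype.coe_le_coe, hv1, hvD]
      exact hlt.le)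
    rw [← Subtype.coe_le_coe, hv1, hvD] at h3
    exact absurd h3 (not_le.mpr hlt)
  obtain ⟨w, rfl⟩ := hwu
  have hu : algebraMap R K ↑w⁻¹ = (D.u : K) := by
    have h1 : algebraMap R K ↑w⁻¹ * algebraMap R K w = 1 := by
      rw [← map_mul, Units.inv_mul, map_one]
    rw [hw] at h1
    calc algebraMap R K ↑w⁻¹ = algebraMap R K ↑w⁻¹ * (↑D.u⁻¹ * ↑D.u) := by simp
      _ = D.u := by rw [← mul_assoc, h1, one_mul]
  obtain ⟨c, hc⟩ := h2.exists_right_inv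
  have hcK : (2 : K) * algebraMap R K c = 1 := by
    have := congrArg (algebraMap R K) hc
    rwa [map_mul, map_one, map_ofNat] at this
  have huu : (↑D.u : K) * ↑D.u⁻¹ = 1 := by simp
  have ha₁ : algebraMap R K I.a₁ = ↑D.u⁻¹ * (algebraMap R K W.a₁ + 2 * D.s) := by
    rw [hI, integralModel_a₁_eq, hD, variableChange_a₁, map_a₁]
  have ha₃ : algebraMap R K I.a₃ =
      (↑D.u⁻¹ : K) ^ 3 * (algebraMap R K W.a₃ + D.r * algebraMap R K W.a₁ + 2 * D.t) := by
    rw [hI, integralModel_a₃_eq, hD, variableChange_a₃, map_a₃, map_a₁]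
  have hb₆ : algebraMap R K I.b₆ = (↑D.u⁻¹ : K) ^ 6 * (algebraMap R K W.b₆ +
      2 * D.r * algebraMap R K W.b₄ + D.r ^ 2 * algebraMap R K W.b₂ + 4 * D.r ^ 3) := by
    rw [hI, integralModel_b₆_eq, hD, variableChange_b₆, map_b₆, map_b₄, map_b₂]
  obtain ⟨r, hr⟩ : ∃ r, algebraMap R K r = D.r := by
    apply IsIntegrallyClosed.isIntegral_iff.mp
    -- The transformation rule for b₆, divided by 4, is a monic cubic equation for r with integral
    -- coefficients; here c = 1/2 and w⁻¹ = u. Then s and t come from the rules for a₁ and a₃.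
    refine ⟨X ^ 3 + (C (c ^ 2 * W.b₂) * X ^ 2 + C (2 * c ^ 2 * W.b₄) * X +
      C (c ^ 2 * (W.b₆ - ↑w⁻¹ ^ 6 * I.b₆))), monic_X_pow_add ?_, ?_⟩
    · exact lt_of_le_of_lt degree_quadratic_le (by norm_num)
    · rw [eval₂_add, eval₂_add, eval₂_add, eval₂_mul, eval₂_mul, eval₂_pow, eval₂_pow, eval₂_X,
        eval₂_C, eval₂_C, eval₂_C]
      simp only [map_mul, map_sub, map_pow, hu, hb₆, map_ofNat]
      have h6 : (↑D.u : K) ^ 6 * (↑D.u⁻¹ : K) ^ 6 = 1 := by rw [← mul_pow, huu, one_pow]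
      have hc2 : (4 : K) * algebraMap R K c ^ 2 = 1 := by
        linear_combination (2 * algebraMap R K c + 1) * hcK
      linear_combination (-algebraMap R K c ^ 2 * (algebraMap R K W.b₆ +
        2 * D.r * algebraMap R K W.b₄ + D.r ^ 2 * algebraMap R K W.b₂ + 4 * D.r ^ 3)) * h6
        - D.r ^ 3 * hc2
  have hs : algebraMap R K (c * (↑w⁻¹ * I.a₁ - W.a₁)) = D.s := by
    rw [map_mul, map_sub, map_mul, hu, ha₁]
    linear_combination algebraMap R K c * (algebraMap R K W.a₁ + 2 * D.s) * huu + D.s * hcK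
  have ht : algebraMap R K (c * (↑w⁻¹ ^ 3 * I.a₃ - W.a₃ - r * W.a₁)) = D.t := by
    have h3 : (↑D.u : K) ^ 3 * (↑D.u⁻¹ : K) ^ 3 = 1 := by rw [← mul_pow, huu, one_pow]
    rw [map_mul, map_sub, map_sub, map_mul, map_mul, map_pow, hu, ha₃, hr]
    linear_combination algebraMap R K c * (algebraMap R K W.a₃ + D.r * algebraMap R K W.a₁
      + 2 * D.t) * h3 + D.t * hcK
  refine ⟨⟨w⁻¹, r, c * (↑w⁻¹ * I.a₁ - W.a₁), c * (↑w⁻¹ ^ 3 * I.a₃ - W.a₃ - r * W.a₁)⟩, ?_⟩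
  apply WeierstrassCurve.map_injective hinj
  change I.map _ = (_ • W).map _
  have hIK : I.map (algebraMap R K) = W' := baseChange_integralModel_eq R W'
  rw [hIK, hD, ← map_variableChange]
  congr 1
  ext
  · exact hu.symm
  · exact hr.symm
  · exact hs.symm
  · exact ht.symm

end MinimalModels

/-! ### Invariance of point counts and their expression by the quadratic character. -/

section PointCounts

open WeierstrassCurve

lemma equation_smul_iff {k : Type*} [Field k] (W : WeierstrassCurve k) (D : VariableChange k)
    (x y : k) : (D • W).toAffine.Equation x y ↔
      W.toAffine.Equation (D.u ^ 2 * x + D.r) (D.u ^ 3 * y + D.u ^ 2 * D.s * x + D.t) := by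
  rw [Affine.equation_iff', Affine.equation_iff', variableChange_a₁, variableChange_a₂,
    variableChange_a₃, variableChange_a₄, variableChange_a₆]
  have huw : (↑D.u : k) * ↑D.u⁻¹ = 1 := by simp
  generalize (↑D.u⁻¹ : k) = w at *
  have hu0 : (↑D.u : k) ^ 6 ≠ 0 := pow_ne_zero 6 D.u.ne_zero
  generalize (↑D.u : k) = u at *
  have hw : w = u⁻¹ := eq_inv_of_mul_eq_one_right huw
  have hu : u ≠ 0 := left_ne_zero_of_mul_eq_one huw
  subst hw
  rw [← mul_right_inj' hu0, mul_zero]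
  refine Eq.congr_left ?_
  field_simp
  ring

lemma bijective_variableChange {k : Type*} [Field k] (D : VariableChange k) :
    Function.Bijective fun P : k × k =>
      (D.u ^ 2 * P.1 + D.r, D.u ^ 3 * P.2 + D.u ^ 2 * D.s * P.1 + D.t) := by
  have hu : (↑D.u : k) ≠ 0 := D.u.ne_zero
  constructor
  · rintro ⟨x, y⟩ ⟨x', y'⟩ h
    obtain ⟨h1, h2⟩ := Prod.ext_iff.mp h
    have hx : x = x' := mul_left_cancel₀ (pow_ne_zero 2 hu) (add_right_cancel h1)
    subst hx
    have hy : y = y' :=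
      mul_left_cancel₀ (pow_ne_zero 3 hu) (add_right_cancel (add_right_cancel h2))
    rw [hy]
  · rintro ⟨x, y⟩
    refine ⟨((x - D.r) / D.u ^ 2, (y - D.s * (x - D.r) - D.t) / D.u ^ 3), Prod.ext ?_ ?_⟩
    · dsimp only; field_simp; ring
    · dsimp only; field_simp; ring

lemma numPoints_smul {k : Type u} [Field k] (W : WeierstrassCurve k) (D : VariableChange k) :
    numPoints (D • W) = numPoints W := by
  have e : {P : k × k // (D • W).toAffine.Equation P.1 P.2} ≃
      {P : k × k // W.toAffine.Equation P.1 P.2} :=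
    (Equiv.ofBijective _ (bijective_variableChange D)).subtypeEquiv
    fun P => equation_smul_iff W D P.1 P.2
  rw [numPoints, numPoints, Nat.card_congr e]

lemma numPoints_cubicCurve {k : Type u} [Field k] [Fintype k] [DecidableEq k]
    (hk : ringChar k ≠ 2) (A γ : k) : (numPoints (cubicCurve A γ) : ℤ) =
      Fintype.card k + ∑ x : k, quadraticChar k (x ^ 3 + A * x ^ 2 + γ * x) + 1 := by
  have e : {P : k × k // (cubicCurve A γ).toAffine.Equation P.1 P.2} ≃
      Σ x : k, {y : k // y ^ 2 = x ^ 3 + A * x ^ 2 + γ * x} :=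
    { toFun := fun P => ⟨P.1.1, P.1.2, by
        have := (Affine.equation_iff _ _).mp P.2
        simpa [cubicCurve] using this⟩
      invFun := fun P => ⟨(P.1, P.2.1), (Affine.equation_iff _ _).mpr (by
        simpa [cubicCurve] using P.2.2)⟩
      left_inv := fun P => rfl
      right_inv := fun P => rfl }
  rw [numPoints, Nat.card_congr e, Nat.card_eq_fintype_card, Fintype.card_sigma]
  push_cast
  congr 1
  rw [← Finset.card_univ, Finset.card_eq_sum_ones, Nat.cast_sum, ← Finset.sum_add_distrib]
  refine Finset.sum_congr rfl fun x _ => ?_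
  have := quadraticChar_card_sqrts hk (x ^ 3 + A * x ^ 2 + γ * x)
  rw [Nat.cast_one, add_comm (1 : ℤ), ← this, Set.toFinset_card]
  rfl

end PointCounts

/-! ### Local factors computed from a minimal equation. -/

section LocalFactor

open WeierstrassCurve

variable {F : Type u} [Field F] [Finite F]

lemma ringChar_residueField (hF : ringChar F ≠ 2) (v : Place F (RatFunc F)) :
    ringChar v.residueField ≠ 2 := by
  rwa [← Algebra.ringChar_eq F v.residueField]

omit [Finite F] in
lemma isUnit_two (hF : ringChar F ≠ 2) {K : Type u} [Field K] [Algebra F K] (v : Place F K) :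
    IsUnit (2 : v.ring) := by
  have : IsUnit (2 : F) := (Ring.two_ne_zero hF).isUnit
  have := this.map (algebraMap F v.ring)
  rwa [map_ofNat] at this

lemma natCard_residueField (v : Place F (RatFunc F)) :
    Nat.card v.residueField = Nat.card F ^ v.degree :=
  Module.natCard_eq_pow_finrank

/-- The local factor at a place at which `E` has the minimal equation
`y² = x³ + A x² + γ x`. -/
lemma localFactor_eq (hF : ringChar F ≠ 2) (E : WeierstrassCurve (RatFunc F))
    (v : Place F (RatFunc F)) [Fintype v.residueField] [DecidableEq v.residueField]
    (A γ : v.ring) (C₀ : VariableChange (RatFunc F))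
    (hE : C₀ • E = (cubicCurve A γ).map (algebraMap v.ring (RatFunc F)))
    (hΔ : (cubicCurve A γ).Δ ≠ 0)
    (hmin : ∀ u : RatFunc F, u ^ 4 * ((cubicCurve A γ).c₄ : v.ring) ∈ v.ring →
      u ^ 12 * ((cubicCurve A γ).Δ : v.ring) ∈ v.ring → u ∈ v.ring) :
    localFactor E v =
      1 + C (∑ x : v.residueField, quadraticChar v.residueField
        (x ^ 3 + IsLocalRing.residue v.ring A * x ^ 2 + IsLocalRing.residue v.ring γ * x)) *
          X ^ v.degree +
        C (if IsLocalRing.residue v.ring γ = 0 ∨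
          IsLocalRing.residue v.ring A ^ 2 = 4 * IsLocalRing.residue v.ring γ then 0 else
            (Fintype.card v.residueField : ℤ)) * X ^ (2 * v.degree) := by
  have hk := ringChar_residueField hF v
  obtain ⟨D, hD⟩ := exists_integralModel_minimal_eq_smul (isUnit_two hF v) E (cubicCurve A γ) C₀
    hE hΔ (by
      rintro u ⟨c, hc⟩ ⟨d, hd⟩
      exact ⟨⟨u, hmin u (by
        have : (algebraMap v.ring (RatFunc F) c) ∈ v.ring := c.2
        rwa [hc] at this) (by
        have : (algebraMap v.ring (RatFunc F) d) ∈ v.ring := d.2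
        rwa [hd] at this)⟩, rfl⟩)
  have hred : reductionAt E v = D.map (IsLocalRing.residue v.ring) •
      cubicCurve (IsLocalRing.residue v.ring A) (IsLocalRing.residue v.ring γ) := by
    rw [reductionAt, reduction, hD, ← map_cubicCurve, map_variableChange]
  have htrace : traceAt E v = -∑ x : v.residueField, quadraticChar v.residueField
      (x ^ 3 + IsLocalRing.residue v.ring A * x ^ 2 + IsLocalRing.residue v.ring γ * x) := by
    rw [traceAt, hred, numPoints_smul, numPoints_cubicCurve hk, Nat.card_eq_fintype_card]
    ring
  have hgood : (E.minimal v.ring).HasGoodReduction v.ring ↔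
      ¬(IsLocalRing.residue v.ring γ = 0 ∨
        IsLocalRing.residue v.ring A ^ 2 = 4 * IsLocalRing.residue v.ring γ) := by
    rw [hasGoodReduction_iff_isElliptic_reduction]
    change (reductionAt E v).IsElliptic ↔ _
    rw [hred, WeierstrassCurve.isElliptic_iff, variableChange_Δ, cubicCurve_Δ,
      isUnit_iff_ne_zero, not_iff_not]
    have h2 : (2 : v.residueField) ≠ 0 := Ring.two_ne_zero hk
    have h16 : (16 : v.residueField) ≠ 0 := by
      have : (16 : v.residueField) = 2 ^ 4 := by norm_num
      rw [this]; exact pow_ne_zero 4 h2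
    rw [mul_eq_zero, mul_eq_zero, mul_eq_zero, sub_eq_zero]
    simp [h16]
  have hq : ((Nat.card F : ℤ) ^ v.degree) = Fintype.card v.residueField := by
    rw [← Nat.card_eq_fintype_card, natCard_residueField]; push_cast; rfl
  rw [localFactor, htrace, hq]
  by_cases h : IsLocalRing.residue v.ring γ = 0 ∨
      IsLocalRing.residue v.ring A ^ 2 = 4 * IsLocalRing.residue v.ring γ
  · rw [if_neg (fun h' => hgood.mp h' h), if_pos h]
    simp
  · rw [if_pos (hgood.mpr h), if_neg h]
    simp

end LocalFactor

end EllipticL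

namespace EllipticL

/-! ### Local factors of the Artin-Schreier family. -/

section Family

open WeierstrassCurve

variable {F : Type u} [Field F] [Finite F]

lemma artinSchreier_eq (a : ℕ) : artinSchreier F a =
    algebraMap F[X] (RatFunc F) (X ^ Nat.card F ^ a - X) := by
  simp [artinSchreier]

/-- Comparison of degrees; with c = 4γ it shows that the discriminant is nonzero. -/
lemma artinSchreier_sq_ne {a : ℕ} (ha : a ≠ 0) (c : F) :
    artinSchreier F a ^ 2 ≠ algebraMap F (RatFunc F) c := by
  intro h
  rw [artinSchreier_eq, ← map_pow, IsScalarTower.algebraMap_apply F F[X] (RatFunc F)] at h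
  have h1 := congrArg natDegree (RatFunc.algebraMap_injective F h)
  rw [natDegree_pow, FiniteField.X_pow_card_pow_sub_X_natDegree_eq _ ha Finite.one_lt_card,
    algebraMap_eq, natDegree_C] at h1
  have : 0 < Nat.card F ^ a := pow_pos Nat.card_pos _
  omega

lemma curveE_eq (γ : F) (a : ℕ) :
    curveE γ a = cubicCurve (artinSchreier F a) (algebraMap F (RatFunc F) γ) := by
  rw [RatFunc.algebraMap_eq_C]; rfl

lemma ofNat_ne_zero_of_ringChar_ne_two {K : Type*} [Field K] (hK : ringChar K ≠ 2) :
    (4 : K) ≠ 0 ∧ (16 : K) ≠ 0 := by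
  have h2 : (2 : K) ≠ 0 := Ring.two_ne_zero hK
  constructor
  · have : (4 : K) = 2 ^ 2 := by norm_num
    rw [this]; exact pow_ne_zero _ h2
  · have : (16 : K) = 2 ^ 4 := by norm_num
    rw [this]; exact pow_ne_zero _ h2

lemma ringChar_ratFunc (hF : ringChar F ≠ 2) : ringChar (RatFunc F) ≠ 2 := by
  rwa [← Algebra.ringChar_eq F (RatFunc F)]

lemma curveE_Δ_ne_zero (hF : ringChar F ≠ 2) {γ : F} (hγ : γ ≠ 0) {a : ℕ} (ha : a ≠ 0) :
    (curveE γ a).Δ ≠ 0 := by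
  rw [curveE_eq, cubicCurve_Δ]
  obtain ⟨-, h16⟩ := ofNat_ne_zero_of_ringChar_ne_two (ringChar_ratFunc hF)
  refine mul_ne_zero (mul_ne_zero h16 (pow_ne_zero 2 ?_)) (sub_ne_zero.mpr ?_)
  · exact (map_ne_zero_iff _ (algebraMap F (RatFunc F)).injective).mpr hγ
  · have := artinSchreier_sq_ne ha (4 * γ)
    rwa [map_mul, map_ofNat] at this

omit [Finite F] in
lemma ValuationSubring.mem_of_pow_mem {K : Type*} [Field K] (A : ValuationSubring K) {u : K}
    {n : ℕ} (hn : n ≠ 0) (h : u ^ n ∈ A) : u ∈ A := by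
  rcases A.mem_or_inv_mem u with h' | h'
  · exact h'
  · by_cases hu : u = 0
    · rw [hu]; exact A.zero_mem
    obtain ⟨m, rfl⟩ := Nat.exists_eq_succ_of_ne_zero hn
    have : u = u ^ (m + 1) * u⁻¹ ^ m := by
      rw [inv_pow, pow_succ, mul_assoc, mul_comm u, ← mul_assoc,
        mul_inv_cancel₀ (pow_ne_zero m hu), one_mul]
    rw [this]
    exact A.mul_mem _ _ h (pow_mem h' m)

omit [Finite F] in
lemma Place.mem_of_mul_unit_mem {v : Place F (RatFunc F)} {w : v.ring} (hw : IsUnit w)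
    {z : RatFunc F} (h : z * (w : RatFunc F) ∈ v.ring) : z ∈ v.ring := by
  obtain ⟨w', hw'⟩ := hw.exists_right_inv
  have h1 : (w : RatFunc F) * (w' : RatFunc F) = 1 := congrArg Subtype.val hw'
  have : z = z * w * w' := by rw [mul_assoc, h1, mul_one]
  rw [this]
  exact v.ring.mul_mem _ _ h w'.2

omit [Finite F] in
lemma artinSchreier_mem {v : Place F (RatFunc F)} (hX : (RatFunc.X : RatFunc F) ∈ v.ring) (a : ℕ) :
    artinSchreier F a ∈ v.ring :=
  v.ring.sub_mem (pow_mem hX _) hX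

/-- The local factor of the curve at a place of the affine line. -/
lemma localFactor_curveE_affine (hF : ringChar F ≠ 2) {γ : F} (hγ : γ ≠ 0) {a : ℕ} (ha : a ≠ 0)
    {v : Place F (RatFunc F)} [Fintype v.residueField] [DecidableEq v.residueField]
    (hX : (RatFunc.X : RatFunc F) ∈ v.ring) :
    localFactor (curveE γ a) v =
      1 + C (∑ x : v.residueField, quadraticChar v.residueField
        (x ^ 3 + (v.coord ^ Nat.card F ^ a - v.coord) * x ^ 2 +
          algebraMap F v.residueField γ * x)) * X ^ v.degree +
        C (if (v.coord ^ Nat.card F ^ a - v.coord) ^ 2 = 4 * algebraMap F v.residueField γ then 0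
          else (Fintype.card v.residueField : ℤ)) * X ^ (2 * v.degree) := by
  let A : v.ring := ⟨artinSchreier F a, artinSchreier_mem hX a⟩
  let g : v.ring := algebraMap F v.ring γ
  have hE : curveE γ a = (cubicCurve A g).map (algebraMap v.ring (RatFunc F)) := by
    rw [map_cubicCurve, curveE_eq]; rfl
  have hA : IsLocalRing.residue v.ring A = v.coord ^ Nat.card F ^ a - v.coord := by
    have : A = ⟨RatFunc.X, hX⟩ ^ Nat.card F ^ a - ⟨RatFunc.X, hX⟩ := rfl
    rw [this, map_sub, map_pow, Place.coord_eq hX]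
  have hg : IsLocalRing.residue v.ring g = algebraMap F v.residueField γ := rfl
  have hg0 : algebraMap F v.residueField γ ≠ 0 :=
    (map_ne_zero_iff _ (algebraMap F v.residueField).injective).mpr hγ
  have hk := ringChar_residueField hF v
  obtain ⟨-, h16⟩ := ofNat_ne_zero_of_ringChar_ne_two hk
  -- If both reduced to zero, then A² = 3γ and A² = 4γ in the residue field, hence γ = 0.
  have hunit : IsUnit (cubicCurve A g).c₄ ∨ IsUnit (cubicCurve A g).Δ := by
    by_contra! h
    obtain ⟨h1, h2⟩ := h
    have h1 : IsLocalRing.residue v.ring (cubicCurve A g).c₄ = 0 :=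
      (IsLocalRing.residue_eq_zero_iff _).mpr h1
    have h2 : IsLocalRing.residue v.ring (cubicCurve A g).Δ = 0 :=
      (IsLocalRing.residue_eq_zero_iff _).mpr h2
    rw [← map_c₄, map_cubicCurve, cubicCurve_c₄, hg, mul_eq_zero] at h1
    rw [← map_Δ, map_cubicCurve, cubicCurve_Δ, hg, mul_eq_zero, mul_eq_zero] at h2
    have h1 := h1.resolve_left h16
    have h2 := h2.resolve_left (not_or.mpr ⟨h16, pow_ne_zero 2 hg0⟩)
    exact hg0 (by linear_combination h1 - h2)
  have h := localFactor_eq hF (curveE γ a) v A g 1 (by rw [one_smul, hE]) (by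
    intro h
    apply curveE_Δ_ne_zero hF hγ ha
    rw [hE, map_Δ, h, map_zero]) (by
    intro u h4 h12
    rcases hunit with h | h
    · exact ValuationSubring.mem_of_pow_mem _ four_ne_zero (Place.mem_of_mul_unit_mem h h4)
    · exact ValuationSubring.mem_of_pow_mem _ (by norm_num) (Place.mem_of_mul_unit_mem h h12))
  rw [h, hA, hg]
  simp only [hg0, false_or]

/-! ### The place at infinity. -/

section Infinity

variable {v : Place F (RatFunc F)}

omit [Finite F]

lemma inv_X_mem (hX : (RatFunc.X : RatFunc F) ∉ v.ring) : (RatFunc.X : RatFunc F)⁻¹ ∈ v.ring :=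
  (v.ring.mem_or_inv_mem _).resolve_left hX

lemma residue_inv_X (hX : (RatFunc.X : RatFunc F) ∉ v.ring) :
    IsLocalRing.residue v.ring ⟨_, inv_X_mem hX⟩ = 0 := by
  rw [IsLocalRing.residue_eq_zero_iff, IsLocalRing.mem_maximalIdeal, mem_nonunits_iff,
    Place.isUnit_iff_inv_mem _ (inv_ne_zero RatFunc.X_ne_zero), inv_inv]
  exact hX

/-- A polynomial is a power of `t` times a unit at infinity. -/
lemma exists_unit_polynomial (hX : (RatFunc.X : RatFunc F) ∉ v.ring) {f : F[X]} (hf : f ≠ 0) :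
    ∃ w ∈ v.ring, w⁻¹ ∈ v.ring ∧ w ≠ 0 ∧
      algebraMap F[X] (RatFunc F) f = RatFunc.X ^ f.natDegree * w := by
  let s : v.ring := ⟨_, inv_X_mem hX⟩
  have hu : IsUnit (aeval s f.reverse) := by
    by_contra h
    have h1 : IsLocalRing.residue v.ring (aeval s f.reverse) = 0 :=
      (IsLocalRing.residue_eq_zero_iff _).mpr h
    have h2 : IsLocalRing.residue v.ring (aeval s f.reverse) =
        aeval (IsLocalRing.residue v.ring s) f.reverse :=
      (aeval_algebraMap_apply v.residueField s f.reverse).symm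
    rw [h2, residue_inv_X hX, aeval_def, eval₂_at_zero, coeff_zero_reverse, map_eq_zero,
      leadingCoeff_eq_zero] at h1
    exact hf h1
  have hw0 : ((aeval s f.reverse : v.ring) : RatFunc F) ≠ 0 := by
    simpa using hu.ne_zero
  refine ⟨_, (aeval s f.reverse).2, (Place.isUnit_iff_inv_mem _ hw0).mp hu, hw0, ?_⟩
  let _ : Invertible (RatFunc.X : RatFunc F) := invertibleOfNonzero RatFunc.X_ne_zero
  have := eval₂_reverse_mul_pow (algebraMap F (RatFunc F)) RatFunc.X f
  rw [v.coe_aeval, ← aeval_ratFunc_X, aeval_def, aeval_def, ← this, mul_comm, invOf_eq_inv]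

/-- The function `1/t` is a uniformiser at infinity. -/
lemma mul_X_mem_of_inv_notMem (hX : (RatFunc.X : RatFunc F) ∉ v.ring) {z : RatFunc F}
    (hz : z⁻¹ ∉ v.ring) : z * RatFunc.X ∈ v.ring := by
  have hz0 : z ≠ 0 := by
    rintro rfl
    rw [inv_zero] at hz
    exact hz v.ring.zero_mem
  obtain ⟨w, hw, hw', hw0, hn⟩ := exists_unit_polynomial hX (RatFunc.num_ne_zero hz0)
  obtain ⟨w₁, hw₁, hw₁', hw₁0, hd⟩ := exists_unit_polynomial hX z.denom_ne_zero
  have hX0 : (RatFunc.X : RatFunc F) ≠ 0 := RatFunc.X_ne_zero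
  have hzeq : z = RatFunc.X ^ z.num.natDegree * w / (RatFunc.X ^ z.denom.natDegree * w₁) := by
    rw [← hn, ← hd, RatFunc.num_div_denom]
  rcases Nat.lt_or_ge z.num.natDegree z.denom.natDegree with h | h
  · obtain ⟨e, he⟩ := Nat.exists_eq_add_of_lt h
    have : z * RatFunc.X = (RatFunc.X)⁻¹ ^ e * (w * w₁⁻¹) := by
      rw [hzeq, he, inv_pow]
      field_simp
      ring
    rw [this]
    exact v.ring.mul_mem _ _ (pow_mem (inv_X_mem hX) e) (v.ring.mul_mem _ _ hw hw₁')
  · exfalso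
    apply hz
    obtain ⟨e, he⟩ := Nat.exists_eq_add_of_le h
    have : z⁻¹ = (RatFunc.X)⁻¹ ^ e * (w₁ * w⁻¹) := by
      rw [hzeq, he, inv_pow]
      field_simp
      ring
    rw [this]
    exact v.ring.mul_mem _ _ (pow_mem (inv_X_mem hX) e) (v.ring.mul_mem _ _ hw₁ hw')

/-- Since 1/t has valuation 1, the inequality 2·ord(u) + 1 ≥ 0 forces ord(u) ≥ 0. -/
lemma mem_of_sq_mul_inv_X_mem (hX : (RatFunc.X : RatFunc F) ∉ v.ring) {u : RatFunc F}
    (hu : u ^ 2 * RatFunc.X⁻¹ ∈ v.ring) : u ∈ v.ring := by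
  by_contra h
  have hu0 : u ≠ 0 := by
    rintro rfl
    exact h v.ring.zero_mem
  have h1 := mul_X_mem_of_inv_notMem hX (z := u⁻¹) (by rwa [inv_inv])
  apply hX
  have : (RatFunc.X : RatFunc F) = (u ^ 2 * RatFunc.X⁻¹) * (u⁻¹ * RatFunc.X) ^ 2 := by
    have hX0 : (RatFunc.X : RatFunc F) ≠ 0 := RatFunc.X_ne_zero
    field_simp
  rw [this]
  exact v.ring.mul_mem _ _ hu (pow_mem h1 2)

end Infinity

/-- The local factor of the curve at infinity is trivial. -/
lemma localFactor_curveE_infinity (hF : ringChar F ≠ 2) {γ : F} (hγ : γ ≠ 0) {a : ℕ} (ha : a ≠ 0)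
    {v : Place F (RatFunc F)} (hX : (RatFunc.X : RatFunc F) ∉ v.ring) :
    localFactor (curveE γ a) v = 1 := by
  classical
  have := Fintype.ofFinite F
  have := Fintype.ofFinite v.residueField
  have hX0 : (RatFunc.X : RatFunc F) ≠ 0 := RatFunc.X_ne_zero
  obtain ⟨m, hm⟩ : ∃ m, Nat.card F ^ a = 2 * m + 1 := by
    have h1 := FiniteField.odd_card_of_char_ne_two hF
    rw [← Nat.card_eq_fintype_card] at h1
    have h2 : Odd (Nat.card F ^ a) := (Nat.odd_iff.mpr h1).pow
    exact h2
  have hm0 : m ≠ 0 := by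
    have : 1 < Nat.card F ^ a := Nat.one_lt_pow ha Finite.one_lt_card
    omega
  let s : v.ring := ⟨_, inv_X_mem hX⟩
  have hs : IsLocalRing.residue v.ring s = 0 := residue_inv_X hX
  have hsc : (s : RatFunc F) = RatFunc.X⁻¹ := rfl
  let A : v.ring := s * (1 - s ^ (2 * m))
  let g : v.ring := algebraMap F v.ring γ * s ^ (4 * m + 4)
  -- As q^a = 2m + 1, the scaling u = t^(m+1) is the smallest power of t that makes a₂/u² integral:
  -- it becomes s(1 - s^(2m)) with s = 1/t.
  let D : VariableChange (RatFunc F) := ⟨Units.mk0 (RatFunc.X ^ (m + 1)) (pow_ne_zero _ hX0), 0, 0, 0⟩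
  have hE : D • curveE γ a = (cubicCurve A g).map (algebraMap v.ring (RatFunc F)) := by
    have hA : algebraMap v.ring (RatFunc F) A = RatFunc.X⁻¹ * (1 - RatFunc.X⁻¹ ^ (2 * m)) := rfl
    have hg : algebraMap v.ring (RatFunc F) g =
      algebraMap F (RatFunc F) γ * RatFunc.X⁻¹ ^ (4 * m + 4) := rfl
    rw [map_cubicCurve, curveE_eq, hA, hg]
    ext
    · simp [variableChange_a₁, cubicCurve, D]
    · simp only [variableChange_a₂, cubicCurve, D, artinSchreier, hm, Units.val_inv_eq_inv_val,
        Units.val_mk0, inv_pow]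
      field_simp
      ring
    · simp [variableChange_a₃, cubicCurve, D]
    · simp only [variableChange_a₄, cubicCurve, D, Units.val_inv_eq_inv_val, Units.val_mk0, inv_pow]
      field_simp
      ring
    · simp [variableChange_a₆, cubicCurve, D]
  have hk := ringChar_residueField hF v
  obtain ⟨-, h16⟩ := ofNat_ne_zero_of_ringChar_ne_two hk
  -- So c₄ is a unit times s², of valuation 2 < 4, and the equation is minimal without recourse to
  -- Δ.
  have hc₄ : (cubicCurve A g).c₄ =
      16 * ((1 - s ^ (2 * m)) ^ 2 - 3 * algebraMap F v.ring γ * s ^ (4 * m + 2)) * s ^ 2 := by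
    rw [cubicCurve_c₄]
    simp only [A, g]
    ring
  have hunit : IsUnit
      (16 * ((1 - s ^ (2 * m)) ^ 2 - 3 * algebraMap F v.ring γ * s ^ (4 * m + 2))) := by
    by_contra h
    have h1 := (IsLocalRing.residue_eq_zero_iff _).mpr h
    rw [map_mul, map_sub, map_pow, map_sub, map_mul, map_pow, map_pow, hs,
      zero_pow (by omega), zero_pow (by omega)] at h1
    simp only [map_ofNat, map_one, sub_zero, one_pow, mul_zero, mul_one] at h1
    exact h16 h1
  have h := localFactor_eq hF (curveE γ a) v A g D hE (by
    intro h
    have h1 : (D • curveE γ a).Δ = 0 := by rw [hE, map_Δ, h, map_zero]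
    rw [variableChange_Δ, mul_eq_zero] at h1
    exact curveE_Δ_ne_zero hF hγ ha (h1.resolve_left (pow_ne_zero _ (Units.ne_zero _)))) (by
    intro u h4 _
    rw [hc₄, mul_comm (16 * _) (s ^ 2), MulMemClass.coe_mul, ← mul_assoc] at h4
    have h5 := Place.mem_of_mul_unit_mem hunit h4
    have h6 : (u ^ 2 * RatFunc.X⁻¹) ^ 2 ∈ v.ring := by
      rw [mul_pow, ← pow_mul]
      exact h5
    exact mem_of_sq_mul_inv_X_mem hX (ValuationSubring.mem_of_pow_mem _ two_ne_zero h6))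
  have hA0 : IsLocalRing.residue v.ring A = 0 := by
    simp only [A]; rw [map_mul, hs, zero_mul]
  have hg0 : IsLocalRing.residue v.ring g = 0 := by
    simp only [g]; rw [map_mul, map_pow, hs, zero_pow (by omega), mul_zero]
  -- The reduction is the cusp y² = x³, and λ(x³) = λ(x) sums to zero.
  have hsum : ∑ x : v.residueField, quadraticChar v.residueField
      (x ^ 3 + 0 * x ^ 2 + 0 * x) = 0 := by
    rw [← quadraticChar_sum_zero hk]
    refine Finset.sum_congr rfl fun x _ => ?_
    by_cases hx : x = 0
    · simp [hx]
    · have : x ^ 3 + 0 * x ^ 2 + 0 * x = x ^ 2 * x := by ring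
      rw [this, map_mul, quadraticChar_sq_one' hx, one_mul]
  rw [h, hA0, hg0, hsum]
  simp

end Family

end EllipticL

namespace EllipticL

/-! ### Logarithmic derivatives and infinite products of power series. -/

section PowerSeries

open Finset

variable {R : Type*} [CommRing R]

lemma coeff_X_mul_derivative (f : R⟦X⟧) (n : ℕ) :
    PowerSeries.coeff n (PowerSeries.X * PowerSeries.derivative (R := R) f) =
      n * PowerSeries.coeff n f := by
  cases n with
  | zero => simp
  | succ n =>
    rw [PowerSeries.coeff_succ_X_mul, PowerSeries.coeff_derivative, mul_comm]
    push_cast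
    rfl

lemma coeff_zero_one_add_X_add (s e : R) : PowerSeries.coeff 0
    (1 + PowerSeries.C s * PowerSeries.X + PowerSeries.C e * PowerSeries.X ^ 2) = 1 := by
  simp

lemma coeff_zero_one_add_add (s e : R) {d : ℕ} (hd : d ≠ 0) :
    (1 + C s * X ^ d + C e * X ^ (2 * d) : R[X]).coeff 0 = 1 := by
  simp [hd, hd.symm]

lemma X_mul_derivative_expand {d : ℕ} (hd : d ≠ 0) (f : R⟦X⟧) :
    PowerSeries.X * PowerSeries.derivative (R := R) (PowerSeries.expand d hd f) =
      (d : R⟦X⟧) * PowerSeries.expand d hd (PowerSeries.X * PowerSeries.derivative (R := R) f) := by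
  ext n
  have : (d : R⟦X⟧) = PowerSeries.C (d : R) := by simp
  rw [coeff_X_mul_derivative, this, PowerSeries.coeff_C_mul, PowerSeries.coeff_expand,
    PowerSeries.coeff_expand]
  split_ifs with h
  · rw [coeff_X_mul_derivative, ← mul_assoc, ← Nat.cast_mul, Nat.mul_div_cancel' h]
  · rw [mul_zero, mul_zero]

lemma X_mul_derivative_mul {f g s t : R⟦X⟧}
    (hf : PowerSeries.X * PowerSeries.derivative (R := R) f = s * f)
    (hg : PowerSeries.X * PowerSeries.derivative (R := R) g = t * g) :
    PowerSeries.X * PowerSeries.derivative (R := R) (f * g) = (s + t) * (f * g) := by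
  rw [Derivation.leibniz, smul_eq_mul, smul_eq_mul]
  linear_combination g * hf + f * hg

lemma X_mul_derivative_of_mul_eq_one {f g s : R⟦X⟧} (h : g * f = 1)
    (hf : PowerSeries.X * PowerSeries.derivative (R := R) f = s * f) :
    PowerSeries.X * PowerSeries.derivative (R := R) g = -s * g := by
  have h1 := congrArg (PowerSeries.derivative (R := R)) h
  rw [Derivation.leibniz, smul_eq_mul, smul_eq_mul, Derivation.map_one_eq_zero] at h1
  linear_combination (PowerSeries.X * g) * h1 - g ^ 2 * hf
    + (-PowerSeries.X * PowerSeries.derivative (R := R) g - s * g) * h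

lemma X_mul_derivative_prod {ι : Type*} (S : Finset ι) {f t : ι → R⟦X⟧}
    (h : ∀ i ∈ S, PowerSeries.X * PowerSeries.derivative (R := R) (f i) = t i * f i) :
    PowerSeries.X * PowerSeries.derivative (R := R) (∏ i ∈ S, f i) =
      (∑ i ∈ S, t i) * ∏ i ∈ S, f i := by
  classical
  induction S using Finset.induction_on with
  | empty => simp
  | insert i S hi ih =>
    rw [prod_insert hi, sum_insert hi]
    exact X_mul_derivative_mul (h i (mem_insert_self i S))
      (ih fun j hj => h j (mem_insert_of_mem hj))

/-- A power series in characteristic zero is determined by its constant coefficient and its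
logarithmic derivative. -/
lemma eq_of_X_mul_derivative [IsDomain R] [CharZero R] {f g s : R⟦X⟧}
    (hs : PowerSeries.coeff 0 s = 0) (h0 : PowerSeries.coeff 0 f = PowerSeries.coeff 0 g)
    (hf : PowerSeries.X * PowerSeries.derivative (R := R) f = s * f)
    (hg : PowerSeries.X * PowerSeries.derivative (R := R) g = s * g) : f = g := by
  ext n
  induction n using Nat.strong_induction_on with
  | _ n ih =>
    rcases Nat.eq_zero_or_pos n with rfl | hn
    · exact h0
    have h1 := congrArg (PowerSeries.coeff n) hf
    have h2 := congrArg (PowerSeries.coeff n) hg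
    rw [coeff_X_mul_derivative, PowerSeries.coeff_mul] at h1 h2
    have h3 : (n : R) ≠ 0 := Nat.cast_ne_zero.mpr hn.ne'
    apply mul_left_cancel₀ h3
    rw [h1, h2]
    refine sum_congr rfl fun p hp => ?_
    rw [HasAntidiagonal.mem_antidiagonal] at hp
    rcases Nat.eq_zero_or_pos p.1 with h | h
    · rw [h, hs, zero_mul, zero_mul]
    · rw [ih p.2 (by omega)]

lemma X_pow_dvd_prod_sub_one {ι : Type*} (S : Finset ι) {e : ι → R⟦X⟧} {n : ℕ}
    (h : ∀ i ∈ S, PowerSeries.X ^ n ∣ e i - 1) : PowerSeries.X ^ n ∣ ∏ i ∈ S, e i - 1 := by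
  classical
  induction S using Finset.induction_on with
  | empty => simp
  | insert i S hi ih =>
    rw [prod_insert hi]
    have : e i * ∏ j ∈ S, e j - 1 = (e i - 1) * ∏ j ∈ S, e j + (∏ j ∈ S, e j - 1) := by ring
    rw [this]
    exact dvd_add (Dvd.dvd.mul_right (h i (mem_insert_self i S)) _)
      (ih fun j hj => h j (mem_insert_of_mem hj))

lemma coeff_prod_eq_of_subset {ι : Type*} {S T : Finset ι} (hST : S ⊆ T) {e : ι → R⟦X⟧} {n : ℕ}
    (h : ∀ i ∉ S, PowerSeries.X ^ (n + 1) ∣ e i - 1) :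
    PowerSeries.coeff n (∏ i ∈ T, e i) = PowerSeries.coeff n (∏ i ∈ S, e i) := by
  classical
  have h1 := X_pow_dvd_prod_sub_one (T \ S) fun i hi => h i (mem_sdiff.mp hi).2
  have h2 : PowerSeries.X ^ (n + 1) ∣ ∏ i ∈ T, e i - ∏ i ∈ S, e i := by
    rw [← prod_sdiff hST]
    have : (∏ i ∈ T \ S, e i) * ∏ i ∈ S, e i - ∏ i ∈ S, e i =
      (∏ i ∈ T \ S, e i - 1) * ∏ i ∈ S, e i := by ring
    rw [this]
    exact Dvd.dvd.mul_right h1 _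
  have h3 := PowerSeries.X_pow_dvd_iff.mp h2 n n.lt_succ_self
  rwa [map_sub, sub_eq_zero] at h3

/-- An infinite product of power series converges if the factors are congruent to one modulo
arbitrarily high powers of the variable, with finitely many exceptions. -/
lemma exists_hasProd [TopologicalSpace R] {ι : Type*} {e : ι → R⟦X⟧} (S : ℕ → Finset ι)
    (h : ∀ n, ∀ i ∉ S n, PowerSeries.X ^ (n + 1) ∣ e i - 1) :
    ∃ P : R⟦X⟧, HasProd e P ∧ ∀ N n, n ≤ N →
      PowerSeries.coeff n P = PowerSeries.coeff n (∏ i ∈ S N, e i) := by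
  classical
  refine ⟨PowerSeries.mk fun n => PowerSeries.coeff n (∏ i ∈ S n, e i), ?_, ?_⟩
  · rw [HasProd, PowerSeries.WithPiTopology.tendsto_iff_coeff_tendsto]
    intro n
    -- Each coefficient of the partial products is eventually constant, so the topology on R is
    -- irrelevant.
    refine tendsto_nhds_of_eventually_eq ?_
    rw [SummationFilter.unconditional_filter]
    filter_upwards [Filter.eventually_ge_atTop (S n)] with T hT
    rw [PowerSeries.coeff_mk]
    exact coeff_prod_eq_of_subset hT (h n)
  · intro N n hn
    rw [PowerSeries.coeff_mk, ← coeff_prod_eq_of_subset (subset_union_left (s₂ := S N)) (h n)]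
    exact coeff_prod_eq_of_subset subset_union_right fun i hi =>
      (pow_dvd_pow _ (by omega)).trans (h N i hi)

end PowerSeries

/-! ### The Euler product of the curve. -/

section EulerProduct

open Finset

variable {F : Type u} [Field F] [Finite F]

lemma eulerFactor_mul_localFactor {E : WeierstrassCurve (RatFunc F)} {v : Place F (RatFunc F)}
    {l : ℤ[X]} (hl : localFactor E v = l) (h0 : l.coeff 0 = 1) :
    eulerFactor E v * (l : ℤ⟦X⟧) = 1 := by
  rw [eulerFactor, hl, PowerSeries.invOfUnit_mul]
  rw [← PowerSeries.coeff_zero_eq_constantCoeff_apply, Polynomial.coeff_coe, h0]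
  rfl

variable (hF : ringChar F ≠ 2) {γ : F} (hγ : γ ≠ 0) {a : ℕ} (ha : a ≠ 0)
include hF hγ ha

lemma eulerFactor_curveE_infinity {v : Place F (RatFunc F)}
    (hX : (RatFunc.X : RatFunc F) ∉ v.ring) : eulerFactor (curveE γ a) v = 1 := by
  have := eulerFactor_mul_localFactor (localFactor_curveE_infinity hF hγ ha hX) (by simp)
  simpa using this

/-- The Euler factor of the curve at an affine place, through its logarithmic derivative. -/
lemma exists_logDeriv_eulerFactor {v : Place F (RatFunc F)}
    (hX : (RatFunc.X : RatFunc F) ∈ v.ring) :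
    PowerSeries.X ^ v.degree ∣ eulerFactor (curveE γ a) v - 1 ∧ ∃ t : ℤ⟦X⟧,
      PowerSeries.X * PowerSeries.derivative (R := ℤ) (eulerFactor (curveE γ a) v) =
        t * eulerFactor (curveE γ a) v ∧
      (∀ n, n = 0 ∨ ¬ v.degree ∣ n → PowerSeries.coeff n t = 0) ∧
      ∀ (L : Type) [Field L] [Fintype L] [DecidableEq L] [Algebra F L],
        v.degree ∣ Module.finrank F L → PowerSeries.coeff (Module.finrank F L) t =
          -∑ σ : v.residueField →ₐ[F] L, ∑ x : L, quadraticChar L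
            (x ^ 3 + (σ v.coord ^ Nat.card F ^ a - σ v.coord) * x ^ 2 + algebraMap F L γ * x) := by
  classical
  have := Fintype.ofFinite v.residueField
  have hd0 : v.degree ≠ 0 := v.degree_pos.ne'
  have hk := ringChar_residueField hF v
  have hg0 : algebraMap F v.residueField γ ≠ 0 :=
    (map_ne_zero_iff _ (algebraMap F v.residueField).injective).mpr hγ
  obtain ⟨s, hs0, hsL, hs⟩ := X_mul_derivative_cubic hk
    (v.coord ^ Nat.card F ^ a - v.coord) hg0
  have hs := hs _ rfl
  set l : ℤ⟦X⟧ := 1 + PowerSeries.C (∑ x : v.residueField, quadraticChar v.residueField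
        (x ^ 3 + (v.coord ^ Nat.card F ^ a - v.coord) * x ^ 2 +
          algebraMap F v.residueField γ * x)) * PowerSeries.X +
    PowerSeries.C (if (v.coord ^ Nat.card F ^ a - v.coord) ^ 2 =
        4 * algebraMap F v.residueField γ then 0
          else (Fintype.card v.residueField : ℤ)) * PowerSeries.X ^ 2 with hl
  -- The local factor is l with T replaced by T^deg v; the chain rule then produces the factor deg v
  -- in the logarithmic derivative.
  have hle : eulerFactor (curveE γ a) v * PowerSeries.expand v.degree hd0 l = 1 := by
    rw [← eulerFactor_mul_localFactor (localFactor_curveE_affine hF hγ ha hX) (coeff_zero_one_add_add _ _ hd0)]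
    congr 1
    rw [hl]
    simp only [map_add, map_mul, map_one, map_pow, PowerSeries.expand_C, PowerSeries.expand_X,
      Polynomial.coe_add, Polynomial.coe_mul, Polynomial.coe_one, Polynomial.coe_C,
      Polynomial.coe_pow, Polynomial.coe_X, ← pow_mul, mul_comm v.degree 2]
  have hlX : PowerSeries.X ^ v.degree ∣ PowerSeries.expand v.degree hd0 l - 1 := by
    rw [PowerSeries.X_pow_dvd_iff]
    intro m hm
    rw [map_sub, PowerSeries.coeff_expand]
    split_ifs with h
    · obtain rfl : m = 0 := Nat.eq_zero_of_dvd_of_lt h hm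
      rw [Nat.zero_div, hl, coeff_zero_one_add_X_add, PowerSeries.coeff_zero_one, sub_self]
    · rw [PowerSeries.coeff_one, if_neg, sub_zero]
      rintro rfl
      exact h (dvd_zero _)
  refine ⟨?_, -(v.degree * PowerSeries.expand v.degree hd0 s), ?_, ?_, ?_⟩
  · have : eulerFactor (curveE γ a) v - 1 =
        (PowerSeries.expand v.degree hd0 l - 1) * -eulerFactor (curveE γ a) v := by
      linear_combination hle
    rw [this]
    exact Dvd.dvd.mul_right hlX _
  · refine X_mul_derivative_of_mul_eq_one hle ?_
    rw [X_mul_derivative_expand, hs, map_mul, mul_assoc]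
  · have hC : (v.degree : ℤ⟦X⟧) = PowerSeries.C (v.degree : ℤ) := by simp
    rintro n hn
    rw [map_neg, hC, PowerSeries.coeff_C_mul, PowerSeries.coeff_expand]
    rcases hn with rfl | hn
    · rw [if_pos (dvd_zero _), Nat.zero_div, hs0, mul_zero, neg_zero]
    · rw [if_neg hn, mul_zero, neg_zero]
  · intro L _ _ _ _ hdvd
    have hC : (v.degree : ℤ⟦X⟧) = PowerSeries.C (v.degree : ℤ) := by simp
    rw [map_neg, hC, PowerSeries.coeff_C_mul, PowerSeries.coeff_expand, if_pos hdvd]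
    congr 1
    -- Through σ, L is an extension of F_v of degree n / deg v, so the sum is a coefficient of s
    -- independent of σ. The deg v embeddings account for the factor deg v.
    have hterm (σ : v.residueField →ₐ[F] L) : ∑ x : L, quadraticChar L
        (x ^ 3 + (σ v.coord ^ Nat.card F ^ a - σ v.coord) * x ^ 2 + algebraMap F L γ * x) =
        PowerSeries.coeff (Module.finrank F L / v.degree) s := by
      let _ : Algebra v.residueField L := σ.toRingHom.toAlgebra
      have : IsScalarTower F v.residueField L :=
        IsScalarTower.of_algebraMap_eq fun x => (σ.commutes x).symm
      have hσ (y : v.residueField) : algebraMap v.residueField L y = σ y := rfl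
      have hfin : Module.finrank F L / v.degree = Module.finrank v.residueField L := by
        rw [← Module.finrank_mul_finrank F v.residueField L]
        exact Nat.mul_div_cancel_left _ v.degree_pos
      rw [hfin, hsL L, ← IsScalarTower.algebraMap_apply, hσ, map_sub, map_pow]
    symm
    have hmem : v ∈ affinePlaces F (Module.finrank F L) :=
      (mem_affinePlaces Module.finrank_pos.ne').mpr ⟨hX, hdvd⟩
    rw [sum_congr rfl fun σ _ => hterm σ, sum_const, card_univ, card_algHom_affinePlace hmem,
      nsmul_eq_mul]

/-- The Euler product of the curve converges, and its logarithmic derivative is given by the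
character sums which count points over the finite extensions of the constant field. -/
theorem exists_hasProd_eulerFactor : ∃ P s : ℤ⟦X⟧,
    HasProd (fun v : Place F (RatFunc F) => eulerFactor (curveE γ a) v) P ∧
    PowerSeries.coeff 0 P = 1 ∧ PowerSeries.coeff 0 s = 0 ∧
    PowerSeries.X * PowerSeries.derivative (R := ℤ) P = s * P ∧
    ∀ (L : Type) [Field L] [Fintype L] [DecidableEq L] [Algebra F L],
      PowerSeries.coeff (Module.finrank F L) s = -∑ β : L, ∑ x : L, quadraticChar L
        (x ^ 3 + (β ^ Nat.card F ^ a - β) * x ^ 2 + algebraMap F L γ * x) := by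
  classical
  -- A finite set containing every affine place of degree at most n, since such a degree divides n!.
  let S (n : ℕ) : Finset (Place F (RatFunc F)) := affinePlaces F n.factorial
  have hS {n : ℕ} {v : Place F (RatFunc F)} : v ∈ S n ↔
      (RatFunc.X : RatFunc F) ∈ v.ring ∧ v.degree ∣ n.factorial :=
    mem_affinePlaces n.factorial_ne_zero
  have hSX (n : ℕ) (v : Place F (RatFunc F)) (hv : v ∉ S n) :
      PowerSeries.X ^ (n + 1) ∣ eulerFactor (curveE γ a) v - 1 := by
    by_cases hX : (RatFunc.X : RatFunc F) ∈ v.ring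
    · refine (pow_dvd_pow _ ?_).trans (exists_logDeriv_eulerFactor hF hγ ha hX).1
      by_contra! h
      exact hv (hS.mpr ⟨hX, Nat.dvd_factorial v.degree_pos (by omega)⟩)
    · rw [eulerFactor_curveE_infinity hF hγ ha hX, sub_self]
      exact dvd_zero _
  obtain ⟨P, hP, hPS⟩ := exists_hasProd S hSX
  have hex : ∀ v : Place F (RatFunc F), ∃ t : ℤ⟦X⟧, (RatFunc.X : RatFunc F) ∈ v.ring →
      PowerSeries.X * PowerSeries.derivative (R := ℤ) (eulerFactor (curveE γ a) v) =
        t * eulerFactor (curveE γ a) v ∧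
      (∀ n, n = 0 ∨ ¬ v.degree ∣ n → PowerSeries.coeff n t = 0) ∧
      ∀ (L : Type) [Field L] [Fintype L] [DecidableEq L] [Algebra F L],
        v.degree ∣ Module.finrank F L → PowerSeries.coeff (Module.finrank F L) t =
          -∑ σ : v.residueField →ₐ[F] L, ∑ x : L, quadraticChar L
            (x ^ 3 + (σ v.coord ^ Nat.card F ^ a - σ v.coord) * x ^ 2 +
              algebraMap F L γ * x) := by
    intro v
    by_cases hX : (RatFunc.X : RatFunc F) ∈ v.ring
    · obtain ⟨-, t, ht⟩ := exists_logDeriv_eulerFactor hF hγ ha hX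
      exact ⟨t, fun _ => ht⟩
    · exact ⟨0, fun h => absurd h hX⟩
  choose t ht using hex
  -- The series t v is supported on positive multiples of deg v, so only places of degree dividing i
  -- matter. For i = 0 the set `affinePlaces F 0` is empty by convention.
  have hsum {i n : ℕ} (hi : i ≤ n) : PowerSeries.coeff i (∑ v ∈ S n, t v) =
      ∑ v ∈ affinePlaces F i, PowerSeries.coeff i (t v) := by
    rw [map_sum]
    rcases Nat.eq_zero_or_pos i with rfl | hi0
    · rw [affinePlaces, dif_neg (by simp), sum_empty]
      exact sum_eq_zero fun v hv => (ht v (hS.mp hv).1).2.1 0 (Or.inl rfl)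
    · symm
      refine sum_subset (fun v hv => ?_) fun v hv hv' => ?_
      · have hv := (mem_affinePlaces hi0.ne').mp hv
        exact hS.mpr ⟨hv.1, hv.2.trans (Nat.dvd_factorial hi0 hi)⟩
      · have hX := (hS.mp hv).1
        exact (ht v hX).2.1 i (Or.inr fun h => hv' ((mem_affinePlaces hi0.ne').mpr ⟨hX, h⟩))
  refine ⟨P, PowerSeries.mk fun i => ∑ v ∈ affinePlaces F i, PowerSeries.coeff i (t v), hP,
    ?_, ?_, ?_, ?_⟩
  · have h1 := X_pow_dvd_prod_sub_one (n := 1) (S 0) (e := eulerFactor (curveE γ a))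
      fun v hv => (pow_dvd_pow _ v.degree_pos).trans
        (exists_logDeriv_eulerFactor hF hγ ha (hS.mp hv).1).1
    have h2 := PowerSeries.X_pow_dvd_iff.mp h1 0 one_pos
    rw [hPS 0 0 le_rfl]
    rwa [map_sub, sub_eq_zero, PowerSeries.coeff_zero_one] at h2
  · simp [affinePlaces]
  · ext n
    have h1 := congrArg (PowerSeries.coeff n)
      (X_mul_derivative_prod (S n) fun v hv => (ht v (hS.mp hv).1).1)
    rw [coeff_X_mul_derivative, PowerSeries.coeff_mul] at h1
    rw [coeff_X_mul_derivative, hPS n n le_rfl, h1, PowerSeries.coeff_mul]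
    refine sum_congr rfl fun p hp => ?_
    have hp := HasAntidiagonal.mem_antidiagonal.mp hp
    rw [hsum (by omega), PowerSeries.coeff_mk, hPS n p.2 (by omega)]
  · intro L _ _ _ _
    rw [PowerSeries.coeff_mk, sum_eq_sum_affinePlaces (F := F), ← sum_neg_distrib]
    refine sum_congr rfl fun v hv => ?_
    have hv := (mem_affinePlaces Module.finrank_pos.ne').mp hv
    exact (ht v hv.1).2.2 L hv.2

end EulerProduct

end EllipticL

namespace EllipticL

/-! ### The Fourier computation of the character sum of the family. -/

section CharacterSums

open Finset

variable {L : Type*} [Field L] [Fintype L] [DecidableEq L]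
variable {R : Type*} [CommRing R] [IsDomain R] [CharZero R]

variable (R) in
lemma quadraticChar_comp_ne_one (hL : ringChar L ≠ 2) :
    (quadraticChar L).ringHomComp (Int.castRingHom R) ≠ 1 :=
  (MulChar.ringHomComp_ne_one_iff (RingHom.injective_int _)).mpr (quadraticChar_ne_one hL)

lemma gaussSum_quadraticChar_sq (hL : ringChar L ≠ 2) {Ψ : AddChar L R} (hΨ : Ψ ≠ 1) :
    (∑ x : L, (quadraticChar L x : R) * Ψ x) ^ 2 = quadraticChar L (-1) * Fintype.card L :=
  gaussSum_sq (quadraticChar_comp_ne_one R hL) ((quadraticChar_isQuadratic L).comp _)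
    (AddChar.IsPrimitive.of_ne_one hΨ)

lemma sum_quadraticChar_mul_addChar (hL : ringChar L ≠ 2) (Ψ : AddChar L R) (z : L) :
    ∑ x : L, (quadraticChar L x : R) * Ψ (z * x) =
      quadraticChar L z * ∑ x : L, (quadraticChar L x : R) * Ψ x := by
  by_cases hz : z = 0
  · subst hz
    simp only [zero_mul, AddChar.map_zero_eq_one, mul_one, MulChar.map_zero, Int.cast_zero]
    rw [← Int.cast_sum, quadraticChar_sum_zero hL, Int.cast_zero]
  · have h1 := gaussSum_mulShift ((quadraticChar L).ringHomComp (Int.castRingHom R)) Ψ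
      (Units.mk0 z hz)
    have h2 : (quadraticChar L z : R) * ∑ x : L, (quadraticChar L x : R) * Ψ (z * x) =
      ∑ x : L, (quadraticChar L x : R) * Ψ x := h1
    rw [← h2, ← mul_assoc, ← Int.cast_mul, quadraticChar_mul_self hz, Int.cast_one, one_mul]

lemma quadraticChar_cubic (A γ : L) (x : Lˣ) :
    quadraticChar L ((x : L) ^ 3 + A * (x : L) ^ 2 + γ * x) =
      quadraticChar L (x + A + γ / x) := by
  have hx : (x : L) ≠ 0 := x.ne_zero
  have : (x : L) ^ 3 + A * (x : L) ^ 2 + γ * x = (x : L) ^ 2 * (x + A + γ / x) := by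
    field_simp
  rw [this, map_mul, quadraticChar_sq_one' hx, one_mul]

/-- As Ψ(cβ) = Ψ(c^Q β^Q), the summand equals Ψ((c - c^Q)β^Q), and β^Q runs over L: orthogonality of
characters applies. -/
lemma sum_addChar_pow_sub {Ψ : AddChar L R} (hΨ : Ψ ≠ 1) {Q : ℕ}
    (hQ : Function.Bijective fun x : L => x ^ Q) (hΨQ : ∀ x, Ψ (x ^ Q) = Ψ x) (c : L) :
    ∑ β : L, Ψ (c * (β ^ Q - β)) = if c ^ Q = c then (Fintype.card L : R) else 0 := by
  have h1 (β : L) : Ψ (c * (β ^ Q - β)) = Ψ (β ^ Q * (c - c ^ Q)) := by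
    have h2 : Ψ ((c * β) ^ Q) = Ψ (c * β) := hΨQ _
    apply (AddChar.val_isUnit Ψ (c * β)).mul_right_cancel
    nth_rewrite 2 [← h2]
    rw [← AddChar.map_add_eq_mul, ← AddChar.map_add_eq_mul]
    congr 1
    ring
  rw [sum_congr rfl fun β _ => h1 β,
    Function.Bijective.sum_comp hQ fun β => Ψ (β * (c - c ^ Q)),
    AddChar.sum_mulShift _ (AddChar.IsPrimitive.of_ne_one hΨ)]
  simp only [sub_eq_zero, eq_comm]
  push_cast
  rfl

lemma sum_units_addChar_neg (Ψ : AddChar L R) (c γ : L) :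
    ∑ x : Lˣ, Ψ (-c * (x + γ / x)) = ∑ x : Lˣ, Ψ (c * (x + γ / x)) := by
  refine Fintype.sum_equiv (Equiv.neg Lˣ) _ _ fun x => ?_
  rw [Equiv.neg_apply, Units.val_neg, div_neg]
  congr 1
  ring

/-- The character sum which counts the points of the family over the affine line, as a sum of
products of Gauss sums and Kloosterman sums. -/
theorem sum_quadraticChar_cubic_family (hL : ringChar L ≠ 2) {Ψ : AddChar L R} (hΨ : Ψ ≠ 1) {Q : ℕ}
    (hodd : Odd Q) (hQ : Function.Bijective fun x : L => x ^ Q) (hΨQ : ∀ x, Ψ (x ^ Q) = Ψ x)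
    (γ : L) :
    ∑ β : L, ∑ x : L, (quadraticChar L (x ^ 3 + (β ^ Q - β) * x ^ 2 + γ * x) : R) =
      ∑ c : L, if c ≠ 0 ∧ c ^ Q = c then
        (-∑ x : L, (quadraticChar L x : R) * Ψ (c * x)) * -∑ x : Lˣ, Ψ (c * (x + γ / x))
        else 0 := by
  set G := ∑ x : L, (quadraticChar L x : R) * Ψ x with hG
  have hG2 : G ^ 2 = quadraticChar L (-1) * Fintype.card L := gaussSum_quadraticChar_sq hL hΨ
  have hcard : (Fintype.card L : R) ≠ 0 := Nat.cast_ne_zero.mpr Fintype.card_ne_zero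
  have hneg : (quadraticChar L (-1) : R) * quadraticChar L (-1) = 1 := by
    rw [← Int.cast_mul, quadraticChar_mul_self (neg_ne_zero.mpr one_ne_zero), Int.cast_one]
  have hG0 : G ≠ 0 := by
    intro h
    rw [h, zero_pow two_ne_zero] at hG2
    rcases mul_eq_zero.mp hG2.symm with h | h
    · rw [h, zero_mul] at hneg
      exact zero_ne_one hneg
    · exact hcard h
  let K (c : L) : R := ∑ x : Lˣ, Ψ (c * (x + γ / x))
  have hK (c : L) : K (-c) = K c := sum_units_addChar_neg Ψ c γ
  have hright (c : L) : (if c ≠ 0 ∧ c ^ Q = c then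
        (-∑ x : L, (quadraticChar L x : R) * Ψ (c * x)) * -K c else 0) =
      G * if c ^ Q = c then (quadraticChar L c : R) * K c else 0 := by
    rw [sum_quadraticChar_mul_addChar hL]
    by_cases h0 : c = 0
    · simp [h0]
    · by_cases h1 : c ^ Q = c
      · rw [if_pos ⟨h0, h1⟩, if_pos h1]; ring
      · rw [if_neg (fun h => h1 h.2), if_neg h1, mul_zero]
  -- The substitution c ↦ -c preserves the condition (Q is odd) and K, and multiplies λ(c) by λ(-1).
  -- This absorbs the sign in G² = λ(-1)|L|.
  have hflip : ∑ c : L, (if c ^ Q = c then (quadraticChar L c : R) * K c else 0) =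
      quadraticChar L (-1) * ∑ c : L, if c ^ Q = c then (quadraticChar L c : R) * K c else 0 := by
    rw [mul_sum, ← Equiv.sum_comp (Equiv.neg L)]
    refine sum_congr rfl fun c _ => ?_
    simp only [Equiv.neg_apply, hodd.neg_pow, neg_inj, hK]
    rw [neg_eq_neg_one_mul c, map_mul]
    split_ifs
    · push_cast; ring
    · rw [mul_zero]
  -- The Fourier expansion G·λ(y) = ∑ λ(c)Ψ(cy) at y = x + γ/x + β^Q - β; multiplying by G avoids
  -- division.
  have hterm (β : L) : G * ∑ x : L,
      (quadraticChar L (x ^ 3 + (β ^ Q - β) * x ^ 2 + γ * x) : R) =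
      ∑ c : L, (quadraticChar L c : R) * K c * Ψ (c * (β ^ Q - β)) := by
    have h1 : ∑ x : L, (quadraticChar L (x ^ 3 + (β ^ Q - β) * x ^ 2 + γ * x) : R) =
        ∑ x : Lˣ, (quadraticChar L (x + (β ^ Q - β) + γ / x) : R) := by
      rw [← sum_congr rfl fun x _ => congrArg _ (quadraticChar_cubic (β ^ Q - β) γ x),
        sum_units_eq fun x : L => (quadraticChar L (x ^ 3 + (β ^ Q - β) * x ^ 2 + γ * x) : R)]
      refine sum_congr rfl fun x _ => ?_
      split_ifs with h
      · simp [h]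
      · rfl
    rw [h1, mul_sum]
    have h2 (x : Lˣ) : G * (quadraticChar L (x + (β ^ Q - β) + γ / x) : R) =
        ∑ c : L, (quadraticChar L c : R) * (Ψ (c * (x + γ / x)) * Ψ (c * (β ^ Q - β))) := by
      rw [mul_comm, hG, ← sum_quadraticChar_mul_addChar hL]
      refine sum_congr rfl fun c _ => ?_
      rw [← AddChar.map_add_eq_mul]
      congr 2
      ring
    rw [sum_congr rfl fun x _ => h2 x, sum_comm]
    refine sum_congr rfl fun c _ => ?_
    rw [mul_assoc, sum_mul, mul_sum]
  apply mul_left_cancel₀ hG0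
  rw [sum_congr rfl fun c _ => hright c, ← mul_sum, ← mul_assoc, ← sq, hG2, mul_sum,
    sum_congr rfl fun β _ => hterm β, sum_comm, mul_right_comm, ← hflip, mul_comm, mul_sum]
  refine sum_congr rfl fun c _ => ?_
  rw [← mul_sum, sum_addChar_pow_sub hΨ hQ hΨQ]
  split_ifs
  · ring
  · ring

end CharacterSums

/-! ### Existence and uniqueness of the Kloosterman pair. -/

section KloostermanPair

open Finset

variable {k : Type u} [Field k]

lemma quadGauss_eq [Fintype k] [DecidableEq k] (ψ : AddChar k QBar) :
    quadGauss ψ = -∑ x : k, (quadraticChar k x : QBar) * ψ x := by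
  unfold quadGauss
  congr!

lemma kloosterman_eq [Fintype k] [DecidableEq k] (ψ : AddChar k QBar) (α : k) :
    kloosterman ψ α = -∑ x : kˣ, ψ (x + α / x) := by
  unfold kloosterman
  congr!

lemma liftChar_apply (ψ : AddChar k QBar) {k' : Type u} [Field k'] [Algebra k k'] (β x : k') :
    liftChar ψ β x = ψ (Algebra.trace k k' (β * x)) := rfl

lemma liftChar_self (ψ : AddChar k QBar) : liftChar ψ (1 : k) = ψ := by
  ext x
  rw [liftChar_apply, one_mul, Algebra.trace_self_apply]

variable [Finite k]

lemma isIntegral_addChar (ψ : AddChar k QBar) (x : k) : IsIntegral ℤ (ψ x) := by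
  refine IsIntegral.of_pow (n := Nat.card k) Nat.card_pos ?_
  rw [← AddChar.map_nsmul_eq_pow, card_nsmul_eq_zero', AddChar.map_zero_eq_one]
  exact isIntegral_one

lemma isIntegral_kloosterman (ψ : AddChar k QBar) (α : k) : IsIntegral ℤ (kloosterman ψ α) := by
  classical
  have := Fintype.ofFinite k
  rw [kloosterman_eq]
  exact (IsIntegral.sum _ fun x _ => isIntegral_addChar ψ _).neg

lemma isIntegral_of_sq {s p x : QBar} (hs : IsIntegral ℤ s) (hp : IsIntegral ℤ p)
    (h : x ^ 2 - s * x + p = 0) : IsIntegral ℤ x := by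
  let A := integralClosure ℤ QBar
  have : IsIntegral A x := by
    refine ⟨X ^ 2 - C (⟨s, hs⟩ : A) * X + C (⟨p, hp⟩ : A), by monicity!, ?_⟩
    simp only [eval₂_add, eval₂_sub, eval₂_pow, eval₂_X, eval₂_mul, eval₂_C]
    exact h
  exact isIntegral_trans x this

/-- The pair of algebraic integers attached to a Kloosterman sum is the pair of roots of a
quadratic polynomial. -/
lemma isKloostermanPair_iff {ψ : AddChar k QBar} (hψ : ψ ≠ 1) {α : k} (hα : α ≠ 0)
    {κ κ' : QBar} : IsKloostermanPair ψ α κ κ' ↔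
      κ + κ' = kloosterman ψ α ∧ κ * κ' = (Nat.card k : QBar) := by
  classical
  have := Fintype.ofFinite k
  constructor
  · intro h
    refine ⟨?_, h.mul_eq⟩
    -- The trivial extension already determines the sum of the pair.
    have := h.pow_add_pow_eq k
    rwa [liftChar_self, Module.finrank_self, pow_one, pow_one, Algebra.algebraMap_self_apply,
      eq_comm] at this
  · rintro ⟨hadd, hmul⟩
    have hi := isIntegral_kloosterman ψ α
    have hc : IsIntegral ℤ (Nat.card k : QBar) := by
      simpa using isIntegral_algebraMap (R := ℤ) (A := QBar) (x := Nat.card k)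
    refine ⟨isIntegral_of_sq hi hc ?_, isIntegral_of_sq hi hc ?_, hmul, ?_⟩
    · rw [← hadd, ← hmul]; ring
    · rw [← hadd, ← hmul]; ring
    · intro k' _ _ _
      have := Fintype.ofFinite k'
      rw [kloosterman_eq] at hadd
      rw [Nat.card_eq_fintype_card] at hmul
      rw [kloosterman_eq, ← sum_kloosterman_trace hψ hα hadd hmul]
      simp only [liftChar_apply, one_mul]

lemma exists_isKloostermanPair {ψ : AddChar k QBar} (hψ : ψ ≠ 1) {α : k} (hα : α ≠ 0) :
    ∃ κ κ' : QBar, IsKloostermanPair ψ α κ κ' ∧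
      ∀ η η' : QBar, IsKloostermanPair ψ α η η' → (η = κ ∧ η' = κ') ∨ (η = κ' ∧ η' = κ) := by
  obtain ⟨z, hz⟩ := IsAlgClosed.exists_pow_nat_eq
    (kloosterman ψ α ^ 2 - 4 * (Nat.card k : QBar)) two_pos
  refine ⟨(kloosterman ψ α + z) / 2, (kloosterman ψ α - z) / 2,
    (isKloostermanPair_iff hψ hα).mpr ⟨by ring, by linear_combination -hz / 4⟩, fun η η' h => ?_⟩
  obtain ⟨hadd, hmul⟩ := (isKloostermanPair_iff hψ hα).mp h
  have : (η - (kloosterman ψ α + z) / 2) * (η - (kloosterman ψ α - z) / 2) = 0 := by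
    linear_combination η * hadd - hmul - hz / 4
  rcases mul_eq_zero.mp this with h | h
  · exact Or.inl ⟨by linear_combination h, by linear_combination hadd - h⟩
  · exact Or.inr ⟨by linear_combination h, by linear_combination hadd - h⟩

end KloostermanPair

end EllipticL

namespace EllipticL

/-! ### Gauss and Kloosterman sums at geometric points. -/

section GeometricPoints

open Finset

variable {F : Type u} [Field F] [Finite F] {ψ : AddChar F QBar}

lemma placeChar_apply (v : Place F (RatFunc F)) (x : v.residueField) :
    placeChar ψ v x = ψ (Algebra.trace F v.residueField (v.coord * x)) := rfl

lemma placeChar_ne_one (hψ : ψ ≠ 1) {v : Place F (RatFunc F)} (hv : v.coord ≠ 0) :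
    placeChar ψ v ≠ 1 := by
  obtain ⟨y, hy⟩ := AddChar.ne_one_iff.mp hψ
  obtain ⟨x, hx⟩ := Algebra.trace_surjective F v.residueField y
  refine AddChar.ne_one_iff.mpr ⟨v.coord⁻¹ * x, ?_⟩
  rwa [placeChar_apply, mul_inv_cancel_left₀ hv, hx]

variable {L : Type*} [Field L] [Fintype L] [DecidableEq L] [Algebra F L]

/-- By transitivity of the trace, x ↦ ψ(Tr(σ(β_v)x)) is the character of F_v composed with the trace
from L, so Hasse-Davenport applies to L over F_v. -/
lemma gaussAt_pow (hF : ringChar F ≠ 2) (hψ : ψ ≠ 1) {v : Place F (RatFunc F)} (hv : v.coord ≠ 0)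
    (σ : v.residueField →ₐ[F] L) :
    -∑ x : L, (quadraticChar L x : QBar) * ψ (Algebra.trace F L (σ v.coord * x)) =
      gaussAt ψ v ^ (Module.finrank F L / v.degree) := by
  classical
  have := Fintype.ofFinite v.residueField
  let _ : Algebra v.residueField L := σ.toRingHom.toAlgebra
  have : IsScalarTower F v.residueField L :=
    IsScalarTower.of_algebraMap_eq fun x => (σ.commutes x).symm
  have htr (x : L) : placeChar ψ v (Algebra.trace v.residueField L x) =
      ψ (Algebra.trace F L (σ v.coord * x)) := by
    rw [placeChar_apply, ← smul_eq_mul, ← map_smul, Algebra.trace_trace, Algebra.smul_def]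
    rfl
  have hfin : Module.finrank F L / v.degree = Module.finrank v.residueField L := by
    rw [← Module.finrank_mul_finrank F v.residueField L]
    exact Nat.mul_div_cancel_left _ v.degree_pos
  rw [gaussAt, quadGauss_eq, hfin,
    ← neg_sum_quadraticChar_trace (ringChar_residueField hF v) (placeChar_ne_one hψ hv)]
  simp only [htr]

lemma sum_kloosterman_algHom (hψ : ψ ≠ 1) {γ : F} (hγ : γ ≠ 0) {v : Place F (RatFunc F)}
    (hv : v.coord ≠ 0) (σ : v.residueField →ₐ[F] L) {κ κ' : QBar}
    (hκ : IsKloostermanPairAt ψ γ v κ κ') :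
    -∑ x : Lˣ, ψ (Algebra.trace F L (σ v.coord * (x + algebraMap F L γ / x))) =
      κ ^ (Module.finrank F L / v.degree) + κ' ^ (Module.finrank F L / v.degree) := by
  classical
  have := Fintype.ofFinite v.residueField
  let _ : Algebra v.residueField L := σ.toRingHom.toAlgebra
  have : IsScalarTower F v.residueField L :=
    IsScalarTower.of_algebraMap_eq fun x => (σ.commutes x).symm
  have htr (x : L) : placeChar ψ v (Algebra.trace v.residueField L x) =
      ψ (Algebra.trace F L (σ v.coord * x)) := by
    rw [placeChar_apply, ← smul_eq_mul, ← map_smul, Algebra.trace_trace, Algebra.smul_def]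
    rfl
  have hfin : Module.finrank F L / v.degree = Module.finrank v.residueField L := by
    rw [← Module.finrank_mul_finrank F v.residueField L]
    exact Nat.mul_div_cancel_left _ v.degree_pos
  have hg0 : algebraMap F v.residueField γ ≠ 0 :=
    (map_ne_zero_iff _ (algebraMap F v.residueField).injective).mpr hγ
  obtain ⟨hadd, hmul⟩ := (isKloostermanPair_iff (placeChar_ne_one hψ hv) hg0).mp hκ
  rw [kloosterman_eq] at hadd
  rw [Nat.card_eq_fintype_card] at hmul
  rw [hfin, ← sum_kloosterman_trace (placeChar_ne_one hψ hv) hg0 hadd hmul]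
  simp only [htr, ← IsScalarTower.algebraMap_apply]

end GeometricPoints

/-! ### Comparison of logarithmic derivatives and the final formula. -/

section LFunctionFormula

open Finset

/-- The logarithmic derivative of `(1 - u T ^ d) (1 - u' T ^ d)`. -/
lemma exists_logDeriv_factor {R : Type*} [CommRing R] [IsDomain R] [CharZero R] (u u' : R) {d : ℕ} (hd : d ≠ 0) :
    ∃ t : R⟦X⟧,
      PowerSeries.X * PowerSeries.derivative (R := R)
        (((1 - C u * X ^ d) * (1 - C u' * X ^ d) : R[X]) : R⟦X⟧) =
        t * (((1 - C u * X ^ d) * (1 - C u' * X ^ d) : R[X]) : R⟦X⟧) ∧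
      ∀ n, PowerSeries.coeff n t =
        if n ≠ 0 ∧ d ∣ n then -((d : R) * (u ^ (n / d) + u' ^ (n / d))) else 0 := by
  let s (g : R) : R⟦X⟧ := PowerSeries.mk fun m => if m = 0 then 0 else -g ^ m
  have hs (g : R) : PowerSeries.X * PowerSeries.derivative (R := R)
      (PowerSeries.expand d hd (1 - PowerSeries.C g * PowerSeries.X)) =
      ((d : R⟦X⟧) * PowerSeries.expand d hd (s g)) *
        PowerSeries.expand d hd (1 - PowerSeries.C g * PowerSeries.X) := by
    rw [X_mul_derivative_expand, X_mul_derivative_one_sub_C_mul_X, map_mul, mul_assoc]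
  have hcoe : (((1 - C u * X ^ d) * (1 - C u' * X ^ d) : R[X]) : R⟦X⟧) =
      PowerSeries.expand d hd (1 - PowerSeries.C u * PowerSeries.X) *
      PowerSeries.expand d hd (1 - PowerSeries.C u' * PowerSeries.X) := by
    simp only [map_sub, map_mul, map_one, PowerSeries.expand_C, PowerSeries.expand_X,
      Polynomial.coe_sub, Polynomial.coe_mul, Polynomial.coe_one, Polynomial.coe_C,
      Polynomial.coe_pow, Polynomial.coe_X]
  refine ⟨d * PowerSeries.expand d hd (s u) + d * PowerSeries.expand d hd (s u'), ?_, fun n => ?_⟩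
  · rw [hcoe]
    exact X_mul_derivative_mul (hs u) (hs u')
  · have hC : (d : R⟦X⟧) = PowerSeries.C (d : R) := by simp
    rw [map_add, hC, PowerSeries.coeff_C_mul, PowerSeries.coeff_C_mul, PowerSeries.coeff_expand,
      PowerSeries.coeff_expand, PowerSeries.coeff_mk, PowerSeries.coeff_mk]
    by_cases hn : n = 0
    · simp [hn]
    · by_cases hdn : d ∣ n
      · have : n / d ≠ 0 := (Nat.div_pos (Nat.le_of_dvd (Nat.pos_of_ne_zero hn) hdn)
          (Nat.pos_of_ne_zero hd)).ne'
        rw [if_pos hdn, if_pos hdn, if_neg this, if_neg this, if_pos ⟨hn, hdn⟩]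
        ring
      · rw [if_neg hdn, if_neg hdn, if_neg (fun h => hdn h.2), mul_zero, add_zero]

lemma X_mul_derivative_map {R S : Type*} [CommRing R] [CommRing S] (φ : R →+* S) (f : R⟦X⟧) :
    PowerSeries.X * PowerSeries.derivative (R := S) (PowerSeries.map φ f) =
      PowerSeries.map φ (PowerSeries.X * PowerSeries.derivative (R := R) f) := by
  ext n
  rw [coeff_X_mul_derivative, PowerSeries.coeff_map, PowerSeries.coeff_map, coeff_X_mul_derivative,
    map_mul, map_natCast]

/-- The source of integrality: injectivity reflects the vanishing of the tail, so an integral series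
that is a polynomial over the larger ring is one already. -/
lemma exists_polynomial_of_map_eq {R S : Type*} [CommRing R] [CommRing S] {φ : R →+* S}
    (hφ : Function.Injective φ) {A : R⟦X⟧} {M : S[X]}
    (h : PowerSeries.map φ A = (M : S⟦X⟧)) : ∃ L : R[X], A = (L : R⟦X⟧) := by
  refine ⟨PowerSeries.trunc (M.natDegree + 1) A, ?_⟩
  ext n
  rw [Polynomial.coeff_coe, PowerSeries.coeff_trunc]
  split_ifs with hn
  · rfl
  · apply hφ
    rw [← PowerSeries.coeff_map, h, Polynomial.coeff_coe, map_zero]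
    exact coeff_eq_zero_of_natDegree_lt (by omega)

variable {F : Type u} [Field F] [Finite F]

/-- The map is the a-th power of the Frobenius automorphism of L over F. -/
lemma bijective_pow_card_pow (L : Type*) [Field L] [Finite L] [Algebra F L] (a : ℕ) :
    Function.Bijective (fun x : L => x ^ Nat.card F ^ a) ∧
      ∀ x : L, Algebra.trace F L (x ^ Nat.card F ^ a) = Algebra.trace F L x := by
  have := Fintype.ofFinite F
  let e := FiniteField.frobeniusAlgEquivOfAlgebraic F L ^ a
  have he (x : L) : e x = x ^ Nat.card F ^ a := by
    rw [AlgEquiv.coe_pow, FiniteField.coe_frobeniusAlgEquivOfAlgebraic_iterate,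
      Nat.card_eq_fintype_card]
  refine ⟨?_, fun x => ?_⟩
  · convert e.bijective using 1
    ext x
    exact (he x).symm
  · rw [← he, Algebra.trace_eq_of_algEquiv]

variable (hF : ringChar F ≠ 2) {ψ : AddChar F QBar} (hψ : ψ ≠ 1) {γ : F} (hγ : γ ≠ 0)
  {a : ℕ} (ha : a ≠ 0)
include hF hψ hγ

/-- The character sum over a finite extension which counts the points of the family, as a sum over
the places `v ≠ 0, ∞` of degree dividing `a`. -/
lemma sum_quadraticChar_family_eq {kl kl' : Place F (RatFunc F) → QBar}
    (h : ∀ v ∈ placesDividing F a, IsKloostermanPairAt ψ γ v (kl v) (kl' v))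
    (P : Finset (Place F (RatFunc F))) (hP : ∀ v, v ∈ P ↔ v ∈ placesDividing F a)
    (L : Type*) [Field L] [Fintype L] [DecidableEq L] [Algebra F L] :
    ((∑ β : L, ∑ x : L, quadraticChar L
        (x ^ 3 + (β ^ Nat.card F ^ a - β) * x ^ 2 + algebraMap F L γ * x) : ℤ) : QBar) =
      ∑ v ∈ P, if v.degree ∣ Module.finrank F L then
        (v.degree : QBar) * ((gaussAt ψ v * kl v) ^ (Module.finrank F L / v.degree) +
          (gaussAt ψ v * kl' v) ^ (Module.finrank F L / v.degree)) else 0 := by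
  classical
  have := Fintype.ofFinite F
  have hn : Module.finrank F L ≠ 0 := Module.finrank_pos.ne'
  let Ψ : AddChar L QBar := ψ.compAddMonoidHom (Algebra.trace F L).toAddMonoidHom
  have hΨ (x : L) : Ψ x = ψ (Algebra.trace F L x) := rfl
  have hΨ1 : Ψ ≠ 1 := by
    obtain ⟨y, hy⟩ := AddChar.ne_one_iff.mp hψ
    obtain ⟨x, hx⟩ := Algebra.trace_surjective F L y
    exact AddChar.ne_one_iff.mpr ⟨x, by rwa [hΨ, hx]⟩
  have hodd : Odd (Nat.card F ^ a) := by
    rw [Nat.card_eq_fintype_card]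
    exact (Nat.odd_iff.mpr (FiniteField.odd_card_of_char_ne_two hF)).pow
  obtain ⟨hbij, htr⟩ := bijective_pow_card_pow (F := F) L a
  push_cast
  rw [sum_quadraticChar_cubic_family (ringChar_ne_two_of_algebra (k := F) hF) hΨ1 hodd hbij
    (fun x => by rw [hΨ, hΨ, htr]), sum_eq_sum_affinePlaces (F := F), ← sum_filter]
  have hset : P.filter (fun v => v.degree ∣ Module.finrank F L) =
      (affinePlaces F (Module.finrank F L)).filter (fun v => v ∈ P) := by
    ext v
    rw [mem_filter, mem_filter, mem_affinePlaces hn, hP]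
    exact ⟨fun h => ⟨⟨h.1.1, h.2⟩, h.1⟩, fun h => ⟨h.2, h.1.2⟩⟩
  rw [hset, sum_filter]
  refine sum_congr rfl fun v hv => ?_
  have hX := ((mem_affinePlaces hn).mp hv).1
  -- The condition on c is invariant under embeddings, so it selects whole places, each with deg v
  -- points.
  have hiff (σ : v.residueField →ₐ[F] L) :
      (σ v.coord ≠ 0 ∧ σ v.coord ^ Nat.card F ^ a = σ v.coord) ↔ v ∈ P := by
    have hinj : Function.Injective σ := σ.injective
    rw [hP, mem_placesDividing_iff hX, ← map_pow, hinj.eq_iff, _root_.map_ne_zero]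
  by_cases hvP : v ∈ P
  · rw [if_pos hvP]
    have hvP' := (hP v).mp hvP
    have hc := ((mem_placesDividing_iff hX a).mp hvP').1
    have hterm (σ : v.residueField →ₐ[F] L) :
        (if σ v.coord ≠ 0 ∧ σ v.coord ^ Nat.card F ^ a = σ v.coord then
          (-∑ x : L, (quadraticChar L x : QBar) * Ψ (σ v.coord * x)) *
            -∑ x : Lˣ, Ψ (σ v.coord * (x + algebraMap F L γ / x)) else 0) =
        (gaussAt ψ v * kl v) ^ (Module.finrank F L / v.degree) +
          (gaussAt ψ v * kl' v) ^ (Module.finrank F L / v.degree) := by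
      rw [if_pos ((hiff σ).mpr hvP)]
      simp only [hΨ]
      rw [gaussAt_pow hF hψ hc, sum_kloosterman_algHom hψ hγ hc σ (h v hvP')]
      ring
    rw [sum_congr rfl fun σ _ => hterm σ, sum_const, card_univ, card_algHom_affinePlace hv,
      nsmul_eq_mul]
  · rw [if_neg hvP]
    exact sum_eq_zero fun σ _ => if_neg fun h => hvP ((hiff σ).mp h)

include ha

/-- The `L`-function of the curve, for a given choice of the Kloosterman pairs. -/
lemma map_lFunction_eq_prod {A s : ℤ⟦X⟧} (hA0 : PowerSeries.coeff 0 A = 1)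
    (hs0 : PowerSeries.coeff 0 s = 0)
    (hA : PowerSeries.X * PowerSeries.derivative (R := ℤ) A = s * A)
    (hs : ∀ (L : Type) [Field L] [Fintype L] [DecidableEq L] [Algebra F L],
      PowerSeries.coeff (Module.finrank F L) s = -∑ β : L, ∑ x : L, quadraticChar L
        (x ^ 3 + (β ^ Nat.card F ^ a - β) * x ^ 2 + algebraMap F L γ * x))
    {kl kl' : Place F (RatFunc F) → QBar}
    (h : ∀ v ∈ placesDividing F a, IsKloostermanPairAt ψ γ v (kl v) (kl' v)) :
    PowerSeries.map (Int.castRingHom QBar) A =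
      ((∏ v ∈ (finite_placesDividing F ha).toFinset,
        (1 - C (gaussAt ψ v * kl v) * X ^ v.degree) *
        (1 - C (gaussAt ψ v * kl' v) * X ^ v.degree) : QBar[X]) : QBar⟦X⟧) := by
  classical
  have := Fintype.ofFinite F
  set P := (finite_placesDividing F ha).toFinset
  have hP (v : Place F (RatFunc F)) : v ∈ P ↔ v ∈ placesDividing F a :=
    Set.Finite.mem_toFinset _
  choose t ht htc using fun v : Place F (RatFunc F) =>
    exists_logDeriv_factor (gaussAt ψ v * kl v) (gaussAt ψ v * kl' v) v.degree_pos.ne'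
  have hM := X_mul_derivative_prod P fun v _ => ht v
  have hcoe : ((∏ v ∈ P, (1 - C (gaussAt ψ v * kl v) * X ^ v.degree) *
      (1 - C (gaussAt ψ v * kl' v) * X ^ v.degree) : QBar[X]) : QBar⟦X⟧) =
      ∏ v ∈ P, (((1 - C (gaussAt ψ v * kl v) * X ^ v.degree) *
        (1 - C (gaussAt ψ v * kl' v) * X ^ v.degree) : QBar[X]) : QBar⟦X⟧) :=
    map_prod (Polynomial.coeToPowerSeries.ringHom (R := QBar)) _ _
  -- The geometric and Fourier computations meet here, coefficient by coefficient.
  have hts : ∑ v ∈ P, t v = PowerSeries.map (Int.castRingHom QBar) s := by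
    ext n
    rw [map_sum, PowerSeries.coeff_map]
    simp only [htc]
    rcases Nat.eq_zero_or_pos n with rfl | hn
    · simp [hs0]
    obtain ⟨L, _, _, _, hL⟩ := exists_extension_of_finrank F n hn.ne'
    have h1 := hs L
    have h2 := sum_quadraticChar_family_eq hF hψ hγ h P hP L
    rw [hL] at h1 h2
    rw [h1, eq_intCast, Int.cast_neg, h2, ← sum_neg_distrib]
    refine sum_congr rfl fun v _ => ?_
    by_cases hd : v.degree ∣ n
    · rw [if_pos ⟨hn.ne', hd⟩, if_pos hd]
    · rw [if_neg fun h => hd h.2, if_neg hd, neg_zero]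
  rw [hcoe]
  refine eq_of_X_mul_derivative (s := PowerSeries.map (Int.castRingHom QBar) s) ?_ ?_ ?_ ?_
  · rw [PowerSeries.coeff_map, hs0, map_zero]
  · rw [PowerSeries.coeff_map, hA0, map_one, ← hcoe, Polynomial.coeff_coe,
      Polynomial.coeff_zero_eq_eval_zero, eval_prod]
    symm
    refine prod_eq_one fun v _ => ?_
    simp [v.degree_pos.ne']
  · rw [X_mul_derivative_map, hA, map_mul]
  · rw [hM, hts]

end LFunctionFormula

end EllipticL

theorem mainTheorem4 {F : Type u} [Field F] [Finite F] (hF : ringChar F ≠ 2)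
    (ψ : AddChar F QBar) (hψ : ψ ≠ 1) (γ : F) (hγ : γ ≠ 0) (a : ℕ) (ha : 1 ≤ a) :
    (curveE γ a).IsElliptic ∧
    (placesDividing F a).Finite ∧
    (∀ v ∈ placesDividing F a, ∃ κ κ' : QBar, IsKloostermanPairAt ψ γ v κ κ' ∧
      ∀ η η' : QBar, IsKloostermanPairAt ψ γ v η η' → (η = κ ∧ η' = κ') ∨ (η = κ' ∧ η' = κ)) ∧
    Multipliable (fun v : Place F (RatFunc F) => eulerFactor (curveE γ a) v) ∧
    ∃ L : ℤ[X],
      lFunction F (curveE γ a) = (L : ℤ⟦X⟧) ∧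
      (∀ kl kl' : Place F (RatFunc F) → QBar,
        (∀ v ∈ placesDividing F a, IsKloostermanPairAt ψ γ v (kl v) (kl' v)) →
        L.map (Int.castRingHom QBar) = ∏ᶠ v ∈ placesDividing F a,
          (1 - C (gaussAt ψ v * kl v) * X ^ v.degree) *
          (1 - C (gaussAt ψ v * kl' v) * X ^ v.degree)) ∧
      L.map (Int.castRingHom QBar) = ∏ᶠ v ∈ placesDividing F a,
        (1 - C (gaussAt ψ v * kloostermanAt ψ γ v) * X ^ v.degree +
          C (gaussAt ψ v ^ 2 * (Nat.card F : QBar) ^ v.degree) * X ^ (2 * v.degree)) := by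
  classical
  have ha0 : a ≠ 0 := by omega
  have hΔ := curveE_Δ_ne_zero hF hγ ha0
  have hpair : ∀ v ∈ placesDividing F a, placeChar ψ v ≠ 1 ∧ algebraMap F v.residueField γ ≠ 0 :=
    fun v hv => ⟨placeChar_ne_one hψ ((mem_placesDividing_iff hv.1 a).mp hv).1,
      (map_ne_zero_iff _ (algebraMap F v.residueField).injective).mpr hγ⟩
  obtain ⟨A, s, hA, hA0, hs0, hAs, hs⟩ := exists_hasProd_eulerFactor hF hγ ha0
  have hmap : ∀ {kl kl' : Place F (RatFunc F) → QBar},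
      (∀ v ∈ placesDividing F a, IsKloostermanPairAt ψ γ v (kl v) (kl' v)) →
      PowerSeries.map (Int.castRingHom QBar) A =
        ((∏ v ∈ (finite_placesDividing F ha0).toFinset,
          (1 - C (gaussAt ψ v * kl v) * X ^ v.degree) *
          (1 - C (gaussAt ψ v * kl' v) * X ^ v.degree) : QBar[X]) : QBar⟦X⟧) :=
    fun h => map_lFunction_eq_prod hF hψ hγ ha0 hA0 hs0 hAs hs h
  have hchoose : ∀ v : Place F (RatFunc F), ∃ κ κ' : QBar, v ∈ placesDividing F a →
      IsKloostermanPairAt ψ γ v κ κ' := by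
    -- The pair is needed as a function of all places; outside P_q(a) it takes the dummy value 0.
    intro v
    by_cases hv : v ∈ placesDividing F a
    · obtain ⟨κ, κ', h, -⟩ := exists_isKloostermanPair (hpair v hv).1 (hpair v hv).2
      exact ⟨κ, κ', fun _ => h⟩
    · exact ⟨0, 0, fun h => absurd h hv⟩
  choose κ κ' hκ using hchoose
  obtain ⟨L, hL⟩ := exists_polynomial_of_map_eq (RingHom.injective_int _) (hmap hκ)
  have hLmap (M : QBar[X]) (h : PowerSeries.map (Int.castRingHom QBar) A = (M : QBar⟦X⟧)) :
      L.map (Int.castRingHom QBar) = M := by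
    rw [hL, ← Polynomial.polynomial_map_coe] at h
    exact Polynomial.coe_injective _ h
  refine ⟨⟨isUnit_iff_ne_zero.mpr hΔ⟩, finite_placesDividing F ha0,
    fun v hv => exists_isKloostermanPair (hpair v hv).1 (hpair v hv).2, hA.multipliable, L, ?_, ?_,
    ?_⟩
  · rw [lFunction, hA.tprod_eq, hL]
  · intro kl kl' h
    rw [hLmap _ (hmap h), finprod_mem_eq_finite_toFinset_prod _ (finite_placesDividing F ha0)]
  · rw [hLmap _ (hmap hκ), finprod_mem_eq_finite_toFinset_prod _ (finite_placesDividing F ha0)]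
    refine Finset.prod_congr rfl fun v hv => ?_
    have hv := (Set.Finite.mem_toFinset _).mp hv
    obtain ⟨hadd, hmul⟩ := (isKloostermanPair_iff (hpair v hv).1 (hpair v hv).2).mp (hκ v hv)
    rw [natCard_residueField] at hmul
    -- With κ + κ' = Kl(v) and κκ' = q^deg v, the two linear factors multiply out to the quadratic
    -- one.
    rw [kloostermanAt, ← hadd, ← Nat.cast_pow, ← hmul]
    simp only [map_mul, map_add, map_pow]
    ring
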